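/- Let $\mathbb{H}^4=\{(v,t): v\in\mathbb{R}^3,\ t>0\}$ be the upper half-space model of hyperbolic $4$-space, with the hyperbolic distance $\rho$ given by $\cosh\rho(x,\hat x)=1+\|x-\hat x\|^2/(2t\hat t)$, where $\|\cdot\|$ is the Euclidean norm of $\mathbb{R}^4$ and $t,\hat t$ are the last coordinates of $x,\hat x$. Use coordinates $(r,\theta,z,t)$, where $(r,\theta,z)$ are the cylindrical coordinates of $\mathbb{R}^3$ and the angle $\theta\in\mathbb{R}/\mathbb{Z}$ is measured in full turns. For irrational $\alpha\in\mathbb{R}/\mathbb{Z}$ let $g_\alpha:(r,\theta,z,t)\mapsto(r,\theta+\alpha,z+1,t)$. Fix $\varepsilon>0$, let $$T_\alpha=\{x\in\mathbb{H}^4:\ \rho(\gamma(x),x)<\varepsilon\ \text{ for some } \gamma\in\langle g_\alpha\rangle\smallsetminus\{\mathrm{id}\}\}$$ be the Margulis region, and let $C_\alpha=T_\alpha/\langle g_\alpha\rangle$ be the Margulis cusp, with the quotient distance $d([x],[y])=\inf_{n\in\mathbb{Z}}\rho(x,g_\alpha^n(y))$ and the orientation inherited from $\mathbb{R}^4$.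 **Theorem B.** Let $\alpha,\beta\in\mathbb{R}/\mathbb{Z}$ be irrational, and let $f:C_\alpha\hookrightarrow C_\beta$ be a bi-Lipschitz embedding, that is, a map for which there is a $k\ge 1$ with $k^{-1}d(p,q)\le d(f(p),f(q))\le k\,d(p,q)$ for all $p,q\in C_\alpha$. If $f$ preserves orientation, then $\alpha=\beta$ in $\mathbb{R}/\mathbb{Z}$. Without any assumption on the orientation, $\alpha=\beta$ or $\alpha=-\beta$ in $\mathbb{R}/\mathbb{Z}$. -/

import Mathlib

/-- The Euclidean space `ℝ⁴`, with coordinates `(x 0, x 1, x 2, x 3)`. -/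
abbrev E4 : Type := EuclideanSpace ℝ (Fin 4)

/-- Hyperbolic 4-space in the upper half-space model. The horizontal coordinates `x 0, x 1` carry
the polar coordinates `(r, θ)`, with `x 0 = r cos (2πθ)` and `x 1 = r sin (2πθ)`; the coordinate
`x 2` is `z`, and `x 3 > 0` is the height `t`. -/
abbrev H4 : Type := {x : E4 // 0 < x 3}

/-- The hyperbolic distance `ρ`, given by `cosh ρ(x, y) = 1 + ‖x - y‖² / (2 t_x t_y)`. -/
noncomputable def hypDist (x y : H4) : ℝ :=
  Real.arcosh (1 + ‖x.1 - y.1‖ ^ 2 / (2 * x.1 3 * y.1 3))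

/-- The isometry `(r, θ, z, t) ↦ (r, θ + a, z + b, t)`. -/
noncomputable def screwMap (a b : ℝ) (x : H4) : H4 :=
  ⟨!₂[Real.cos (2 * Real.pi * a) * x.1 0 - Real.sin (2 * Real.pi * a) * x.1 1,
      Real.sin (2 * Real.pi * a) * x.1 0 + Real.cos (2 * Real.pi * a) * x.1 1,
      x.1 2 + b,
      x.1 3], by simpa using x.2⟩

theorem screwMap_screwMap_neg (a b : ℝ) (x : H4) : screwMap a b (screwMap (-a) (-b) x) = x := by
  have h := Real.sin_sq_add_cos_sq (2 * Real.pi * a)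
  apply Subtype.ext
  ext i
  fin_cases i
  · simp [screwMap]
    linear_combination x.1 0 * h
  · simp [screwMap]
    linear_combination x.1 1 * h
  · simp [screwMap]
  · simp [screwMap]

/-- The screw translation `g_α : (r, θ, z, t) ↦ (r, θ + α, z + 1, t)`, as a bijection of
hyperbolic 4-space. -/
noncomputable def screw (α : ℝ) : Equiv.Perm H4 where
  toFun := screwMap α 1
  invFun := screwMap (-α) (-1)
  left_inv x := by simpa using screwMap_screwMap_neg (-α) (-1) x
  right_inv x := screwMap_screwMap_neg α 1 x

/-- The Margulis region `T_α`: the points that are moved by a distance less than `ε` by some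
non-identity element of the cyclic group generated by `g_α`. -/
noncomputable def margulisRegion (ε α : ℝ) : Set H4 :=
  {x | ∃ γ ∈ Subgroup.zpowers (screw α), γ ≠ 1 ∧ hypDist (γ x) x < ε}

/-- Two points of `T_α` are equivalent if they lie in the same orbit of the group generated by
`g_α`. -/
noncomputable def cuspSetoid (ε α : ℝ) : Setoid (margulisRegion ε α) :=
  (MulAction.orbitRel (Subgroup.zpowers (screw α)) H4).comap Subtype.val

/-- The Margulis cusp `C_α = T_α / ⟨g_α⟩`. -/
abbrev MargulisCusp (ε α : ℝ) : Type := Quotient (cuspSetoid ε α)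

/-- The projection `T_α → C_α`. -/
noncomputable def cuspMk {ε α : ℝ} (x : margulisRegion ε α) : MargulisCusp ε α := Quotient.mk (cuspSetoid ε α) x

/-- The quotient distance on `C_α`: the distance between two orbits, that is, the infimum of the
hyperbolic distances between their points. -/
noncomputable def cuspDist {ε α : ℝ} (p q : MargulisCusp ε α) : ℝ :=
  sInf {d : ℝ | ∃ x y : margulisRegion ε α, cuspMk x = p ∧ cuspMk y = q ∧ d = hypDist x.1 y.1}

/-- `f` is a bi-Lipschitz embedding (a bi-Lipschitz map onto its image). -/
def IsBiLipschitzEmbedding {ε α β : ℝ} (f : MargulisCusp ε α → MargulisCusp ε β) : Prop :=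
  ∃ k : ℝ, 1 ≤ k ∧ ∀ p q : MargulisCusp ε α,
    k⁻¹ * cuspDist p q ≤ cuspDist (f p) (f q) ∧ cuspDist (f p) (f q) ≤ k * cuspDist p q

/-- On the open set `U ⊆ T_α ⊆ ℝ⁴`, the continuous map `F` into `T_β` is a lift of `f`, that is,
it represents `f` in the local coordinates given by the covering maps `T_α → C_α` and
`T_β → C_β`. -/
def IsLocalLift {ε α β : ℝ} (f : MargulisCusp ε α → MargulisCusp ε β) (U : Set E4)
    (F : E4 → E4) : Prop :=
  IsOpen U ∧ ContinuousOn F U ∧ ∀ x ∈ U, ∃ (p : margulisRegion ε α) (q : margulisRegion ε β),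
    p.1.1 = x ∧ q.1.1 = F x ∧ f (cuspMk p) = cuspMk q

/-- A bi-Lipschitz embedding `f : C_α → C_β` preserves the orientations (both inherited from `ℝ⁴`)
if its local lifts have positive Jacobian determinant wherever they are differentiable. The local
lifts of such an `f` exist around every point and are locally bi-Lipschitz, so they are
differentiable almost everywhere, and the sign of the Jacobian at any such point is the local
degree. -/
def IsOrientationPreserving {ε α β : ℝ} (f : MargulisCusp ε α → MargulisCusp ε β) : Prop :=
  ∀ (U : Set E4) (F : E4 → E4), IsLocalLift f U F →
    ∀ x ∈ U, DifferentiableAt ℝ F x → 0 < (fderiv ℝ F x).det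

/-!
# Bi-Lipschitz embeddings of Margulis cusps in hyperbolic 4-space

**Lifting.** The Margulis region is not convex, but the set `tube ε α N` of the points that `g_αᴺ`
moves by less than `ε` is convex, open and `g_α`-invariant, and for a suitable `N` it contains the
far part `t ≥ T` of the cone `r ≤ t` together with all hyperbolic balls of a given radius around
its points (`exists_ball_subset_tube`). Since `ℍ⁴ → ℍ⁴ / ⟨g_β⟩` is a covering, `f` lifts to a map
`F` of this tube, with `F ∘ g_αⁿ = g_β^(mn) ∘ F` for an integer `m`. The lift is locally
bi-Lipschitz. Hence it stretches segments by a bounded factor (`IsCuspLift.upperDist_map_le`); by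
invariance of domain it is also open, so short segments that start at `F x` are images of short
paths that start at `x` (`IsCuspLift.exists_eq_of_ball_subset`). It follows that `m = ±1`, and that
far up in the cone the displacement of `g_αⁿ` at `x` and that of `g_βⁿ` at `F x` are comparable
whenever one of them is small (`exists_isConeLift`).

**Angles up to sign.** In units of the height, the squared displacement of `g_αⁿ` is
`(n² + |e^{2πinα} - 1|² r²) / t²`. Along a ray on which `t / r` is a large constant and `r → ∞`
the first summand disappears, and the comparison yields that `|e^{2πinα} - 1|` and `|e^{2πinβ} - 1|` are
comparable, with constants that do not depend on `n`. So `nα ↦ nβ` extends to an automorphism of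
the circle, and `β = σα` modulo `1` with `σ = ±1` (`IsConeLift.eq_or_eq_neg`).

**The sign.** The maps `x ↦ F (l x)`, rescaled and translated, converge along an ultrafilter to a
map `G` of the open cone `r < t`. The powers of `g_α` become dense in the group of all rotations
and translations, so `G` turns the rotation by `a` composed with the translation by `b` into the
rotation by `mσa` composed with the translation by `mqb`, for a constant `q > 0`
(`IsConeLift.isConeLimit`). Up to positive factors the Jacobian determinant of `G` is therefore
`(mσ)(mq) = σq` times that of the map which `G` induces on the sector `0 < r < t`
(`IsConeLimit.det_fderiv_eq`). The induced map is comparable to `(r, t) ↦ (r², t)` and so has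
degree one, which excludes a nowhere positive Jacobian determinant
(`not_forall_det_fderiv_nonpos`). If `f` preserves the orientation, then the Jacobian determinant
of the limit `G` is non-negative (`IsConeLift.limit_det_nonneg`), and `σ = 1`.

**Degree theory.** Invariance of domain and the statements on Jacobian determinants all rest on the
identity `∫ det Dw = 0` for compactly supported Lipschitz maps `w` (`integral_det_fderiv_eq_zero`):
the integral of a smooth density `det DH`, pulled back by a Lipschitz map, depends only on the
values of the map outside a compact set (`integral_density_comp_sub_eq_zero`).
-/

open Set Filter Topology MeasureTheory
open scoped NNReal ENNReal

/-! ### Integrals of Jacobian determinants -/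

section Jacobian

variable {E : Type*} [NormedAddCommGroup E] [NormedSpace ℝ E] [FiniteDimensional ℝ E]
  [MeasurableSpace E] [BorelSpace E] (μ : Measure E) [μ.IsAddHaarMeasure]

theorem LipschitzWith.addHaar_image_eq_zero {f : E → E} {K : ℝ≥0} (hf : LipschitzWith K f)
    {s : Set E} (hs : μ s = 0) : μ (f '' s) = 0 := by
  set ν : Measure E := Measure.hausdorffMeasure (Module.finrank ℝ E) with hν
  have : ν.IsAddHaarMeasure := by rw [hν]; infer_instance
  have h1 : ν s = 0 := by
    exact Measure.absolutelyContinuous_isAddHaarMeasure ν μ hs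
  have h2 : ν (f '' s) = 0 := by
    have := hf.hausdorffMeasure_image_le (d := Module.finrank ℝ E) (by positivity) s
    rw [← hν, h1, mul_zero] at this
    exact le_antisymm this bot_le
  exact Measure.absolutelyContinuous_isAddHaarMeasure μ ν h2

/-- The polynomial `t ↦ det (t + M) - tⁿ` has degree less than `n`, so its value at zero is a linear
combination, with coefficients that do not depend on `M`, of its values at `n` large numbers. -/
theorem ContinuousLinearMap.exists_lagrange_det (E : Type*) [NormedAddCommGroup E]
    [NormedSpace ℝ E] [FiniteDimensional ℝ E] (t₀ : ℝ) :
    ∃ (t : ℕ → ℝ) (c : ℕ → ℝ), (∀ i, t₀ < t i) ∧ ∀ M : E →L[ℝ] E,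
      M.det - 0 ^ Module.finrank ℝ E = ∑ i ∈ Finset.range (Module.finrank ℝ E),
        c i * ((t i • ContinuousLinearMap.id ℝ E + M).det - t i ^ Module.finrank ℝ E) := by
  set n := Module.finrank ℝ E with hn
  set t : ℕ → ℝ := fun i ↦ t₀ + 1 + i with ht
  have hinj : Set.InjOn t (Finset.range n : Finset ℕ) := by
    intro i _ j _ hij
    simpa [ht] using hij
  refine ⟨t, fun i ↦ Polynomial.eval 0 (Lagrange.basis (Finset.range n) t i), fun i ↦ ?_,
    fun M ↦ ?_⟩
  · have : (0 : ℝ) ≤ i := by positivity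
    simp only [ht]; linarith
  · set q : Polynomial ℝ := (-(M : E →ₗ[ℝ] E)).charpoly - Polynomial.X ^ n with hq
    have hmon : ((-(M : E →ₗ[ℝ] E)).charpoly).Monic := LinearMap.charpoly_monic _
    have hdeg : q.degree < (Finset.range n).card := by
      rw [Finset.card_range, hq]
      have h1 : ((-(M : E →ₗ[ℝ] E)).charpoly).degree = n := by
        rw [Polynomial.degree_eq_natDegree hmon.ne_zero, LinearMap.charpoly_natDegree]
      refine lt_of_lt_of_eq (Polynomial.degree_sub_lt_left ?_ hmon.ne_zero ?_) h1
      · rw [h1, Polynomial.degree_X_pow]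
      · rw [hmon.leadingCoeff, (Polynomial.monic_X_pow n).leadingCoeff]
    have heval : ∀ s : ℝ, q.eval s = (s • ContinuousLinearMap.id ℝ E + M).det - s ^ n := by
      intro s
      rw [hq, Polynomial.eval_sub, LinearMap.eval_charpoly, Polynomial.eval_pow,
        Polynomial.eval_X, sub_neg_eq_add]
      rfl
    have h0 := Lagrange.eq_interpolate hinj hdeg
    have h1 := congrArg (Polynomial.eval 0) h0
    rw [Lagrange.interpolate_apply, Polynomial.eval_finsetSum, heval, zero_smul, zero_add] at h1
    rw [h1]
    refine Finset.sum_congr rfl fun i _ ↦ ?_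
    rw [Polynomial.eval_mul, Polynomial.eval_C, heval, mul_comm]

theorem integrable_det_fderiv_sub_pow {w : E → E} {K : ℝ≥0} (hw : LipschitzWith K w)
    (hc : HasCompactSupport w) (t : ℝ) :
    Integrable (fun x ↦ (t • ContinuousLinearMap.id ℝ E + fderiv ℝ w x).det
      - t ^ Module.finrank ℝ E) μ := by
  have hm : Measurable (fun x ↦ (t • ContinuousLinearMap.id ℝ E + fderiv ℝ w x).det
      - t ^ Module.finrank ℝ E) := by
    refine (ContinuousLinearMap.continuous_det.measurable.comp ?_).sub_const _
    exact (measurable_fderiv ℝ w).const_add _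
  have hcont : Continuous (fun M : E →L[ℝ] E ↦ (t • ContinuousLinearMap.id ℝ E + M).det
      - t ^ Module.finrank ℝ E) :=
    (ContinuousLinearMap.continuous_det.comp (continuous_const.add continuous_id)).sub
      continuous_const
  obtain ⟨C, hC⟩ := ((isCompact_closedBall (0 : E →L[ℝ] E) K).image hcont).isBounded.exists_norm_le
  have hsupp : ∀ x, x ∉ tsupport w → (t • ContinuousLinearMap.id ℝ E + fderiv ℝ w x).det
      - t ^ Module.finrank ℝ E = 0 := by
    intro x hx
    rw [fderiv_of_notMem_tsupport ℝ hx, add_zero]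
    simp [ContinuousLinearMap.det]
  refine (integrableOn_iff_integrable_of_support_subset (s := tsupport w) ?_).1 ?_
  · intro x hx
    by_contra h
    exact hx (hsupp x h)
  · refine Measure.integrableOn_of_bounded (M := C) hc.isCompact.measure_lt_top.ne
      hm.aestronglyMeasurable (Eventually.of_forall fun x ↦ hC _ ⟨fderiv ℝ w x, ?_, rfl⟩)
    simpa using norm_fderiv_le_of_lipschitz ℝ hw

/-- The volume comparison behind the vanishing of the integral of a Jacobian: for large `t` the
map `x ↦ t x + w x` is a homeomorphism that agrees with `t • id` away from a compact set. -/
theorem exists_forall_integral_det_sub_pow_eq_zero {w : E → E} {K : ℝ≥0} (hw : LipschitzWith K w)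
    (hc : HasCompactSupport w) :
    ∃ t₀ : ℝ, ∀ t, t₀ < t → ∫ x, ((t • ContinuousLinearMap.id ℝ E + fderiv ℝ w x).det
      - t ^ Module.finrank ℝ E) ∂μ = 0 := by
  -- near the identity the determinant is positive
  obtain ⟨δ, hδ, hpos⟩ : ∃ δ > 0, ∀ N : E →L[ℝ] E, ‖N‖ < δ →
      0 < (ContinuousLinearMap.id ℝ E + N).det := by
    have h1 : Continuous fun N : E →L[ℝ] E ↦ (ContinuousLinearMap.id ℝ E + N).det :=
      ContinuousLinearMap.continuous_det.comp (continuous_const.add continuous_id)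
    have h2 : ∀ᶠ N in 𝓝 (0 : E →L[ℝ] E), 0 < (ContinuousLinearMap.id ℝ E + N).det := by
      refine h1.continuousAt.eventually (lt_mem_nhds ?_)
      simp [ContinuousLinearMap.det]
    obtain ⟨δ, hδ, h⟩ := Metric.eventually_nhds_iff.1 h2
    exact ⟨δ, hδ, fun N hN ↦ h (by simpa using hN)⟩
  refine ⟨max (K + 1) (K / δ), fun t ht ↦ ?_⟩
  have htK : (K : ℝ) + 1 < t := (le_max_left _ _).trans_lt ht
  have htδ : K / δ < t := (le_max_right _ _).trans_lt ht
  have ht0 : 0 < t := by have := K.2; linarith [K.coe_nonneg]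
  set s : ℝ := t⁻¹ with hs
  have hs0 : 0 < s := inv_pos.2 ht0
  set Φ : E → E := fun x ↦ x + s • w x with hΦ
  have hsK : s * K < 1 := by
    rw [hs, inv_mul_lt_iff₀ ht0]; linarith
  have happ : ApproximatesLinearOn Φ ((ContinuousLinearEquiv.refl ℝ E : E ≃L[ℝ] E) : E →L[ℝ] E)
      univ (s.toNNReal * K) := by
    intro x _ y _
    have : Φ x - Φ y - ((ContinuousLinearEquiv.refl ℝ E : E ≃L[ℝ] E) : E →L[ℝ] E) (x - y)
        = s • (w x - w y) := by
      simp [hΦ, smul_sub]; abel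
    rw [this, norm_smul, Real.norm_of_nonneg hs0.le]
    have := hw.norm_sub_le x y
    simp only [NNReal.coe_mul, Real.coe_toNNReal _ hs0.le]
    nlinarith
  -- `Φ` is a perturbation of the identity by a map with Lipschitz constant less than one
  have hcN : Subsingleton E ∨ s.toNNReal * K <
      ‖(((ContinuousLinearEquiv.refl ℝ E).symm : E ≃L[ℝ] E) : E →L[ℝ] E)‖₊⁻¹ := by
    rcases subsingleton_or_nontrivial E with h | h
    · exact Or.inl h
    · right
      have : ‖(((ContinuousLinearEquiv.refl ℝ E).symm : E ≃L[ℝ] E) : E →L[ℝ] E)‖₊ = 1 := by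
        have : (((ContinuousLinearEquiv.refl ℝ E).symm : E ≃L[ℝ] E) : E →L[ℝ] E)
          = ContinuousLinearMap.id ℝ E := rfl
        rw [this]; exact ContinuousLinearMap.nnnorm_id
      rw [this, inv_one, ← NNReal.coe_lt_coe]
      simpa [Real.coe_toNNReal _ hs0.le] using hsK
  have hinj : Function.Injective Φ := fun x y h ↦ happ.injOn hcN (mem_univ x) (mem_univ y) h
  have hsurj : Function.Surjective Φ := happ.surjective hcN
  have hΦL : LipschitzWith (1 + s.toNNReal * K) Φ := by
    refine LipschitzWith.id.add ?_
    refine LipschitzWith.of_dist_le_mul fun x y ↦ ?_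
    rw [dist_smul₀, Real.norm_of_nonneg hs0.le, NNReal.coe_mul, Real.coe_toNNReal _ hs0.le,
      mul_assoc]
    exact mul_le_mul_of_nonneg_left (hw.dist_le_mul x y) hs0.le
  obtain ⟨ρ, hρ⟩ := hc.isCompact.isBounded.subset_ball (0 : E)
  set B := Metric.ball (0 : E) ρ with hB
  have hout : ∀ x, x ∉ B → Φ x = x := by
    intro x hx
    have : w x = 0 := image_eq_zero_of_notMem_tsupport fun h ↦ hx (hρ h)
    simp [hΦ, this]
  -- `Φ` fixes the complement of `B` pointwise, so it permutes `B`
  have himage : Φ '' B = B := by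
    have h1 : Φ '' Bᶜ = Bᶜ := by
      ext y; constructor
      · rintro ⟨x, hx, rfl⟩; rwa [hout x hx]
      · intro hy; exact ⟨y, hy, hout y hy⟩
    rw [← compl_inj_iff, ← image_compl_eq ⟨hinj, hsurj⟩, h1]
  set D : Set E := {x | DifferentiableAt ℝ Φ x} with hD
  have hDm : MeasurableSet D := measurableSet_of_differentiableAt ℝ Φ
  have hDae : ∀ᵐ x ∂μ, x ∈ D := hΦL.ae_differentiableAt
  have hD0 : μ Dᶜ = 0 := hDae
  have hfd : ∀ x ∈ D, fderiv ℝ Φ x = ContinuousLinearMap.id ℝ E + s • fderiv ℝ w x := by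
    intro x hx
    have hwx : DifferentiableAt ℝ w x := by
      have : w = fun x ↦ t • (Φ x - x) := by
        ext x; simp [hΦ, smul_smul, hs, mul_inv_cancel₀ ht0.ne']
      rw [this]
      exact (DifferentiableAt.sub hx differentiableAt_id).const_smul t
    exact ((hasFDerivAt_id x).add (hwx.hasFDerivAt.const_smul s)).fderiv
  have hdetpos : ∀ x ∈ D, 0 < (fderiv ℝ Φ x).det := by
    intro x hx
    rw [hfd x hx]
    apply hpos
    rw [norm_smul, Real.norm_of_nonneg hs0.le]
    have h1 := norm_fderiv_le_of_lipschitz ℝ hw (x₀ := x)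
    have h2 : s * K < δ := by
      rw [hs, inv_mul_lt_iff₀ ht0]
      rwa [div_lt_iff₀ hδ] at htδ
    nlinarith
  -- the change of variables needs differentiability, and `Φ` maps the exceptional null set to a
  -- null set
  have hvol : ∫⁻ x in B ∩ D, ENNReal.ofReal |(fderiv ℝ Φ x).det| ∂μ = μ B := by
    rw [lintegral_abs_det_fderiv_eq_addHaar_image μ (Metric.isOpen_ball.measurableSet.inter hDm)
      (fun x hx ↦ (DifferentiableAt.hasFDerivAt hx.2).hasFDerivWithinAt) hinj.injOn]
    refine le_antisymm ((measure_mono (image_mono inter_subset_left)).trans_eq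
      (by rw [himage])) ?_
    calc μ B = μ (Φ '' B) := by rw [himage]
      _ ≤ μ (Φ '' (B ∩ D) ∪ Φ '' Dᶜ) := by
          refine measure_mono ?_
          rw [← image_union]
          exact image_mono fun x hx ↦ (em (x ∈ D)).imp (fun h ↦ ⟨hx, h⟩) id
      _ ≤ μ (Φ '' (B ∩ D)) + μ (Φ '' Dᶜ) := measure_union_le _ _
      _ = μ (Φ '' (B ∩ D)) := by rw [hΦL.addHaar_image_eq_zero μ hD0, add_zero]
  have hBfin : μ B < ⊤ := measure_ball_lt_top
  have hint : ∫ x in B, (fderiv ℝ Φ x).det ∂μ = μ.real B := by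
    rw [integral_eq_lintegral_of_nonneg_ae]
    · rw [Measure.real, ← hvol]
      congr 1
      rw [show (∫⁻ x in B, ENNReal.ofReal (fderiv ℝ Φ x).det ∂μ)
        = ∫⁻ x in B ∩ D, ENNReal.ofReal (fderiv ℝ Φ x).det ∂μ from
        setLIntegral_congr (by
          filter_upwards [hDae] with x hx
          exact propext ⟨fun h ↦ ⟨h, hx⟩, fun h ↦ h.1⟩)]
      refine setLIntegral_congr_fun (Metric.isOpen_ball.measurableSet.inter hDm) fun x hx ↦ ?_
      rw [abs_of_pos (hdetpos x hx.2)]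
    · filter_upwards [ae_restrict_of_ae hDae] with x hx using (hdetpos x hx).le
    · exact (ContinuousLinearMap.continuous_det.measurable.comp
        (measurable_fderiv ℝ Φ)).aestronglyMeasurable
  have hdet_eq : ∀ x ∈ D, (t • ContinuousLinearMap.id ℝ E + fderiv ℝ w x).det
      = t ^ Module.finrank ℝ E * (fderiv ℝ Φ x).det := by
    intro x hx
    have : t • ContinuousLinearMap.id ℝ E + fderiv ℝ w x = t • fderiv ℝ Φ x := by
      rw [hfd x hx, smul_add, smul_smul, hs, mul_inv_cancel₀ ht0.ne', one_smul]
    rw [this]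
    simp [ContinuousLinearMap.det]
  have hsub : (Function.support fun x ↦ (t • ContinuousLinearMap.id ℝ E + fderiv ℝ w x).det
      - t ^ Module.finrank ℝ E) ⊆ B := by
    intro x hx
    by_contra h
    apply hx
    dsimp only
    rw [fderiv_of_notMem_tsupport ℝ fun h' ↦ h (hρ h'), add_zero]
    simp [ContinuousLinearMap.det]
  rw [← setIntegral_eq_integral_of_forall_compl_eq_zero
    (fun x hx ↦ Function.notMem_support.1 fun h ↦ hx (hsub h))]
  have : ∫ x in B, ((t • ContinuousLinearMap.id ℝ E + fderiv ℝ w x).det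
      - t ^ Module.finrank ℝ E) ∂μ
      = ∫ x in B, t ^ Module.finrank ℝ E * ((fderiv ℝ Φ x).det - 1) ∂μ := by
    refine integral_congr_ae ?_
    filter_upwards [ae_restrict_of_ae hDae] with x hx
    rw [hdet_eq x hx]; ring
  have hi : IntegrableOn (fun x ↦ (fderiv ℝ Φ x).det) B μ := by
    have h1 : IntegrableOn (fun x ↦ (t ^ Module.finrank ℝ E)⁻¹ *
      (((t • ContinuousLinearMap.id ℝ E + fderiv ℝ w x).det - t ^ Module.finrank ℝ E)
        + t ^ Module.finrank ℝ E)) B μ :=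
      ((integrable_det_fderiv_sub_pow μ hw hc t).integrableOn.add
        (integrableOn_const hBfin.ne)).const_mul _
    refine h1.congr ?_
    filter_upwards [ae_restrict_of_ae hDae] with x hx
    rw [hdet_eq x hx]
    have : t ^ Module.finrank ℝ E ≠ 0 := (pow_pos ht0 _).ne'
    field_simp
    ring
  rw [this, integral_const_mul, integral_sub hi (integrableOn_const hBfin.ne), hint]
  simp

/-- The Jacobian determinant of a compactly supported Lipschitz map has integral zero. As a
function of `t`, the integral of `det (t + Dw) - tⁿ` is a polynomial of degree less than `n` that
vanishes for large `t`, so it also vanishes at `t = 0`. -/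
theorem integral_det_fderiv_eq_zero [Nontrivial E] {w : E → E} {K : ℝ≥0} (hw : LipschitzWith K w)
    (hc : HasCompactSupport w) : ∫ x, (fderiv ℝ w x).det ∂μ = 0 := by
  obtain ⟨t₀, h0⟩ := exists_forall_integral_det_sub_pow_eq_zero μ hw hc
  obtain ⟨t, c, ht, hM⟩ := ContinuousLinearMap.exists_lagrange_det E t₀
  have hn : Module.finrank ℝ E ≠ 0 := Module.finrank_pos.ne'
  have h1 : ∀ x, (fderiv ℝ w x).det = ∑ i ∈ Finset.range (Module.finrank ℝ E),
        c i * ((t i • ContinuousLinearMap.id ℝ E + fderiv ℝ w x).det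
          - t i ^ Module.finrank ℝ E) := fun x ↦ by
    rw [← hM, zero_pow hn, sub_zero]
  simp_rw [h1]
  rw [integral_finsetSum _ fun i _ ↦ (integrable_det_fderiv_sub_pow μ hw hc (t i)).const_mul _]
  refine Finset.sum_eq_zero fun i _ ↦ ?_
  rw [integral_const_mul, h0 _ (ht i), mul_zero]

end Jacobian

/-! ### Local degree of Lipschitz maps -/

section Degree

theorem exists_lipschitz_cutoff {E : Type*} [PseudoMetricSpace E] (p : E) {a b : ℝ} (hab : a < b) :
    ∃ (χ : E → ℝ) (K : ℝ≥0), LipschitzWith K χ ∧ (∀ x, χ x ∈ Icc (0 : ℝ) 1) ∧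
      (∀ x ∈ Metric.closedBall p a, χ x = 1) ∧ ∀ x, x ∉ Metric.ball p b → χ x = 0 := by
  have hba : 0 < b - a := sub_pos.2 hab
  refine ⟨fun x ↦ max 0 (min 1 ((b - dist x p) / (b - a))), (b - a)⁻¹.toNNReal, ?_, ?_, ?_, ?_⟩
  · have h1 : LipschitzWith (b - a)⁻¹.toNNReal fun x : E ↦ (b - dist x p) / (b - a) := by
      refine LipschitzWith.of_dist_le_mul fun x y ↦ ?_
      rw [Real.dist_eq, ← sub_div, abs_div, abs_of_pos hba, Real.coe_toNNReal _ (by positivity),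
        inv_mul_eq_div]
      refine div_le_div_of_nonneg_right ?_ hba.le
      rw [show b - dist x p - (b - dist y p) = -(dist x p - dist y p) by ring, abs_neg]
      exact abs_dist_sub_le x y p
    exact (h1.const_min 1).const_max 0
  · intro x
    exact ⟨le_max_left _ _, max_le zero_le_one (min_le_left _ _)⟩
  · intro x hx
    have : 1 ≤ (b - dist x p) / (b - a) := by
      rw [le_div_iff₀ hba]; linarith [Metric.mem_closedBall.1 hx]
    simp [min_eq_left this]
  · intro x hx
    have : (b - dist x p) / (b - a) ≤ 0 :=
      div_nonpos_of_nonpos_of_nonneg (by linarith [not_lt.1 fun h ↦ hx (Metric.mem_ball.2 h)])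
        hba.le
    exact max_eq_left ((min_le_right _ _).trans this)

theorem LipschitzWith.exists_cutoff_smul {E F : Type*} [PseudoMetricSpace E]
    [NormedAddCommGroup F] [NormedSpace ℝ F]
    {χ : E → ℝ} {K K' : ℝ≥0} {A : E → F} {p : E} {b : ℝ} (hχ : LipschitzWith K χ)
    (h01 : ∀ x, χ x ∈ Icc (0 : ℝ) 1) (h0 : ∀ x, x ∉ Metric.ball p b → χ x = 0)
    (hA : LipschitzWith K' A) : ∃ C : ℝ≥0, LipschitzWith C fun x ↦ χ x • A x := by
  set M : ℝ≥0 := (‖A p‖ + K' * |b|).toNNReal with hM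
  have hMA : ∀ y ∈ Metric.ball p b, ‖A y‖ ≤ M := by
    intro y hy
    have h1 := hA.dist_le_mul y p
    have h2 : ‖A y‖ ≤ ‖A p‖ + dist (A y) (A p) := by
      rw [dist_eq_norm]; simpa using norm_add_le (A p) (A y - A p)
    have h3 : (K' : ℝ) * dist y p ≤ K' * |b| :=
      mul_le_mul_of_nonneg_left ((Metric.mem_ball.1 hy).le.trans (le_abs_self b)) K'.2
    rw [hM]
    exact (by linarith : ‖A y‖ ≤ ‖A p‖ + K' * |b|).trans (Real.le_coe_toNNReal _)
  -- it suffices to treat pairs whose second point lies in the ball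
  have key : ∀ x, ∀ y ∈ Metric.ball p b,
      dist (χ x • A x) (χ y • A y) ≤ (K' + K * M) * dist x y := by
    intro x y hy
    have h1 : χ x • A x - χ y • A y = χ x • (A x - A y) + (χ x - χ y) • A y := by
      simp [smul_sub, sub_smul]
    rw [dist_eq_norm, h1]
    refine (norm_add_le _ _).trans ?_
    rw [norm_smul, norm_smul, Real.norm_of_nonneg (h01 x).1, ← dist_eq_norm, ← dist_eq_norm]
    have h2 := hA.dist_le_mul x y
    have h3 := hχ.dist_le_mul x y
    have h4 : χ x * dist (A x) (A y) ≤ 1 * (K' * dist x y) :=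
      mul_le_mul (h01 x).2 h2 dist_nonneg zero_le_one
    have h5 : dist (χ x) (χ y) * ‖A y‖ ≤ (K * dist x y) * M :=
      mul_le_mul h3 (hMA y hy) (norm_nonneg _) (by positivity)
    nlinarith
  refine ⟨K' + K * M, LipschitzWith.of_dist_le_mul fun x y ↦ ?_⟩
  push_cast
  by_cases hy : y ∈ Metric.ball p b
  · exact key x y hy
  by_cases hx : x ∈ Metric.ball p b
  · rw [dist_comm, dist_comm x y]; exact key y x hx
  · rw [h0 x hx, h0 y hy, zero_smul, zero_smul, dist_self]; positivity

variable {E : Type*} [NormedAddCommGroup E] [NormedSpace ℝ E]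

/-- The function `det (DH)` is a continuous bump density at `p`: it is non-negative, positive at
`p`, and zero outside the ball of radius `δ`. It is recorded through the map `H`, because integrals
of Jacobian determinants `det (D(H ∘ F)) = det (DH ∘ F) · det (DF)` are what the degree theory
controls. -/
structure IsBumpPrimitive (H : E → E) (p : E) (δ : ℝ) : Prop where
  contDiff : ContDiff ℝ 1 H
  lipschitz : ∃ C : ℝ≥0, LipschitzWith C H
  nonneg : ∀ y, 0 ≤ (fderiv ℝ H y).det
  pos : 0 < (fderiv ℝ H p).det
  eq_zero : ∀ y, y ∉ Metric.ball p δ → (fderiv ℝ H y).det = 0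

theorem IsBumpPrimitive.mono {H : E → E} {p : E} {δ δ' : ℝ} (h : IsBumpPrimitive H p δ)
    (hδ : δ ≤ δ') : IsBumpPrimitive H p δ' :=
  ⟨h.contDiff, h.lipschitz, h.nonneg, h.pos,
    fun y hy ↦ h.eq_zero y fun h' ↦ hy (Metric.ball_subset_ball hδ h')⟩

/-- A lower Lipschitz bound at a point passes to the derivative. -/
theorem HasFDerivAt.le_norm_apply {F : E → E} {L : E →L[ℝ] E} {x : E} (h : HasFDerivAt F L x)
    {c : ℝ} (hc : ∀ᶠ y in 𝓝 x, c * ‖y - x‖ ≤ ‖F y - F x‖) (v : E) : c * ‖v‖ ≤ ‖L v‖ := by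
  have h1 : Tendsto (fun t : ℝ ↦ x + t • v) (𝓝[>] 0) (𝓝 x) := by
    have : Continuous fun t : ℝ ↦ x + t • v := by fun_prop
    simpa using (this.tendsto 0).mono_left nhdsWithin_le_nhds
  have h2 : Tendsto (fun t : ℝ ↦ ‖t⁻¹ • (F (x + t • v) - F x)‖) (𝓝[>] 0) (𝓝 ‖L v‖) := by
    have := (h.hasLineDerivAt v).tendsto_slope_zero_right
    simpa using this.norm
  refine ge_of_tendsto h2 ?_
  filter_upwards [h1.eventually hc, self_mem_nhdsWithin] with t ht ht0
  have ht0 : 0 < t := ht0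
  rw [add_sub_cancel_left, norm_smul, Real.norm_of_nonneg ht0.le] at ht
  rw [norm_smul, norm_inv, Real.norm_of_nonneg ht0.le, inv_mul_eq_div, le_div_iff₀ ht0]
  linarith

variable [FiniteDimensional ℝ E]

theorem ContinuousLinearMap.det_ne_zero_of_le_norm {L : E →L[ℝ] E} {c : ℝ} (hc : 0 < c)
    (hL : ∀ v, c * ‖v‖ ≤ ‖L v‖) : L.det ≠ 0 := by
  have : LinearMap.ker (L : E →ₗ[ℝ] E) = ⊥ := by
    rw [LinearMap.ker_eq_bot']
    intro v hv
    have h1 := hL v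
    rw [show L v = 0 from hv, norm_zero] at h1
    have h2 : ‖v‖ ≤ 0 := by nlinarith [norm_nonneg v]
    simpa using h2
  have h3 : IsUnit (LinearMap.det (L : E →ₗ[ℝ] E)) :=
    (LinearMap.isUnit_iff_ker_eq_bot _).2 this |>.map LinearMap.det
  exact h3.ne_zero

theorem ContinuousLinearMap.exists_le_norm_of_det_ne_zero {L : E →L[ℝ] E} (hL : L.det ≠ 0) :
    ∃ c > 0, ∀ v, c * ‖v‖ ≤ ‖L v‖ := by
  have hu : IsUnit (L : E →ₗ[ℝ] E) := by
    rw [LinearMap.isUnit_iff_isUnit_det]; exact isUnit_iff_ne_zero.2 hL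
  obtain ⟨K, hK, h⟩ := LinearMap.exists_antilipschitzWith (L : E →ₗ[ℝ] E)
    ((LinearMap.isUnit_iff_ker_eq_bot _).1 hu)
  refine ⟨(K : ℝ)⁻¹, by positivity, fun v ↦ ?_⟩
  have := h.le_mul_dist v 0
  simp only [dist_zero_right, map_zero] at this
  rw [inv_mul_le_iff₀ (by positivity)]
  exact this

variable [MeasurableSpace E] [BorelSpace E] (μ : Measure E)

theorem integrableOn_density_comp {A H : E → E} {K C : ℝ≥0} (hH : ContDiff ℝ 1 H)
    (hHL : LipschitzWith C H) (hA : LipschitzWith K A) {s : Set E} (hs : μ s < ⊤) :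
    IntegrableOn (fun x ↦ (fderiv ℝ H (A x)).det * (fderiv ℝ A x).det) s μ := by
  have hbound : ∀ R : ℝ≥0, ∃ M : ℝ, ∀ N : E →L[ℝ] E, ‖N‖ ≤ R → ‖N.det‖ ≤ M := by
    intro R
    obtain ⟨M, hM⟩ := ((isCompact_closedBall (0 : E →L[ℝ] E) R).image
      ContinuousLinearMap.continuous_det).isBounded.exists_norm_le
    exact ⟨M, fun N hN ↦ hM _ ⟨N, by simpa using hN, rfl⟩⟩
  obtain ⟨M, hM⟩ := hbound C
  obtain ⟨M', hM'⟩ := hbound K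
  have hcont : Continuous fun y ↦ (fderiv ℝ H y).det :=
    ContinuousLinearMap.continuous_det.comp (hH.continuous_fderiv one_ne_zero)
  refine Measure.integrableOn_of_bounded (M := M * M') hs.ne ?_ ?_
  · exact ((hcont.comp hA.continuous).measurable.mul
      (ContinuousLinearMap.continuous_det.measurable.comp
        (measurable_fderiv ℝ A))).aestronglyMeasurable
  · refine Eventually.of_forall fun x ↦ ?_
    rw [norm_mul]
    have h1 := hM _ (norm_fderiv_le_of_lipschitz ℝ hHL (x₀ := A x))
    exact mul_le_mul h1 (hM' _ (norm_fderiv_le_of_lipschitz ℝ hA)) (norm_nonneg _)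
      ((norm_nonneg _).trans h1)

variable [μ.IsAddHaarMeasure]

theorem LipschitzWith.exists_differentiableAt_mem {F : E → E} {K : ℝ≥0} (hF : LipschitzWith K F)
    {U : Set E} (hU : IsOpen U) (hne : U.Nonempty) : ∃ x ∈ U, DifferentiableAt ℝ F x := by
  have hd : ∀ᵐ x ∂(Measure.addHaar : Measure E), DifferentiableAt ℝ F x := hF.ae_differentiableAt
  obtain ⟨x, hx, hx'⟩ :=
    (hd.and_frequently (frequently_ae_iff.2 (hU.measure_pos Measure.addHaar hne).ne')).exists
  exact ⟨x, hx', hx⟩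

/-- The integral of the Jacobian determinant depends only on the values of a Lipschitz map
outside a compact set. -/
theorem integral_det_fderiv_sub_eq_zero [Nontrivial E] {A B : E → E} {K K' : ℝ≥0}
    (hA : LipschitzWith K A) (hB : LipschitzWith K' B) {p : E} {ρ : ℝ}
    (hAB : ∀ x, x ∉ Metric.ball p ρ → A x = B x) :
    ∫ x, ((fderiv ℝ A x).det - (fderiv ℝ B x).det) ∂μ = 0 := by
  obtain ⟨χ, Kχ, hχ, h01, h1, h0⟩ := exists_lipschitz_cutoff p (show ρ + 1 < ρ + 2 by linarith)
  obtain ⟨CA, hCA⟩ := hχ.exists_cutoff_smul h01 h0 hA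
  obtain ⟨CB, hCB⟩ := hχ.exists_cutoff_smul h01 h0 hB
  have hcs : ∀ f : E → E, HasCompactSupport fun x ↦ χ x • f x := fun f ↦
    HasCompactSupport.intro (isCompact_closedBall p (ρ + 2)) fun x hx ↦ by
      rw [h0 x fun h ↦ hx (Metric.ball_subset_closedBall h), zero_smul]
  have hint : ∀ (f : E → E) (C : ℝ≥0), LipschitzWith C (fun x ↦ χ x • f x) →
      Integrable (fun x ↦ (fderiv ℝ (fun x ↦ χ x • f x) x).det) μ := by
    intro f C hf
    have := integrable_det_fderiv_sub_pow μ hf (hcs f) 0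
    simpa [zero_pow Module.finrank_pos.ne'] using this
  have heq : ∀ x, (fderiv ℝ A x).det - (fderiv ℝ B x).det
      = (fderiv ℝ (fun x ↦ χ x • A x) x).det - (fderiv ℝ (fun x ↦ χ x • B x) x).det := by
    intro x
    by_cases hx : x ∈ Metric.ball p (ρ + 1)
    · have hloc : ∀ f : E → E, (fun x ↦ χ x • f x) =ᶠ[𝓝 x] f := fun f ↦ by
        filter_upwards [Metric.isOpen_ball.mem_nhds hx] with y hy
        rw [h1 y (Metric.ball_subset_closedBall hy), one_smul]
      rw [(hloc A).fderiv_eq, (hloc B).fderiv_eq]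
    · have hmem : (Metric.closedBall p ρ)ᶜ ∈ 𝓝 x :=
        Metric.isClosed_closedBall.isOpen_compl.mem_nhds fun h ↦ hx
          (Metric.mem_ball.2 (by linarith [Metric.mem_closedBall.1 h]))
      have h2 : A =ᶠ[𝓝 x] B := by
        filter_upwards [hmem] with y hy
        exact hAB y fun h ↦ hy (Metric.ball_subset_closedBall h)
      have h3 : (fun x ↦ χ x • A x) =ᶠ[𝓝 x] fun x ↦ χ x • B x := by
        filter_upwards [h2] with y hy
        rw [hy]
      rw [h2.fderiv_eq, h3.fderiv_eq, sub_self, sub_self]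
  simp_rw [heq]
  rw [integral_sub (hint A CA hCA) (hint B CB hCB), integral_det_fderiv_eq_zero μ hCA (hcs A),
    integral_det_fderiv_eq_zero μ hCB (hcs B), sub_zero]

/-- The pull-back of a density of the form `det (DH)` under a Lipschitz map has an integral that
depends only on the values of the map outside a compact set. -/
theorem integral_density_comp_sub_eq_zero [Nontrivial E] {A B H : E → E} {K K' C : ℝ≥0}
    (hH : ContDiff ℝ 1 H) (hHL : LipschitzWith C H) (hA : LipschitzWith K A)
    (hB : LipschitzWith K' B) {p : E} {ρ : ℝ} (hAB : ∀ x, x ∉ Metric.ball p ρ → A x = B x) :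
    ∫ x, ((fderiv ℝ H (A x)).det * (fderiv ℝ A x).det
      - (fderiv ℝ H (B x)).det * (fderiv ℝ B x).det) ∂μ = 0 := by
  rw [← integral_det_fderiv_sub_eq_zero μ (hHL.comp hA) (hHL.comp hB) (p := p) (ρ := ρ)
    fun x hx ↦ by simp [hAB x hx]]
  have hcomp : ∀ f : E → E, ∀ x, DifferentiableAt ℝ f x →
      (fderiv ℝ (H ∘ f) x).det = (fderiv ℝ H (f x)).det * (fderiv ℝ f x).det := by
    intro f x hf
    rw [fderiv_comp x (hH.differentiable one_ne_zero _) hf]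
    exact LinearMap.det_comp _ _
  refine integral_congr_ae ?_
  filter_upwards [hA.ae_differentiableAt, hB.ae_differentiableAt] with x hxA hxB
  rw [hcomp A x hxA, hcomp B x hxB]

/-- Local degree: a Lipschitz map that is close to an invertible affine map on a ball has the
local degree of that affine map. -/
theorem exists_pos_setIntegral_density_comp_eq [Nontrivial E] {F H : E → E} {K : ℝ≥0}
    (hF : LipschitzWith K F) {L : E →L[ℝ] E} {c δ : ℝ} (hc : 0 < c) (hδ : 0 < δ)
    (hL : ∀ v, c * ‖v‖ ≤ ‖L v‖) {p y₁ : E}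
    (hFL : ∀ x ∈ Metric.ball p δ, ‖F x - (y₁ + L (x - p))‖ ≤ c * δ / 8)
    (hH : IsBumpPrimitive H y₁ (c * δ / 8)) :
    ∃ I : ℝ, 0 < I ∧ ∫ x in Metric.ball p δ, (fderiv ℝ H (F x)).det * (fderiv ℝ F x).det ∂μ
      = I * L.det := by
  obtain ⟨C, hC⟩ := hH.lipschitz
  set A : E → E := fun x ↦ y₁ + L (x - p) with hA
  have hAL : LipschitzWith ‖L‖₊ A := by
    refine LipschitzWith.of_dist_le_mul fun x y ↦ ?_
    rw [dist_eq_norm, dist_eq_norm, show A x - A y = L (x - y) by simp [hA, map_sub]]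
    exact L.le_opNorm _
  have hAd : ∀ x, fderiv ℝ A x = L := fun x ↦ by
    have h1 : HasFDerivAt A (L.comp (ContinuousLinearMap.id ℝ E)) x :=
      (L.hasFDerivAt.comp x ((hasFDerivAt_id x).sub_const p)).const_add y₁
    simpa using h1.fderiv
  have hψc : Continuous fun y ↦ (fderiv ℝ H y).det :=
    ContinuousLinearMap.continuous_det.comp (hH.contDiff.continuous_fderiv one_ne_zero)
  obtain ⟨χ, Kχ, hχ, h01, h1, h0⟩ :=
    exists_lipschitz_cutoff p (show δ / 2 < 3 * δ / 4 by linarith)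
  obtain ⟨C', hC'⟩ := hχ.exists_cutoff_smul h01 h0 (hAL.sub hF)
  -- `B` agrees with the affine map `A` near `p` and with `F` near the boundary of the ball
  set B : E → E := fun x ↦ F x + χ x • (A - F) x with hB
  have hBL : LipschitzWith (K + C') B := hF.add hC'
  have hT := integral_density_comp_sub_eq_zero μ hH.contDiff hC hF hBL (p := p) (ρ := 3 * δ / 4)
    fun x hx ↦ by simp [hB, h0 x hx]
  -- where `B` is not equal to `A`, both take values outside the support of the bump
  have hfar : ∀ x ∈ Metric.ball p δ, x ∉ Metric.ball p (δ / 2) →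
      (fderiv ℝ H (B x)).det = 0 ∧ (fderiv ℝ H (A x)).det = 0 := by
    intro x hx hx2
    have h2 : δ / 2 ≤ ‖x - p‖ := by
      rw [← dist_eq_norm]; exact not_lt.1 fun h ↦ hx2 (Metric.mem_ball.2 h)
    have h3 : c * δ / 2 ≤ ‖L (x - p)‖ := by
      refine le_trans ?_ (hL _); nlinarith
    have hBA : B x - y₁ = L (x - p) + (1 - χ x) • (F x - A x) := by
      simp only [hB, hA, Pi.sub_apply, sub_smul, smul_sub, one_smul, smul_add]; abel
    have h4 : ‖(1 - χ x) • (F x - A x)‖ ≤ c * δ / 8 := by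
      rw [norm_smul, Real.norm_of_nonneg (by linarith [(h01 x).2])]
      calc (1 - χ x) * ‖F x - A x‖ ≤ 1 * ‖F x - A x‖ :=
            mul_le_mul_of_nonneg_right (by linarith [(h01 x).1]) (norm_nonneg _)
        _ ≤ c * δ / 8 := by rw [one_mul]; exact hFL x hx
    have hcδ : 0 < c * δ := mul_pos hc hδ
    constructor
    · refine hH.eq_zero _ fun h ↦ ?_
      rw [Metric.mem_ball, dist_eq_norm, hBA] at h
      have h5 := norm_sub_le (L (x - p) + (1 - χ x) • (F x - A x)) ((1 - χ x) • (F x - A x))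
      rw [add_sub_cancel_right] at h5
      linarith
    · refine hH.eq_zero _ fun h ↦ ?_
      rw [Metric.mem_ball, dist_eq_norm, show A x - y₁ = L (x - p) by simp [hA]] at h
      linarith
  have hlocal : ∀ x ∈ Metric.ball p δ, (fderiv ℝ H (B x)).det * (fderiv ℝ B x).det
      = (fderiv ℝ H (A x)).det * (fderiv ℝ A x).det := by
    intro x hx
    by_cases hx2 : x ∈ Metric.ball p (δ / 2)
    · have : B =ᶠ[𝓝 x] A := by
        filter_upwards [Metric.isOpen_ball.mem_nhds hx2] with y hy
        simp [hB, h1 y (Metric.ball_subset_closedBall hy)]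
      rw [this.fderiv_eq, this.eq_of_nhds]
    · rw [(hfar x hx hx2).1, (hfar x hx hx2).2, zero_mul, zero_mul]
  have hout : ∀ x, x ∉ Metric.ball p δ → (fderiv ℝ H (F x)).det * (fderiv ℝ F x).det
      - (fderiv ℝ H (B x)).det * (fderiv ℝ B x).det = 0 := by
    intro x hx
    have hmem : (Metric.closedBall p (3 * δ / 4))ᶜ ∈ 𝓝 x :=
      Metric.isClosed_closedBall.isOpen_compl.mem_nhds fun h ↦ hx
        (Metric.mem_ball.2 (by linarith [Metric.mem_closedBall.1 h]))
    have : B =ᶠ[𝓝 x] F := by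
      filter_upwards [hmem] with y hy
      simp [hB, h0 y fun h ↦ hy (Metric.ball_subset_closedBall h)]
    rw [this.fderiv_eq, this.eq_of_nhds, sub_self]
  rw [← setIntegral_eq_integral_of_forall_compl_eq_zero hout,
    integral_sub (integrableOn_density_comp μ hH.contDiff hC hF measure_ball_lt_top)
      (integrableOn_density_comp μ hH.contDiff hC hBL measure_ball_lt_top),
    setIntegral_congr_fun Metric.isOpen_ball.measurableSet hlocal, sub_eq_zero] at hT
  refine ⟨∫ x in Metric.ball p δ, (fderiv ℝ H (A x)).det ∂μ, ?_, ?_⟩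
  · have hAc : Continuous fun x ↦ (fderiv ℝ H (A x)).det := hψc.comp hAL.continuous
    refine (setIntegral_pos_iff_support_of_nonneg_ae (Eventually.of_forall fun x ↦ hH.nonneg _)
      ?_).2 ?_
    · exact (hAc.continuousOn.integrableOn_compact (isCompact_closedBall p δ)).mono_set
        Metric.ball_subset_closedBall
    · refine IsOpen.measure_pos μ (hAc.isOpen_support.inter Metric.isOpen_ball) ⟨p, ?_, ?_⟩
      · simpa [hA] using hH.pos.ne'
      · exact Metric.mem_ball_self hδ
  · rw [hT]
    simp_rw [hAd]
    rw [integral_mul_const]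

end Degree

/-! ### Invariance of domain for bi-Lipschitz maps -/

section EuclideanDegree

variable {ι : Type*} [Fintype ι] [Nonempty ι]

theorem EuclideanSpace.det_eq_det_matrix {ι : Type*} [Fintype ι] [DecidableEq ι]
    (L : EuclideanSpace ℝ ι →L[ℝ] EuclideanSpace ℝ ι) :
    L.det = (Matrix.of fun i j ↦ L (EuclideanSpace.single j 1) i).det := by
  rw [ContinuousLinearMap.det, ← LinearMap.det_toMatrix (PiLp.basisFun 2 ℝ ι)]
  congr 1

theorem exists_primitive_bump_real {a : ℝ} (ha : 0 < a) : ∃ h h' : ℝ → ℝ,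
    (∀ t, HasDerivAt h (h' t) t) ∧ Continuous h' ∧ (∀ t, h' t ∈ Icc (0 : ℝ) 1) ∧ 0 < h' 0 ∧
      ∀ t, a ≤ |t| → h' t = 0 := by
  let g : ContDiffBump (0 : ℝ) := ⟨a / 2, a, by positivity, by linarith⟩
  refine ⟨fun t ↦ ∫ s in (0 : ℝ)..t, g s, g, fun t ↦ ?_, g.continuous,
    fun t ↦ ⟨g.nonneg, g.le_one⟩, ?_, fun t ht ↦ ?_⟩
  · exact intervalIntegral.integral_hasDerivAt_right (g.continuous.intervalIntegrable _ _)
      (g.continuous.stronglyMeasurableAtFilter _ _) g.continuous.continuousAt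
  · rw [g.one_of_mem_closedBall (Metric.mem_closedBall_self (by positivity))]; exact one_pos
  · exact g.zero_of_le_dist (by simpa using ht)

/-- The map `H` applies to each coordinate a primitive of a bump function of one variable. -/
theorem exists_isBumpPrimitive (p : EuclideanSpace ℝ ι) {δ : ℝ} (hδ : 0 < δ) :
    ∃ H : EuclideanSpace ℝ ι → EuclideanSpace ℝ ι, IsBumpPrimitive H p δ := by
  classical
  set n : ℝ := (Fintype.card ι : ℝ) with hn
  have hn0 : 0 ≤ n := by positivity
  obtain ⟨h, h', hh, hc, h01, hpos, hz⟩ := exists_primitive_bump_real (a := δ / (n + 1))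
    (by positivity)
  set H : EuclideanSpace ℝ ι → EuclideanSpace ℝ ι := fun y ↦ WithLp.toLp 2 fun i ↦ h (y i - p i)
    with hH
  set DH : EuclideanSpace ℝ ι → (EuclideanSpace ℝ ι →L[ℝ] EuclideanSpace ℝ ι) := fun y ↦
    (Matrix.toEuclideanCLM (𝕜 := ℝ) (Matrix.diagonal fun i ↦ h' (y i - p i))) with hDH
  have hD : ∀ y, HasFDerivAt H (DH y) y := by
    intro y
    rw [← hasFDerivWithinAt_univ, hasFDerivWithinAt_euclidean]
    intro i
    have h1 : HasFDerivAt (fun x : EuclideanSpace ℝ ι ↦ x i - p i)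
        (EuclideanSpace.proj i : EuclideanSpace ℝ ι →L[ℝ] ℝ) y :=
      ((EuclideanSpace.proj i : EuclideanSpace ℝ ι →L[ℝ] ℝ).hasFDerivAt).sub_const _
    have h2 := (hh (y i - p i)).comp_hasFDerivAt y h1
    rw [hasFDerivWithinAt_univ]
    refine h2.congr_fderiv ?_
    ext v
    simp [hDH, Matrix.mulVec_diagonal]
  have hdet : ∀ y, (fderiv ℝ H y).det = ∏ i, h' (y i - p i) := by
    intro y
    rw [(hD y).fderiv, ← Matrix.det_diagonal, EuclideanSpace.det_eq_det_matrix]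
    congr 1
    ext i j
    simp [hDH, EuclideanSpace.single, Matrix.diagonal_apply, Pi.single_apply, eq_comm]
    aesop
  refine ⟨H, ?_, ⟨1, ?_⟩, ?_, ?_, ?_⟩
  · rw [contDiff_one_iff_fderiv]
    refine ⟨fun y ↦ (hD y).differentiableAt, ?_⟩
    have : fderiv ℝ H = DH := funext fun y ↦ (hD y).fderiv
    rw [this, hDH]
    have h1 : Continuous fun M : Matrix ι ι ℝ ↦
        (Matrix.toEuclideanCLM (𝕜 := ℝ) M : EuclideanSpace ℝ ι →L[ℝ] EuclideanSpace ℝ ι) :=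
      LinearMap.continuous_of_finiteDimensional
        (Matrix.toEuclideanCLM (𝕜 := ℝ) (n := ι)).toAlgEquiv.toLinearMap
    refine h1.comp (Continuous.matrix_diagonal (continuous_pi fun i ↦ hc.comp ?_))
    fun_prop
  · refine LipschitzWith.of_dist_le_mul fun x y ↦ ?_
    have hlip : LipschitzWith 1 h := by
      refine lipschitzWith_of_nnnorm_deriv_le (fun t ↦ (hh t).differentiableAt) fun t ↦ ?_
      rw [(hh t).deriv, ← NNReal.coe_le_coe, coe_nnnorm, Real.norm_of_nonneg (h01 t).1]
      exact (h01 t).2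
    rw [NNReal.coe_one, one_mul, EuclideanSpace.dist_eq, EuclideanSpace.dist_eq]
    refine Real.sqrt_le_sqrt (Finset.sum_le_sum fun i _ ↦ ?_)
    have := hlip.dist_le_mul (x i - p i) (y i - p i)
    rw [NNReal.coe_one, one_mul, dist_sub_right] at this
    exact pow_le_pow_left₀ dist_nonneg this 2
  · intro y
    rw [hdet]
    exact Finset.prod_nonneg fun i _ ↦ (h01 _).1
  · rw [hdet]
    exact Finset.prod_pos fun i _ ↦ by simpa using hpos
  · intro y hy
    rw [hdet]
    by_contra hne
    have h1 : ∀ i, |y i - p i| < δ / (n + 1) := fun i ↦ by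
      by_contra hi
      exact hne (Finset.prod_eq_zero (Finset.mem_univ i) (hz _ (not_lt.1 hi)))
    apply hy
    rw [Metric.mem_ball, EuclideanSpace.dist_eq, Real.sqrt_lt' hδ]
    calc ∑ i, dist (y i) (p i) ^ 2 ≤ ∑ i : ι, (δ / (n + 1)) ^ 2 := by
          refine Finset.sum_le_sum fun i _ ↦ pow_le_pow_left₀ dist_nonneg ?_ 2
          rw [Real.dist_eq]; exact (h1 i).le
      _ = n * (δ / (n + 1)) ^ 2 := by simp [hn]
      _ < δ ^ 2 := by
          rw [div_pow, ← mul_div_assoc, div_lt_iff₀ (by positivity)]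
          have h2 : 0 < δ ^ 2 := by positivity
          nlinarith [mul_nonneg hn0 h2.le, mul_nonneg (sq_nonneg n) h2.le]

/-- Invariance of domain for bi-Lipschitz maps, in a quantitative form. If `y₀` were missed, the
image density of a bump could be translated past `y₀` without changing its integral; but the
integral vanishes near `y₀` and not near the image of a point of differentiability. -/
theorem ball_subset_image_closedBall_of_lipschitzWith
    {F : EuclideanSpace ℝ ι → EuclideanSpace ℝ ι} {K : ℝ≥0} (hF : LipschitzWith K F) {c δ : ℝ}
    (hc : 0 < c) (hδ : 0 < δ) {x₀ : EuclideanSpace ℝ ι}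
    (hFc : ∀ x ∈ Metric.closedBall x₀ δ, ∀ y ∈ Metric.closedBall x₀ δ,
      c * ‖x - y‖ ≤ ‖F x - F y‖) :
    Metric.ball (F x₀) (c * δ / 4) ⊆ F '' Metric.closedBall x₀ δ := by
  intro y₀ hy₀
  by_contra hmiss
  have hcδ : 0 < c * δ := mul_pos hc hδ
  have hcomp : IsClosed (F '' Metric.closedBall x₀ δ) :=
    ((isCompact_closedBall x₀ δ).image hF.continuous).isClosed
  obtain ⟨η₀, hη₀, hη₀'⟩ := Metric.isOpen_iff.1 hcomp.isOpen_compl y₀ hmiss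
  -- a point of differentiability close to `x₀`
  obtain ⟨x₁, ⟨hx₁a, hx₁b⟩, hx₁d⟩ : ∃ x₁, (x₁ ∈ Metric.ball x₀ (δ / 4) ∧
      F x₁ ∈ Metric.ball (F x₀) (c * δ / 4)) ∧ DifferentiableAt ℝ F x₁ := by
    have hopen : IsOpen (Metric.ball x₀ (δ / 4) ∩ F ⁻¹' Metric.ball (F x₀) (c * δ / 4)) :=
      Metric.isOpen_ball.inter (Metric.isOpen_ball.preimage hF.continuous)
    have hne : (Metric.ball x₀ (δ / 4) ∩ F ⁻¹' Metric.ball (F x₀) (c * δ / 4)).Nonempty :=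
      ⟨x₀, Metric.mem_ball_self (by positivity),
        mem_preimage.2 (Metric.mem_ball_self (by positivity))⟩
    exact hF.exists_differentiableAt_mem hopen hne
  set y₁ := F x₁ with hy₁
  set L := fderiv ℝ F x₁ with hLdef
  have hnhds : Metric.closedBall x₀ δ ∈ 𝓝 x₁ :=
    mem_of_superset (Metric.isOpen_ball.mem_nhds hx₁a)
      (Metric.ball_subset_closedBall.trans (Metric.closedBall_subset_closedBall (by linarith)))
  have hL : ∀ v, c * ‖v‖ ≤ ‖L v‖ := by
    refine hx₁d.hasFDerivAt.le_norm_apply ?_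
    filter_upwards [hnhds] with y hy
    exact hFc y hy x₁ (mem_of_mem_nhds hnhds)
  obtain ⟨δ₁, hδ₁, hδ₁'⟩ : ∃ δ₁ > 0, Metric.ball x₁ δ₁ ⊆ {x | x ∈ Metric.closedBall x₀ δ ∧
      ‖F x - F x₁ - L (x - x₁)‖ ≤ c / 8 * ‖x - x₁‖} :=
    Metric.mem_nhds_iff.1 (inter_mem hnhds
      ((hasFDerivAt_iff_isLittleO.1 hx₁d.hasFDerivAt).bound (by positivity)))
  have hcδ₁ : 0 < c * δ₁ := mul_pos hc hδ₁
  set η := min (c * δ₁ / 8) (min η₀ (c * δ / 8)) with hη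
  have hη0 : 0 < η := by positivity
  obtain ⟨H, hH⟩ := exists_isBumpPrimitive y₁ hη0
  obtain ⟨C, hC⟩ := hH.lipschitz
  obtain ⟨I, hI, hdeg⟩ := exists_pos_setIntegral_density_comp_eq volume hF hc hδ₁ hL (p := x₁)
    (y₁ := y₁) (fun x hx ↦ by
      have h1 := (hδ₁' hx).2
      have h2 := Metric.mem_ball.1 hx
      rw [dist_eq_norm] at h2
      rw [← sub_sub]
      refine h1.trans ?_
      nlinarith) (hH.mono (min_le_left _ _))
  have hne : ∫ x in Metric.closedBall x₀ δ, (fderiv ℝ H (F x)).det * (fderiv ℝ F x).det ≠ 0 := by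
    rw [setIntegral_eq_of_subset_of_forall_sdiff_eq_zero
      Metric.isClosed_closedBall.measurableSet (fun x hx ↦ (hδ₁' hx).1), hdeg]
    · exact mul_ne_zero hI.ne' (ContinuousLinearMap.det_ne_zero_of_le_norm hc hL)
    · intro x hx
      rw [hH.eq_zero, zero_mul]
      intro h
      have h1 := hFc x hx.1 x₁ (mem_of_mem_nhds hnhds)
      rw [Metric.mem_ball, dist_eq_norm] at h
      have h2 : δ₁ ≤ ‖x - x₁‖ := by
        rw [← dist_eq_norm]; exact not_lt.1 fun h' ↦ hx.2 (Metric.mem_ball.2 h')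
      have h3 : η ≤ c * δ₁ / 8 := min_le_left _ _
      nlinarith
  -- translate the image near `x₀` by `y₁ - y₀`
  obtain ⟨χ, Kχ, hχ, h01, h1, h0⟩ :=
    exists_lipschitz_cutoff x₀ (show 7 * δ / 8 < 15 * δ / 16 by linarith)
  obtain ⟨C', hC'⟩ := hχ.exists_cutoff_smul h01 h0 (LipschitzWith.const (α := EuclideanSpace ℝ ι)
    (y₁ - y₀))
  set B : EuclideanSpace ℝ ι → EuclideanSpace ℝ ι := fun x ↦ F x + χ x • (y₁ - y₀) with hB
  have hBL : LipschitzWith (K + C') B := hF.add hC'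
  have hT := integral_density_comp_sub_eq_zero volume hH.contDiff hC hF hBL (p := x₀)
    (ρ := 15 * δ / 16) fun x hx ↦ by simp [hB, h0 x hx]
  have hout : ∀ x, x ∉ Metric.closedBall x₀ δ → (fderiv ℝ H (F x)).det * (fderiv ℝ F x).det
      - (fderiv ℝ H (B x)).det * (fderiv ℝ B x).det = 0 := by
    intro x hx
    have : B =ᶠ[𝓝 x] F := by
      filter_upwards [Metric.isClosed_closedBall.isOpen_compl.mem_nhds hx] with y hy
      simp [hB, h0 y fun h ↦ hy (Metric.ball_subset_closedBall
        (Metric.ball_subset_ball (by linarith) h))]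
    rw [this.fderiv_eq, this.eq_of_nhds, sub_self]
  have hzero : ∀ x ∈ Metric.closedBall x₀ δ, (fderiv ℝ H (F x)).det * (fderiv ℝ F x).det
      - (fderiv ℝ H (B x)).det * (fderiv ℝ B x).det
      = (fderiv ℝ H (F x)).det * (fderiv ℝ F x).det := by
    intro x hx
    rw [hH.eq_zero (B x), zero_mul, sub_zero]
    intro h
    by_cases hx2 : x ∈ Metric.closedBall x₀ (7 * δ / 8)
    · refine hη₀' ?_ ⟨x, hx, rfl⟩
      rw [Metric.mem_ball, dist_eq_norm] at h ⊢
      rw [show B x - y₁ = F x - y₀ by simp only [hB, h1 x hx2, one_smul]; abel] at h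
      exact h.trans_le ((min_le_right _ _).trans (min_le_left _ _))
    · have h2 : 7 * δ / 8 ≤ ‖x - x₀‖ := by
        rw [← dist_eq_norm]; exact (not_le.1 fun h' ↦ hx2 (Metric.mem_closedBall.2 h')).le
      have h3 := hFc x hx x₀ (Metric.mem_closedBall_self hδ.le)
      rw [Metric.mem_ball, dist_eq_norm] at h hx₁b hy₀
      have h4 : ‖χ x • (y₁ - y₀)‖ ≤ ‖y₁ - F x₀‖ + ‖y₀ - F x₀‖ := by
        rw [norm_smul, Real.norm_of_nonneg (h01 x).1]
        calc χ x * ‖y₁ - y₀‖ ≤ 1 * ‖y₁ - y₀‖ :=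
              mul_le_mul_of_nonneg_right (h01 x).2 (norm_nonneg _)
          _ = ‖(y₁ - F x₀) - (y₀ - F x₀)‖ := by rw [one_mul, sub_sub_sub_cancel_right]
          _ ≤ _ := norm_sub_le _ _
      have h5 : F x - F x₀ = (B x - y₁) - χ x • (y₁ - y₀) + (y₁ - F x₀) := by
        simp only [hB]; abel
      have h6 : ‖F x - F x₀‖ ≤ ‖B x - y₁‖ + ‖χ x • (y₁ - y₀)‖ + ‖y₁ - F x₀‖ := by
        rw [h5]
        exact (norm_add_le _ _).trans (add_le_add_left (norm_sub_le _ _) _)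
      have h7 : η ≤ c * δ / 8 := (min_le_right _ _).trans (min_le_right _ _)
      nlinarith
  rw [← setIntegral_eq_integral_of_forall_compl_eq_zero hout,
    setIntegral_congr_fun Metric.isClosed_closedBall.measurableSet hzero] at hT
  exact hne hT

/-- Invariance of domain in a quantitative form: a bi-Lipschitz map of a ball covers a ball around
the image of the centre, with a radius that depends only on the lower Lipschitz constant. -/
theorem ball_subset_image_closedBall
    {F : EuclideanSpace ℝ ι → EuclideanSpace ℝ ι} {K : ℝ≥0} {c δ : ℝ} (hc : 0 < c) (hδ : 0 < δ)
    {x₀ : EuclideanSpace ℝ ι} (hF : LipschitzOnWith K F (Metric.closedBall x₀ δ))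
    (hFc : ∀ x ∈ Metric.closedBall x₀ δ, ∀ y ∈ Metric.closedBall x₀ δ,
      c * ‖x - y‖ ≤ ‖F x - F y‖) :
    Metric.ball (F x₀) (c * δ / 4) ⊆ F '' Metric.closedBall x₀ δ := by
  obtain ⟨G, hG, hFG⟩ := hF.extend_finite_dimension
  rw [hFG.image_eq, hFG (Metric.mem_closedBall_self hδ.le)]
  refine ball_subset_image_closedBall_of_lipschitzWith hG hc hδ fun x hx y hy ↦ ?_
  rw [← hFG hx, ← hFG hy]
  exact hFc x hx y hy

end EuclideanDegree

/-! ### Rotations of the circle -/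

section Rotation

/-- The squared length `|e^{2πia} - 1|²` of the chord that a rotation by `a` full turns spans on
the unit circle. -/
noncomputable def chordSq (a : ℝ) : ℝ := 2 - 2 * Real.cos (2 * Real.pi * a)

theorem chordSq_eq_sin_sq (a : ℝ) : chordSq a = 4 * Real.sin (Real.pi * a) ^ 2 := by
  have := Real.cos_two_mul (Real.pi * a)
  have h2 := Real.sin_sq_add_cos_sq (Real.pi * a)
  rw [chordSq, show 2 * Real.pi * a = 2 * (Real.pi * a) by ring, this]
  linear_combination (-4) * h2

theorem chordSq_nonneg (a : ℝ) : 0 ≤ chordSq a := by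
  rw [chordSq_eq_sin_sq]; positivity

theorem chordSq_le_four (a : ℝ) : chordSq a ≤ 4 := by
  have := Real.neg_one_le_cos (2 * Real.pi * a)
  rw [chordSq]; linarith

theorem chordSq_neg (a : ℝ) : chordSq (-a) = chordSq a := by
  rw [chordSq, chordSq, mul_neg, Real.cos_neg]

theorem chordSq_sub_int (a : ℝ) (m : ℤ) : chordSq (a - m) = chordSq a := by
  rw [chordSq, chordSq, show 2 * Real.pi * (a - m) = 2 * Real.pi * a - m * (2 * Real.pi) by ring,
    Real.cos_sub_int_mul_two_pi]

theorem chordSq_le_sq (a : ℝ) (m : ℤ) : chordSq a ≤ 4 * Real.pi ^ 2 * (a - m) ^ 2 := by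
  rw [← chordSq_sub_int a m, chordSq_eq_sin_sq]
  have h := Real.abs_sin_le_one (Real.pi * (a - m))
  have h1 : |Real.sin (Real.pi * (a - m))| ≤ |Real.pi * (a - m)| := Real.abs_sin_le_abs
  have h2 := sq_le_sq.2 h1
  nlinarith

theorem sq_le_chordSq (a : ℝ) : 16 * (a - round a) ^ 2 ≤ chordSq a := by
  rw [← chordSq_sub_int a (round a), chordSq_eq_sin_sq]
  set d := a - round a with hd
  have h1 : |d| ≤ 1 / 2 := abs_sub_round a
  have h2 : 2 * |d| ≤ |Real.sin (Real.pi * d)| := by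
    have h3 := Real.mul_abs_le_abs_sin (x := Real.pi * d) (by
      rw [abs_mul, abs_of_pos Real.pi_pos]; nlinarith [Real.pi_pos])
    rw [abs_mul, abs_of_pos Real.pi_pos] at h3
    calc 2 * |d| = 2 / Real.pi * (Real.pi * |d|) := by field_simp
      _ ≤ _ := h3
  have h3 : (2 * |d|) ^ 2 ≤ |Real.sin (Real.pi * d)| ^ 2 := pow_le_pow_left₀ (by positivity) h2 2
  rw [sq_abs, mul_pow, sq_abs] at h3
  linarith

theorem chordSq_pos {a : ℝ} (ha : Irrational a) : 0 < chordSq a := by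
  refine lt_of_lt_of_le ?_ (sq_le_chordSq a)
  have : a - round a ≠ 0 := sub_ne_zero.2 (ha.ne_int _)
  positivity

/-- Dirichlet approximation; the approximation is never exact. -/
theorem Irrational.exists_int_mul_sub_small {α : ℝ} (hα : Irrational α) {η : ℝ} (hη : 0 < η) :
    ∃ (n : ℤ) (p : ℤ), 0 < n ∧ 0 < |n * α - p| ∧ |n * α - p| < η := by
  obtain ⟨N, hN⟩ := exists_nat_one_div_lt hη
  obtain ⟨k, hk, -, h⟩ := Real.exists_nat_abs_mul_sub_round_le α (Nat.succ_pos N)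
  refine ⟨k, round (k * α), by exact_mod_cast hk, ?_, ?_⟩
  · rw [abs_pos, sub_ne_zero]
    exact ((hα.natCast_mul hk.ne').ne_int _ : _)
  · push_cast at h ⊢
    refine h.trans_lt (lt_of_le_of_lt ?_ hN)
    exact one_div_le_one_div_of_le (by positivity) (by linarith)

/-- The multiples of an irrational number come close to a given number modulo `1` within every
sufficiently long window of indices. -/
theorem Irrational.exists_chordSq_le_of_window {α : ℝ} (hα : Irrational α) {η : ℝ} (hη : 0 < η)
    (a : ℝ) : ∃ L : ℝ, ∀ M : ℤ, ∃ n : ℤ, M ≤ n ∧ (n : ℝ) ≤ M + L ∧ chordSq (n * α - a) ≤ η := by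
  set η' := √(η / (4 * Real.pi ^ 2)) with hη'
  have hη'0 : 0 < η' := Real.sqrt_pos.2 (by positivity)
  obtain ⟨k, p, hk, hδ, hδη⟩ := hα.exists_int_mul_sub_small hη'0
  set δ := (k : ℝ) * α - p with hδdef
  have hkR : (0 : ℝ) < k := by exact_mod_cast hk
  refine ⟨k * |δ|⁻¹, fun M ↦ ?_⟩
  set θ := M * α - a with hθ
  -- choose `j` and `q` with `θ + j δ` within `|δ|` of `q`
  obtain ⟨j, q, hj0, hj1, hjq⟩ : ∃ j q : ℤ, 0 ≤ j ∧ (j : ℝ) ≤ |δ|⁻¹ ∧ |θ + j * δ - q| ≤ |δ| := by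
    rcases lt_or_gt_of_ne (abs_pos.1 hδ) with h | h
    · have hx : 0 ≤ Int.fract θ / |δ| := div_nonneg (Int.fract_nonneg _) hδ.le
      have h1 := Int.floor_le (Int.fract θ / |δ|)
      have h2 := Int.lt_floor_add_one (Int.fract θ / |δ|)
      rw [le_div_iff₀ hδ] at h1
      rw [div_lt_iff₀ hδ] at h2
      refine ⟨⌊Int.fract θ / |δ|⌋, ⌊θ⌋, Int.floor_nonneg.2 hx, ?_, ?_⟩
      · rw [← one_div, le_div_iff₀ hδ]; linarith [Int.fract_lt_one θ]
      · rw [abs_of_neg h] at *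
        have := Int.floor_add_fract θ
        rw [abs_le]; constructor <;> nlinarith
    · have hx : 0 ≤ Int.fract (-θ) / |δ| := div_nonneg (Int.fract_nonneg _) hδ.le
      have h1 := Int.floor_le (Int.fract (-θ) / |δ|)
      have h2 := Int.lt_floor_add_one (Int.fract (-θ) / |δ|)
      rw [le_div_iff₀ hδ] at h1
      rw [div_lt_iff₀ hδ] at h2
      refine ⟨⌊Int.fract (-θ) / |δ|⌋, -⌊-θ⌋, Int.floor_nonneg.2 hx, ?_, ?_⟩
      · rw [← one_div, le_div_iff₀ hδ]; linarith [Int.fract_lt_one (-θ)]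
      · rw [abs_of_pos h] at *
        have := Int.floor_add_fract (-θ)
        push_cast
        rw [abs_le]; constructor <;> nlinarith
  refine ⟨M + j * k, by nlinarith, ?_, ?_⟩
  · push_cast
    nlinarith
  · refine (chordSq_le_sq _ (j * p + q)).trans ?_
    have h1 : ((M + j * k : ℤ) : ℝ) * α - a - ((j * p + q : ℤ) : ℝ) = θ + j * δ - q := by
      push_cast; rw [hθ, hδdef]; ring
    rw [h1]
    have h2 : (θ + j * δ - q) ^ 2 ≤ η' ^ 2 := by
      rw [← sq_abs]; exact pow_le_pow_left₀ (abs_nonneg _) (hjq.trans hδη.le) 2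
    rw [hη', Real.sq_sqrt (by positivity), le_div_iff₀ (by positivity)] at h2
    linarith

/-- If every near-return of the rotation by `α` is, up to a constant, a near-return of the
rotation by `β`, then `β` is a multiple of `α` modulo `1`: the correspondence `nα ↦ nβ` extends to
a continuous endomorphism of the circle. -/
theorem Irrational.exists_eq_int_mul_add_int {α β C : ℝ} (hα : Irrational α)
    (h : ∀ n p : ℤ, ∃ p' : ℤ, |n * β - p'| ≤ C * |n * α - p|) :
    ∃ l j : ℤ, β = l * α + j := by
  have hC0 : 0 ≤ C := by
    obtain ⟨p', hp'⟩ := h 1 0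
    have h1 : 0 < |((1 : ℤ) : ℝ) * α - ((0 : ℤ) : ℝ)| := by
      simpa using hα.ne_zero
    by_contra hC
    have := abs_nonneg (((1 : ℤ) : ℝ) * β - p')
    nlinarith
  -- for every small `δ` some bounded multiple `lα` approximates `β`
  have key : ∀ η > 0, ∃ l j : ℤ, |(l : ℝ)| ≤ C + 1 ∧ |β - l * α - j| ≤ C * (1 + |α|) * η := by
    intro η hη
    obtain ⟨n, p, -, hδ, hδη⟩ := hα.exists_int_mul_sub_small hη
    obtain ⟨p', hp'⟩ := h n p
    set δ := (n : ℝ) * α - p with hδdef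
    set δ' := (n : ℝ) * β - p' with hδ'def
    have hδ0 : δ ≠ 0 := abs_pos.1 hδ
    set s := δ' / δ with hs
    have hsC : |s| ≤ C := by
      rw [hs, abs_div, div_le_iff₀ hδ]; exact hp'
    have hsδ : δ' = s * δ := by rw [hs]; field_simp
    -- if `jδ` is close to `x`, then `jδ'` is close to `s x`
    have hround : ∀ x : ℝ, |round (x / δ) * δ - x| ≤ |δ| / 2 := by
      intro x
      have h1 := abs_sub_round (x / δ)
      have h2 : round (x / δ) * δ - x = -((x / δ - round (x / δ)) * δ) := by field_simp; ring
      rw [h2, abs_neg, abs_mul]; nlinarith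
    have hA : ∃ q : ℤ, |s - q| ≤ C * |δ| := by
      set j := round (1 / δ) with hj
      obtain ⟨q, hq⟩ := h (j * n) (j * p + 1)
      have h1 := hround 1
      rw [← hj] at h1
      have h2 : ((j * n : ℤ) : ℝ) * α - ((j * p + 1 : ℤ) : ℝ) = j * δ - 1 := by
        push_cast; rw [hδdef]; ring
      rw [h2] at hq
      refine ⟨q - j * p', ?_⟩
      have h3 : s - ((q - j * p' : ℤ) : ℝ) = (((j * n : ℤ) : ℝ) * β - q) - s * (j * δ - 1) := by
        have : s * (j * δ - 1) = j * δ' - s := by rw [hsδ]; ring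
        rw [this, hδ'def]; push_cast; ring
      rw [h3]
      refine (abs_sub _ _).trans ?_
      rw [abs_mul]
      have h4 : |s| * |j * δ - 1| ≤ C * (|δ| / 2) :=
        mul_le_mul hsC h1 (abs_nonneg _) hC0
      have h5 : C * |j * δ - 1| ≤ C * (|δ| / 2) := mul_le_mul_of_nonneg_left h1 hC0
      linarith
    have hB : ∃ q : ℤ, |β - s * α - q| ≤ C * |δ| := by
      set j := round (α / δ) with hj
      obtain ⟨q, hq⟩ := h (j * n - 1) (j * p)
      have h1 := hround α
      rw [← hj] at h1
      have h2 : ((j * n - 1 : ℤ) : ℝ) * α - ((j * p : ℤ) : ℝ) = j * δ - α := by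
        push_cast; rw [hδdef]; ring
      rw [h2] at hq
      refine ⟨j * p' - q, ?_⟩
      have h3 : β - s * α - ((j * p' - q : ℤ) : ℝ)
          = s * (j * δ - α) - (((j * n - 1 : ℤ) : ℝ) * β - q) := by
        have : s * (j * δ - α) = j * δ' - s * α := by rw [hsδ]; ring
        rw [this, hδ'def]; push_cast; ring
      rw [h3]
      refine (abs_sub _ _).trans ?_
      rw [abs_mul]
      have h4 : |s| * |j * δ - α| ≤ C * (|δ| / 2) :=
        mul_le_mul hsC h1 (abs_nonneg _) hC0
      have h5 : C * |j * δ - α| ≤ C * (|δ| / 2) := mul_le_mul_of_nonneg_left h1 hC0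
      linarith
    obtain ⟨q, hq⟩ := hB
    have hA' : |s - round s| ≤ C * |δ| := by
      obtain ⟨q', hq'⟩ := hA
      exact (round_le s q').trans hq'
    refine ⟨round s, q, ?_, ?_⟩
    · have h1 := abs_sub_round s
      have h2 : (round s : ℝ) = s - (s - round s) := by ring
      rw [h2]
      refine (abs_sub _ _).trans ?_
      linarith
    · have h1 : β - round s * α - q = (β - s * α - q) + (s - round s) * α := by ring
      rw [h1]
      refine (abs_add_le _ _).trans ?_
      rw [abs_mul]
      have h2 : |s - round s| * |α| ≤ C * |δ| * |α| :=
        mul_le_mul_of_nonneg_right hA' (abs_nonneg _)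
      have h3 : C * (1 + |α|) * |δ| ≤ C * (1 + |α|) * η :=
        mul_le_mul_of_nonneg_left hδη.le (by positivity)
      nlinarith
  -- only finitely many `l` are possible, so one of them is exact
  by_contra hne
  push Not at hne
  set N : ℤ := ⌈C + 1⌉ with hN
  have hpos : ∀ l : ℤ, 0 < |(β - l * α) - round (β - l * α)| := by
    intro l
    rw [abs_pos]
    intro h0
    exact hne l (round (β - l * α)) (by linarith)
  obtain ⟨l₀, -, hl₀⟩ := Finset.exists_min_image (Finset.Icc (-N) N)
    (fun l : ℤ ↦ |(β - l * α) - round (β - l * α)|)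
    (Finset.nonempty_Icc.2 (by
      have : 0 ≤ N := Int.ceil_nonneg (by linarith)
      linarith))
  set μ := |(β - l₀ * α) - round (β - l₀ * α)| with hμ
  have hμ0 : 0 < μ := hpos l₀
  obtain ⟨l, j, hl, hlj⟩ := key (μ / (2 * (C * (1 + |α|) + 1))) (by positivity)
  have hlN : l ∈ Finset.Icc (-N) N := by
    have h1 : (C + 1 : ℝ) ≤ N := Int.le_ceil _
    have h2 := abs_le.1 (hl.trans h1)
    rw [Finset.mem_Icc]
    exact ⟨by exact_mod_cast h2.1, by exact_mod_cast h2.2⟩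
  have h1 := (hl₀ l hlN).trans ((round_le (β - l * α) j).trans hlj)
  have h2 : C * (1 + |α|) * (μ / (2 * (C * (1 + |α|) + 1))) < μ := by
    rw [← mul_div_assoc, div_lt_iff₀ (by positivity)]
    have : 0 ≤ C * (1 + |α|) := by positivity
    nlinarith
  linarith

theorem Irrational.exists_eq_int_mul_add_int_of_chordSq {α β C : ℝ} (hα : Irrational α)
    (h : ∀ n : ℤ, chordSq (n * β) ≤ C * chordSq (n * α)) : ∃ l j : ℤ, β = l * α + j := by
  have hC0 : 0 ≤ C := by
    by_contra hC
    have h1 := h 1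
    have h2 := chordSq_nonneg (((1 : ℤ) : ℝ) * β)
    have h3 : 0 < chordSq (((1 : ℤ) : ℝ) * α) := by simpa using chordSq_pos hα
    nlinarith
  refine hα.exists_eq_int_mul_add_int (C := √(C * Real.pi ^ 2 / 4)) fun n p ↦ ⟨round (n * β), ?_⟩
  have h1 := sq_le_chordSq (n * β)
  have h2 := chordSq_le_sq (n * α) p
  have h3 := (h n).trans (mul_le_mul_of_nonneg_left h2 hC0)
  refine abs_le_of_sq_le_sq ?_ (by positivity)
  rw [mul_pow, Real.sq_sqrt (by positivity), sq_abs]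
  linarith

/-- Two irrational rotations whose powers move the points of the circle by comparable amounts agree
up to orientation: each angle is a multiple of the other, and the two factors are inverse integers.
-/
theorem Irrational.eq_or_eq_neg_of_chordSq {α β C C' : ℝ} (hα : Irrational α) (hβ : Irrational β)
    (h : ∀ n : ℤ, chordSq (n * β) ≤ C * chordSq (n * α))
    (h' : ∀ n : ℤ, chordSq (n * α) ≤ C' * chordSq (n * β)) :
    ∃ (σ j : ℤ), (σ = 1 ∨ σ = -1) ∧ β = σ * α + j := by
  obtain ⟨l, j, hl⟩ := hα.exists_eq_int_mul_add_int_of_chordSq h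
  obtain ⟨l', j', hl'⟩ := hβ.exists_eq_int_mul_add_int_of_chordSq h'
  refine ⟨l, j, ?_, hl⟩
  have h1 : ((1 - l * l' : ℤ) : ℝ) * α = ((l' * j + j' : ℤ) : ℝ) := by
    push_cast
    rw [hl] at hl'
    linear_combination hl'
  have h2 : 1 - l * l' = 0 := by
    by_contra hne
    exact (hα.intCast_mul hne).ne_int _ h1
  exact Int.isUnit_iff.1 (IsUnit.of_mul_eq_one l' (by linarith))

end Rotation

/-! ### Hyperbolic and Euclidean distances in the upper half-space -/

section UpperHalfSpace

/-- The hyperbolic distance as a function of points of `ℝ⁴`; it is meaningful for points of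
positive height. -/
noncomputable def upperDist (x y : E4) : ℝ :=
  Real.arcosh (1 + ‖x - y‖ ^ 2 / (2 * x 3 * y 3))

theorem hypDist_eq_upperDist (x y : H4) : hypDist x y = upperDist x.1 y.1 := rfl

variable {x y z : E4}

theorem upperDist_arg (hx : 0 < x 3) (hy : 0 < y 3) :
    1 ≤ 1 + ‖x - y‖ ^ 2 / (2 * x 3 * y 3) := by
  have : 0 ≤ ‖x - y‖ ^ 2 / (2 * x 3 * y 3) := by positivity
  linarith

theorem upperDist_nonneg (hx : 0 < x 3) (hy : 0 < y 3) : 0 ≤ upperDist x y :=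
  Real.arcosh_nonneg (upperDist_arg hx hy)

theorem upperDist_comm (x y : E4) : upperDist x y = upperDist y x := by
  rw [upperDist, upperDist, norm_sub_rev, mul_right_comm]

theorem upperDist_self (x : E4) : upperDist x x = 0 := by
  simp [upperDist]

theorem cosh_upperDist (hx : 0 < x 3) (hy : 0 < y 3) :
    Real.cosh (upperDist x y) = 1 + ‖x - y‖ ^ 2 / (2 * x 3 * y 3) :=
  Real.cosh_arcosh (upperDist_arg hx hy)

theorem sinh_half_upperDist (hx : 0 < x 3) (hy : 0 < y 3) :
    Real.sinh (upperDist x y / 2) = ‖x - y‖ / (2 * √(x 3 * y 3)) := by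
  have h1 := Real.cosh_two_mul (upperDist x y / 2)
  have h2 := Real.cosh_sq (upperDist x y / 2)
  rw [mul_div_cancel₀ _ (two_ne_zero), cosh_upperDist hx hy] at h1
  have h0 : 0 ≤ Real.sinh (upperDist x y / 2) :=
    Real.sinh_nonneg_iff.2 (by have := upperDist_nonneg hx hy; positivity)
  refine (sq_eq_sq₀ h0 (by positivity)).1 ?_
  rw [div_pow, mul_pow, Real.sq_sqrt (by positivity)]
  have : Real.sinh (upperDist x y / 2) ^ 2 = ‖x - y‖ ^ 2 / (2 * x 3 * y 3) / 2 := by linarith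
  rw [this]
  field_simp

/-- The reflection of `ℝ⁴` in the boundary hyperplane of the upper half-space. -/
noncomputable def reflectHeight (y : E4) : E4 := !₂[y 0, y 1, y 2, -y 3]

theorem norm_sub_reflectHeight_sq (x y : E4) :
    ‖x - reflectHeight y‖ ^ 2 = ‖x - y‖ ^ 2 + 4 * x 3 * y 3 := by
  rw [EuclideanSpace.norm_sq_eq, EuclideanSpace.norm_sq_eq, Fin.sum_univ_four, Fin.sum_univ_four]
  simp [reflectHeight]
  ring

theorem cosh_half_upperDist (hx : 0 < x 3) (hy : 0 < y 3) :
    Real.cosh (upperDist x y / 2) = ‖x - reflectHeight y‖ / (2 * √(x 3 * y 3)) := by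
  refine (sq_eq_sq₀ (Real.cosh_pos _).le (by positivity)).1 ?_
  rw [Real.cosh_sq, sinh_half_upperDist hx hy, div_pow, div_pow, norm_sub_reflectHeight_sq,
    mul_pow, Real.sq_sqrt (by positivity)]
  field_simp
  ring

/-- The triangle inequality, deduced from Ptolemy's inequality for `x, y, z` and the mirror image
of `y`. -/
theorem upperDist_triangle (hx : 0 < x 3) (hy : 0 < y 3) (hz : 0 < z 3) :
    upperDist x z ≤ upperDist x y + upperDist y z := by
  have key : Real.sinh (upperDist x z / 2) ≤
      Real.sinh (upperDist x y / 2 + upperDist z y / 2) := by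
    have hP := EuclideanGeometry.mul_dist_le_mul_dist_add_mul_dist x y z (reflectHeight y)
    simp only [dist_eq_norm] at hP
    have h2 : ‖y - reflectHeight y‖ = 2 * y 3 := by
      refine (sq_eq_sq₀ (norm_nonneg _) (by positivity)).1 ?_
      rw [norm_sub_reflectHeight_sq, sub_self, norm_zero]; ring
    rw [h2] at hP
    rw [Real.sinh_add, sinh_half_upperDist hx hz, sinh_half_upperDist hx hy,
      cosh_half_upperDist hx hy, sinh_half_upperDist hz hy, cosh_half_upperDist hz hy,
      Real.sqrt_mul hx.le, Real.sqrt_mul hx.le, Real.sqrt_mul hz.le]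
    have e1 : ‖x - z‖ / (2 * (√(x 3) * √(z 3)))
        = ‖x - z‖ * (2 * y 3) / (4 * y 3 * (√(x 3) * √(z 3))) := by
      field_simp; norm_num
    have hy2 : √(y 3) * √(y 3) = y 3 := Real.mul_self_sqrt hy.le
    have e2 : ‖x - y‖ / (2 * (√(x 3) * √(y 3))) * (‖z - reflectHeight y‖ / (2 * (√(z 3) * √(y 3))))
        + ‖x - reflectHeight y‖ / (2 * (√(x 3) * √(y 3))) * (‖z - y‖ / (2 * (√(z 3) * √(y 3))))
        = (‖x - y‖ * ‖z - reflectHeight y‖ + ‖y - z‖ * ‖x - reflectHeight y‖)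
          / (4 * y 3 * (√(x 3) * √(z 3))) := by
      rw [norm_sub_rev z y, div_mul_div_comm, div_mul_div_comm, ← add_div]
      congr 1
      · ring
      · linear_combination (4 * √(x 3) * √(z 3)) * hy2
    rw [e1, e2]
    exact div_le_div_of_nonneg_right hP (by positivity)
  have := Real.sinh_le_sinh.1 key
  rw [upperDist_comm y z]
  linarith

theorem upperDist_le_norm_div_sqrt (hx : 0 < x 3) (hy : 0 < y 3) :
    upperDist x y ≤ ‖x - y‖ / √(x 3 * y 3) := by
  have h1 := Real.self_le_sinh_iff.2 (show 0 ≤ upperDist x y / 2 by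
    have := upperDist_nonneg hx hy; positivity)
  rw [sinh_half_upperDist hx hy, mul_comm, ← div_div] at h1
  linarith

theorem upperDist_le_norm_div {m : ℝ} (hm : 0 < m) (hx : m ≤ x 3) (hy : m ≤ y 3) :
    upperDist x y ≤ ‖x - y‖ / m := by
  refine (upperDist_le_norm_div_sqrt (hm.trans_le hx) (hm.trans_le hy)).trans
    (div_le_div_of_nonneg_left (norm_nonneg _) hm ?_)
  exact Real.le_sqrt_of_sq_le (by nlinarith)

theorem abs_apply_le_norm (v : E4) (i : Fin 4) : |v i| ≤ ‖v‖ := by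
  simpa using PiLp.norm_apply_le v i

/-- The highest point at distance `d` from `x` lies above `x`, at height `x 3 * exp d`. -/
theorem height_le_mul_exp (hx : 0 < x 3) (hy : 0 < y 3) :
    y 3 ≤ x 3 * Real.exp (upperDist x y) := by
  set d := upperDist x y with hd
  by_contra! hlt
  have h0 := upperDist_nonneg hx hy
  have hc := cosh_upperDist hx hy
  rw [← hd, Real.cosh_eq] at hc
  have h1 : |x 3 - y 3| ≤ ‖x - y‖ := abs_apply_le_norm (x - y) 3
  have h2 : (x 3 - y 3) ^ 2 ≤ ‖x - y‖ ^ 2 := by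
    rw [← sq_abs]; exact pow_le_pow_left₀ (abs_nonneg _) h1 2
  have hE : 1 ≤ Real.exp d := Real.one_le_exp h0
  have hEi : Real.exp (-d) * Real.exp d = 1 := by rw [← Real.exp_add]; simp
  -- with `u = y₃ / x₃ > e ^ d` one has `u + u⁻¹ > e ^ d + e ^ (-d)`
  have h3 : ‖x - y‖ ^ 2 = 2 * x 3 * y 3 * ((Real.exp d + Real.exp (-d)) / 2 - 1) := by
    have : (Real.exp d + Real.exp (-d)) / 2 - 1 = ‖x - y‖ ^ 2 / (2 * x 3 * y 3) := by linarith
    rw [this]; field_simp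
  set E := Real.exp d
  set E' := Real.exp (-d)
  have hE' : 0 < E' := Real.exp_pos _
  have h4 : (x 3 - y 3) ^ 2 ≤ x 3 * y 3 * (E + E' - 2) := by nlinarith
  have h5 : (y 3 - x 3 * E) * (y 3 - x 3 * E') ≤ 0 := by
    have : (y 3 - x 3 * E) * (y 3 - x 3 * E')
      = (x 3 - y 3) ^ 2 - x 3 * y 3 * (E + E' - 2) + x 3 ^ 2 * (E' * E - 1) := by ring
    rw [this, hEi]; linarith
  have h6 : E' ≤ E := Real.exp_le_exp.2 (by linarith)
  have h7 : x 3 * E' ≤ x 3 * E := mul_le_mul_of_nonneg_left h6 hx.le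
  nlinarith

/-- Of the points at hyperbolic distance `d` from `x`, the one above `x` has the largest Euclidean
distance from `x`. -/
theorem norm_sub_le_mul_exp_sub_one (hx : 0 < x 3) (hy : 0 < y 3) :
    ‖x - y‖ ≤ x 3 * (Real.exp (upperDist x y) - 1) := by
  have h1 := height_le_mul_exp hx hy
  have h0 := upperDist_nonneg hx hy
  have hc := cosh_upperDist hx hy
  set d := upperDist x y with hd
  rw [Real.cosh_eq] at hc
  have hE : 1 ≤ Real.exp d := Real.one_le_exp h0
  have hEi : Real.exp (-d) * Real.exp d = 1 := by rw [← Real.exp_add]; simp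
  have h3 : ‖x - y‖ ^ 2 = 2 * x 3 * y 3 * ((Real.exp d + Real.exp (-d)) / 2 - 1) := by
    have : (Real.exp d + Real.exp (-d)) / 2 - 1 = ‖x - y‖ ^ 2 / (2 * x 3 * y 3) := by linarith
    rw [this]; field_simp
  have h2 : 0 ≤ Real.exp d + Real.exp (-d) - 2 := by
    have := Real.one_le_cosh d
    rw [Real.cosh_eq] at this; linarith
  refine abs_le_of_sq_le_sq (b := x 3 * (Real.exp d - 1)) ?_ (by nlinarith) |> fun h ↦
    (le_abs_self _).trans h
  rw [h3]
  have h4 : x 3 * y 3 * (Real.exp d + Real.exp (-d) - 2)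
      ≤ x 3 * (x 3 * Real.exp d) * (Real.exp d + Real.exp (-d) - 2) :=
    mul_le_mul_of_nonneg_right (mul_le_mul_of_nonneg_left h1 hx.le) h2
  have h5 : x 3 * (x 3 * Real.exp d) * (Real.exp d + Real.exp (-d) - 2)
      = (x 3 * (Real.exp d - 1)) ^ 2 := by
    linear_combination x 3 ^ 2 * hEi
  linarith

theorem exp_sub_one_le_two_mul {d : ℝ} (h0 : 0 ≤ d) (h1 : d ≤ 1) : Real.exp d - 1 ≤ 2 * d := by
  have := Real.abs_exp_sub_one_le (x := d) (by rwa [abs_of_nonneg h0])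
  rw [abs_of_nonneg h0] at this
  exact (le_abs_self _).trans this

theorem norm_sub_div_le_two_mul (hx : 0 < x 3) (hy : 0 < y 3) (h1 : upperDist x y ≤ 1) :
    ‖x - y‖ / x 3 ≤ 2 * upperDist x y := by
  rw [div_le_iff₀ hx]
  have := norm_sub_le_mul_exp_sub_one hx hy
  have h2 := exp_sub_one_le_two_mul (upperDist_nonneg hx hy) h1
  nlinarith

theorem eq_of_upperDist_nonpos (hx : 0 < x 3) (hy : 0 < y 3) (h : upperDist x y ≤ 0) : x = y := by
  have h0 : upperDist x y = 0 := le_antisymm h (upperDist_nonneg hx hy)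
  have := norm_sub_le_mul_exp_sub_one hx hy
  rw [h0, Real.exp_zero, sub_self, mul_zero] at this
  exact sub_eq_zero.1 (norm_le_zero_iff.1 this)

/-- Similarities of `ℝ⁴` that preserve the upper half-space are hyperbolic isometries. -/
theorem upperDist_smul_sub {c : ℝ} (hc : 0 < c) {v : E4} (hv : v 3 = 0) (x y : E4) :
    upperDist (c • (x - v)) (c • (y - v)) = upperDist x y := by
  have h1 : ‖c • (x - v) - c • (y - v)‖ ^ 2 = c ^ 2 * ‖x - y‖ ^ 2 := by
    rw [← smul_sub, sub_sub_sub_cancel_right, norm_smul, Real.norm_of_nonneg hc.le, mul_pow]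
  have h2 : ∀ w : E4, (c • (w - v)) 3 = c * w 3 := fun w ↦ by simp [hv]
  rw [upperDist, upperDist, h1, h2, h2]
  congr 2
  rw [show 2 * (c * x 3) * (c * y 3) = c ^ 2 * (2 * x 3 * y 3) by ring,
    mul_div_mul_left _ _ (by positivity)]

end UpperHalfSpace

/-! ### Screw translations and their displacements -/

section Screw

/-- The square of the distance `r` to the axis in cylindrical coordinates. -/
def radSq (x : E4) : ℝ := x 0 ^ 2 + x 1 ^ 2

theorem radSq_nonneg (x : E4) : 0 ≤ radSq x := by unfold radSq; positivity

/-- The map `(r, θ, z, t) ↦ (r, θ + a, z + b, t)` on all of `ℝ⁴`. -/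
noncomputable def scr (a b : ℝ) (x : E4) : E4 :=
  !₂[Real.cos (2 * Real.pi * a) * x 0 - Real.sin (2 * Real.pi * a) * x 1,
      Real.sin (2 * Real.pi * a) * x 0 + Real.cos (2 * Real.pi * a) * x 1,
      x 2 + b, x 3]

variable (a b c d : ℝ) (x y : E4)

@[simp] theorem scr_apply_zero : scr a b x 0
    = Real.cos (2 * Real.pi * a) * x 0 - Real.sin (2 * Real.pi * a) * x 1 := rfl
@[simp] theorem scr_apply_one : scr a b x 1
    = Real.sin (2 * Real.pi * a) * x 0 + Real.cos (2 * Real.pi * a) * x 1 := rfl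
@[simp] theorem scr_apply_two : scr a b x 2 = x 2 + b := rfl
@[simp] theorem scr_apply_three : scr a b x 3 = x 3 := rfl

theorem E4.ext {x y : E4} (h0 : x 0 = y 0) (h1 : x 1 = y 1) (h2 : x 2 = y 2) (h3 : x 3 = y 3) :
    x = y := by
  ext i
  fin_cases i <;> assumption

theorem E4.norm_sq (x : E4) : ‖x‖ ^ 2 = x 0 ^ 2 + x 1 ^ 2 + x 2 ^ 2 + x 3 ^ 2 := by
  rw [EuclideanSpace.norm_sq_eq, Fin.sum_univ_four]
  simp

theorem scr_scr : scr a b (scr c d x) = scr (a + c) (b + d) x := by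
  have e : 2 * Real.pi * (a + c) = 2 * Real.pi * a + 2 * Real.pi * c := by ring
  apply E4.ext <;> simp only [scr_apply_zero, scr_apply_one, scr_apply_two, scr_apply_three, e,
    Real.cos_add, Real.sin_add] <;> ring

theorem scr_zero_zero : scr 0 0 x = x := by
  apply E4.ext <;> simp

theorem norm_scr_sub_scr : ‖scr a b x - scr a b y‖ = ‖x - y‖ := by
  refine (sq_eq_sq₀ (norm_nonneg _) (norm_nonneg _)).1 ?_
  have h := Real.sin_sq_add_cos_sq (2 * Real.pi * a)
  rw [E4.norm_sq, E4.norm_sq]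
  simp only [PiLp.sub_apply, scr_apply_zero, scr_apply_one, scr_apply_two, scr_apply_three]
  linear_combination ((x 0 - y 0) ^ 2 + (x 1 - y 1) ^ 2) * h

theorem radSq_scr : radSq (scr a b x) = radSq x := by
  have h := Real.sin_sq_add_cos_sq (2 * Real.pi * a)
  simp only [radSq, scr_apply_zero, scr_apply_one]
  linear_combination (x 0 ^ 2 + x 1 ^ 2) * h

theorem norm_scr_sub_self_sq : ‖scr a b x - x‖ ^ 2 = b ^ 2 + chordSq a * radSq x := by
  have h := Real.sin_sq_add_cos_sq (2 * Real.pi * a)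
  rw [E4.norm_sq, chordSq, radSq]
  simp only [PiLp.sub_apply, scr_apply_zero, scr_apply_one, scr_apply_two, scr_apply_three]
  linear_combination (x 0 ^ 2 + x 1 ^ 2) * h

theorem norm_scr_sub_scr_sq (a b c d : ℝ) (x : E4) :
    ‖scr a b x - scr c d x‖ ^ 2 = (b - d) ^ 2 + chordSq (a - c) * radSq x := by
  have h : scr a b x = scr c d (scr (a - c) (b - d) x) := by
    rw [scr_scr]; congr 1 <;> ring
  rw [h, norm_scr_sub_scr, norm_scr_sub_self_sq]

theorem scr_combo {s t : ℝ} (hst : s + t = 1) :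
    scr a b (s • x + t • y) = s • scr a b x + t • scr a b y := by
  apply E4.ext <;> simp only [PiLp.add_apply, PiLp.smul_apply, smul_eq_mul, scr_apply_zero,
    scr_apply_one, scr_apply_two, scr_apply_three]
  · ring
  · ring
  · linear_combination (-b) * hst

theorem continuous_scr : Continuous (scr a b) := by
  refine (LipschitzWith.of_dist_le_mul (K := 1) fun x y ↦ ?_).continuous
  rw [dist_eq_norm, dist_eq_norm, norm_scr_sub_scr, NNReal.coe_one, one_mul]

theorem upperDist_scr : upperDist (scr a b x) (scr a b y) = upperDist x y := by
  rw [upperDist, upperDist, norm_scr_sub_scr, scr_apply_three, scr_apply_three]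

theorem screw_zpow_val (α : ℝ) (n : ℤ) (x : H4) :
    ((screw α ^ n) x).1 = scr (n * α) n x.1 := by
  have h1 : ∀ y : H4, (screw α y).1 = scr α 1 y.1 := fun _ ↦ rfl
  have h2 : ∀ y : H4, ((screw α)⁻¹ y).1 = scr (-α) (-1) y.1 := fun _ ↦ rfl
  induction n with
  | zero => simp [scr_zero_zero]
  | succ n ih =>
    rw [add_comm, zpow_add, zpow_one, Equiv.Perm.mul_apply, h1, ih, scr_scr]
    push_cast
    congr 1
    ring
  | pred n ih =>
    rw [show -(n : ℤ) - 1 = -1 + -(n : ℤ) by ring, zpow_add, zpow_neg_one, Equiv.Perm.mul_apply,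
      h2, ih, scr_scr]
    push_cast
    congr 1
    ring

theorem screw_zpow_ne_one (α : ℝ) {n : ℤ} (hn : n ≠ 0) : screw α ^ n ≠ 1 := by
  intro h
  have h1 := screw_zpow_val α n ⟨!₂[0, 0, 0, 1], by simp⟩
  rw [h] at h1
  have h2 := congrArg (fun v : E4 ↦ v 2) h1
  simp at h2
  exact hn (by exact_mod_cast h2.symm)

/-- The integer power of `g_α` on `ℝ⁴`. -/
noncomputable def spow (α : ℝ) (n : ℤ) (x : E4) : E4 := scr (n * α) n x

theorem spow_spow (α : ℝ) (m n : ℤ) (x : E4) : spow α m (spow α n x) = spow α (m + n) x := by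
  rw [spow, spow, scr_scr, spow]
  push_cast
  congr 1
  ring

theorem spow_zero (α : ℝ) (x : E4) : spow α 0 x = x := by simp [spow, scr_zero_zero]

@[simp] theorem spow_apply_three (α : ℝ) (n : ℤ) (x : E4) : spow α n x 3 = x 3 := rfl

theorem spow_apply_two (α : ℝ) (n : ℤ) (x : E4) : spow α n x 2 = x 2 + n := rfl

theorem spow_right_injective {α : ℝ} {m n : ℤ} {x : E4} (h : spow α m x = spow α n x) :
    m = n := by
  have h1 := congrArg (fun v : E4 ↦ v 2) h
  simp only [spow_apply_two] at h1
  exact_mod_cast add_left_cancel h1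

/-- The Euclidean displacement of `g_αⁿ`, measured in units of the height. -/
noncomputable def disp (α : ℝ) (n : ℤ) (x : E4) : ℝ := ‖spow α n x - x‖ / x 3

theorem norm_spow_sub_self_sq (α : ℝ) (n : ℤ) (x : E4) :
    ‖spow α n x - x‖ ^ 2 = (n : ℝ) ^ 2 + chordSq (n * α) * radSq x :=
  norm_scr_sub_self_sq _ _ _

theorem disp_sq (α : ℝ) (n : ℤ) (x : E4) :
    disp α n x ^ 2 = ((n : ℝ) ^ 2 + chordSq (n * α) * radSq x) / x 3 ^ 2 := by
  rw [disp, div_pow, norm_spow_sub_self_sq]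

theorem disp_nonneg (α : ℝ) (n : ℤ) {x : E4} (hx : 0 < x 3) : 0 ≤ disp α n x := by
  unfold disp; positivity

theorem norm_spow_sub_spow (α : ℝ) (n : ℤ) (x y : E4) :
    ‖spow α n x - spow α n y‖ = ‖x - y‖ := norm_scr_sub_scr _ _ _ _

theorem disp_spow (α : ℝ) (n m : ℤ) (x : E4) : disp α n (spow α m x) = disp α n x := by
  rw [disp, disp, spow_spow, add_comm, ← spow_spow, norm_spow_sub_spow]
  rfl

theorem disp_neg (α : ℝ) (n : ℤ) {x : E4} (hx : 0 < x 3) : disp α (-n) x = disp α n x := by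
  refine (sq_eq_sq₀ (disp_nonneg _ _ hx) (disp_nonneg _ _ hx)).1 ?_
  rw [disp_sq, disp_sq]
  push_cast
  rw [neg_mul, chordSq_neg, neg_sq]

theorem upperDist_spow (α : ℝ) (n : ℤ) (x y : E4) :
    upperDist (spow α n x) (spow α n y) = upperDist x y := upperDist_scr _ _ _ _

theorem disp_le_two_mul (α : ℝ) (n : ℤ) {x : E4} (hx : 0 < x 3)
    (h1 : upperDist x (spow α n x) ≤ 1) : disp α n x ≤ 2 * upperDist x (spow α n x) := by
  have := norm_sub_div_le_two_mul (y := spow α n x) hx hx h1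
  rwa [norm_sub_rev] at this

/-- The displacement that corresponds to the hyperbolic distance `ε`. -/
noncomputable def chordBound (ε : ℝ) : ℝ := √(2 * (Real.cosh ε - 1))

theorem chordBound_pos {ε : ℝ} (hε : 0 < ε) : 0 < chordBound ε := by
  have := Real.one_lt_cosh.2 hε.ne'
  exact Real.sqrt_pos.2 (by linarith)

/-- As `g_αⁿ` preserves the height, its hyperbolic displacement is a function of the Euclidean
displacement divided by the height. -/
theorem upperDist_spow_self_lt_iff (α : ℝ) (n : ℤ) {ε : ℝ} (hε : 0 < ε) {x : E4} (hx : 0 < x 3) :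
    upperDist (spow α n x) x < ε ↔ disp α n x < chordBound ε := by
  have h0 := upperDist_nonneg (x := spow α n x) (y := x) hx hx
  have h1 : upperDist (spow α n x) x < ε ↔ Real.cosh (upperDist (spow α n x) x) < Real.cosh ε := by
    rw [Real.cosh_lt_cosh, abs_of_nonneg h0, abs_of_pos hε]
  rw [h1, cosh_upperDist (by exact hx) hx, chordBound, Real.lt_sqrt (disp_nonneg _ _ hx), disp,
    div_pow, spow_apply_three]
  have e : ‖spow α n x - x‖ ^ 2 / (2 * x 3 * x 3) = (‖spow α n x - x‖ ^ 2 / x 3 ^ 2) / 2 := by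
    field_simp
  rw [e]
  constructor <;> intro h <;> linarith

theorem mem_margulisRegion_iff {ε α : ℝ} (hε : 0 < ε) (x : H4) :
    x ∈ margulisRegion ε α ↔ ∃ n : ℤ, n ≠ 0 ∧ disp α n x.1 < chordBound ε := by
  constructor
  · rintro ⟨γ, ⟨n, rfl⟩, hne, hlt⟩
    refine ⟨n, fun h ↦ hne (by simp [h]), ?_⟩
    rw [hypDist_eq_upperDist] at hlt
    dsimp only at hlt
    rw [screw_zpow_val] at hlt
    exact (upperDist_spow_self_lt_iff α n hε x.2).1 hlt
  · rintro ⟨n, hn, hlt⟩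
    refine ⟨screw α ^ n, ⟨n, rfl⟩, screw_zpow_ne_one α hn, ?_⟩
    rw [hypDist_eq_upperDist, screw_zpow_val]
    exact (upperDist_spow_self_lt_iff α n hε x.2).2 hlt

end Screw

/-! ### The quotient distance -/

section QuotientDistance

variable {ε α β : ℝ}

theorem cuspMk_eq_iff (x y : margulisRegion ε α) :
    cuspMk x = cuspMk y ↔ ∃ n : ℤ, x.1.1 = spow α n y.1.1 := by
  have h1 : cuspMk x = cuspMk y ↔ x.1 ∈ MulAction.orbit (Subgroup.zpowers (screw α)) y.1 :=
    Quotient.eq (r := cuspSetoid ε α)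
  rw [h1]
  constructor
  · rintro ⟨⟨γ, n, rfl⟩, h⟩
    refine ⟨n, ?_⟩
    rw [← h]
    exact screw_zpow_val α n y.1
  · rintro ⟨n, h⟩
    exact ⟨⟨screw α ^ n, n, rfl⟩, Subtype.ext ((screw_zpow_val α n y.1).trans h.symm)⟩

theorem cuspDist_le (x y : margulisRegion ε α) :
    cuspDist (cuspMk x) (cuspMk y) ≤ upperDist x.1.1 y.1.1 := by
  refine csInf_le ⟨0, ?_⟩ ⟨x, y, rfl, rfl, rfl⟩
  rintro d ⟨x', y', -, -, rfl⟩
  exact upperDist_nonneg x'.1.2 y'.1.2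

/-- Screw translations act properly: a hyperbolic ball bounds the `z`-coordinate. -/
theorem finite_setOf_upperDist_spow_le (α : ℝ) {x y : E4} (hx : 0 < x 3) (hy : 0 < y 3) (R : ℝ) :
    {n : ℤ | upperDist x (spow α n y) ≤ R}.Finite := by
  set A := x 3 * (Real.exp R - 1) with hA
  refine (Set.finite_Icc ⌊x 2 - y 2 - A⌋ ⌈x 2 - y 2 + A⌉).subset fun n hn ↦ ?_
  have h1 := norm_sub_le_mul_exp_sub_one (y := spow α n y) hx hy
  have h2 := abs_apply_le_norm (x - spow α n y) 2
  have h3 : Real.exp (upperDist x (spow α n y)) ≤ Real.exp R := Real.exp_le_exp.2 hn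
  have h4 : |x 2 - (y 2 + n)| ≤ A := by
    refine h2.trans (h1.trans ?_)
    exact mul_le_mul_of_nonneg_left (by linarith) hx.le
  rw [abs_le] at h4
  rw [Set.mem_Icc]
  constructor
  · have : (⌊x 2 - y 2 - A⌋ : ℝ) ≤ n := (Int.floor_le _).trans (by linarith)
    exact_mod_cast this
  · have : (n : ℝ) ≤ ⌈x 2 - y 2 + A⌉ := le_trans (by linarith) (Int.le_ceil _)
    exact_mod_cast this

theorem mem_margulisRegion_of_eq_spow (hε : 0 < ε) {x y : H4} (hx : x ∈ margulisRegion ε α)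
    {n : ℤ} (h : y.1 = spow α n x.1) : y ∈ margulisRegion ε α := by
  obtain ⟨j, hj, hlt⟩ := (mem_margulisRegion_iff hε _).1 hx
  refine (mem_margulisRegion_iff hε _).2 ⟨j, hj, ?_⟩
  rwa [h, disp_spow]

/-- The infimum in the quotient distance is attained. -/
theorem exists_cuspDist_eq (hε : 0 < ε) (x y : margulisRegion ε α) :
    ∃ n : ℤ, cuspDist (cuspMk x) (cuspMk y) = upperDist x.1.1 (spow α n y.1.1) := by
  obtain ⟨n, hn, hmin⟩ := Set.exists_min_image _ (fun n : ℤ ↦ upperDist x.1.1 (spow α n y.1.1))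
    (finite_setOf_upperDist_spow_le α x.1.2 y.1.2 (upperDist x.1.1 y.1.1))
    ⟨0, by simp [spow_zero]⟩
  have hmin' : ∀ j : ℤ, upperDist x.1.1 (spow α n y.1.1) ≤ upperDist x.1.1 (spow α j y.1.1) := by
    intro j
    rcases le_or_gt (upperDist x.1.1 (spow α j y.1.1)) (upperDist x.1.1 y.1.1) with h | h
    · exact hmin j h
    · exact le_trans hn h.le
  refine ⟨n, IsLeast.csInf_eq ⟨?_, ?_⟩⟩
  · have hmem : (screw α ^ n) y.1 ∈ margulisRegion ε α := by
      exact mem_margulisRegion_of_eq_spow hε y.2 (screw_zpow_val α n y.1)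
    refine ⟨x, ⟨_, hmem⟩, rfl, (cuspMk_eq_iff _ _).2 ⟨n, screw_zpow_val α n y.1⟩, ?_⟩
    rw [hypDist_eq_upperDist, screw_zpow_val]
    rfl
  · rintro d ⟨x', y', hx', hy', rfl⟩
    obtain ⟨i, hi⟩ := (cuspMk_eq_iff _ _).1 hx'
    obtain ⟨j, hj⟩ := (cuspMk_eq_iff _ _).1 hy'
    rw [hypDist_eq_upperDist, hi, hj, ← upperDist_spow α (-i) (spow α i _), spow_spow, spow_spow,
      neg_add_cancel, spow_zero]
    exact hmin' _

theorem eq_of_cuspDist_nonpos (hε : 0 < ε) {p q : MargulisCusp ε α} (h : cuspDist p q ≤ 0) :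
    p = q := by
  obtain ⟨x, rfl⟩ := Quotient.exists_rep p
  obtain ⟨y, rfl⟩ := Quotient.exists_rep q
  obtain ⟨n, hn⟩ := exists_cuspDist_eq hε x y
  refine (cuspMk_eq_iff x y).2 ⟨n, eq_of_upperDist_nonpos x.1.2 y.1.2 ?_⟩
  rw [← hn]; exact h

end QuotientDistance

/-! ### Convex tubes in the Margulis region -/

section Tube

/-- The points of the upper half-space that `g_αᴺ` moves by less than `ε`: a convex open piece of
the Margulis region, invariant under `g_α`. -/
def tube (ε α : ℝ) (N : ℤ) : Set E4 := {x | ‖spow α N x - x‖ < chordBound ε * x 3}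

variable {ε α : ℝ} {N : ℤ} {x : E4}

theorem pos_of_mem_tube (hε : 0 < ε) (hx : x ∈ tube ε α N) : 0 < x 3 := by
  have h1 := (norm_nonneg _).trans_lt (show ‖spow α N x - x‖ < chordBound ε * x 3 from hx)
  exact pos_of_mul_pos_right h1 (chordBound_pos hε).le

theorem continuous_height : Continuous fun x : E4 ↦ x 3 := by fun_prop

theorem isOpen_tube (ε α : ℝ) (N : ℤ) : IsOpen (tube ε α N) :=
  isOpen_lt (((continuous_scr _ _).sub continuous_id).norm)
    (continuous_const.mul continuous_height)

theorem convex_tube (ε α : ℝ) (N : ℤ) : Convex ℝ (tube ε α N) := by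
  intro x hx y hy s t hs ht hst
  have hx : ‖spow α N x - x‖ < chordBound ε * x 3 := hx
  have hy : ‖spow α N y - y‖ < chordBound ε * y 3 := hy
  change ‖scr _ _ (s • x + t • y) - (s • x + t • y)‖ < chordBound ε * (s • x + t • y) 3
  rw [scr_combo _ _ _ _ hst]
  have h1 : s • scr (N * α) N x + t • scr (N * α) N y - (s • x + t • y)
      = s • (spow α N x - x) + t • (spow α N y - y) := by
    simp only [spow, smul_sub]; abel
  rw [h1]
  refine (norm_add_le _ _).trans_lt ?_
  rw [norm_smul, norm_smul, Real.norm_of_nonneg hs, Real.norm_of_nonneg ht]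
  have h2 : (s • x + t • y) 3 = s * x 3 + t * y 3 := by simp
  rw [h2]
  rcases hs.eq_or_lt with rfl | hs0
  · have : t = 1 := by linarith
    subst this; linarith
  · nlinarith [mul_lt_mul_of_pos_left hx hs0, mul_le_mul_of_nonneg_left hy.le ht]

theorem spow_mem_tube (hx : x ∈ tube ε α N) (n : ℤ) : spow α n x ∈ tube ε α N := by
  change ‖spow α N (spow α n x) - spow α n x‖ < chordBound ε * x 3
  rw [spow_spow, add_comm, ← spow_spow, norm_spow_sub_spow]
  exact hx

theorem mem_tube_iff_sq (hε : 0 < ε) (hx : 0 < x 3) :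
    x ∈ tube ε α N ↔ (N : ℝ) ^ 2 + chordSq (N * α) * radSq x < (chordBound ε * x 3) ^ 2 := by
  rw [← norm_spow_sub_self_sq]
  exact (sq_lt_sq₀ (norm_nonneg _) (mul_nonneg (chordBound_pos hε).le hx.le)).symm

theorem mem_margulisRegion_of_mem_tube (hε : 0 < ε) (hN : N ≠ 0) (hx : x ∈ tube ε α N) :
    (⟨x, pos_of_mem_tube hε hx⟩ : H4) ∈ margulisRegion ε α := by
  refine (mem_margulisRegion_iff hε _).2 ⟨N, hN, ?_⟩
  rw [disp, div_lt_iff₀ (pos_of_mem_tube hε hx)]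
  exact hx

theorem tube_nonempty (hε : 0 < ε) (α : ℝ) (N : ℤ) : (tube ε α N).Nonempty := by
  have hc := chordBound_pos hε
  have hpos : 0 < (|(N : ℝ)| + 1) / chordBound ε := by positivity
  refine ⟨!₂[0, 0, 0, (|(N : ℝ)| + 1) / chordBound ε],
    (mem_tube_iff_sq hε (by simpa using hpos)).2 ?_⟩
  simp only [radSq, Matrix.cons_val, ne_eq, OfNat.ofNat_ne_zero,
    not_false_eq_true, zero_pow, add_zero, mul_zero]
  rw [mul_div_cancel₀ _ hc.ne', ← sq_abs (N : ℝ)]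
  nlinarith [abs_nonneg (N : ℝ)]

end Tube

/-! ### The covering by the upper half-space and lifts of maps of cusps -/

section Lift

variable {ε α β : ℝ}

theorem continuous_zpowers_smul (β : ℝ) (g : Subgroup.zpowers (screw β)) :
    Continuous fun x : H4 ↦ g • x := by
  obtain ⟨γ, n, rfl⟩ := g
  refine Continuous.subtype_mk (f := fun x : H4 ↦ spow β n x.1)
    ((continuous_scr _ _).comp continuous_subtype_val) (fun x ↦ x.2) |>.congr fun x ↦ ?_
  exact Subtype.ext (screw_zpow_val β n x).symm

/-- The orbit map of the cyclic group generated by a screw translation is a covering: the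
translates of a slab of width one in the `z`-direction are disjoint. -/
theorem isQuotientCoveringMap_orbit (β : ℝ) :
    IsQuotientCoveringMap (Quotient.mk (MulAction.orbitRel (Subgroup.zpowers (screw β)) H4))
      (Subgroup.zpowers (screw β)) where
  toIsQuotientMap := isQuotientMap_quotient_mk'
  continuous_const_smul := continuous_zpowers_smul β
  apply_eq_iff_mem_orbit := Quotient.eq
  disjoint e := by
    refine ⟨{y : H4 | |y.1 2 - e.1 2| < 1 / 2}, ?_, ?_⟩
    · refine IsOpen.mem_nhds (isOpen_lt ?_ continuous_const) (by simp)
      have : Continuous fun y : H4 ↦ y.1 2 :=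
        (PiLp.continuous_apply 2 _ 2).comp continuous_subtype_val
      exact (this.sub continuous_const).abs
    · rintro ⟨γ, n, rfl⟩ ⟨z, ⟨y, hy, rfl⟩, hz⟩
      have h1 : ((screw β ^ n) y).1 2 = y.1 2 + n := by
        rw [screw_zpow_val]; rfl
      have hz' : |((screw β ^ n) y).1 2 - e.1 2| < 1 / 2 := hz
      rw [h1] at hz'
      have hy' : |y.1 2 - e.1 2| < 1 / 2 := hy
      rw [abs_lt] at hy' hz'
      have h2 : (-1 : ℝ) < n := by linarith
      have h3 : (n : ℝ) < 1 := by linarith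
      have h4 : n = 0 := by
        have h5 : (-1 : ℤ) < n := by exact_mod_cast h2
        have h6 : n < 1 := by exact_mod_cast h3
        omega
      subst h4
      exact Subtype.ext (zpow_zero _)

theorem tendsto_upperDist_nhds {x : E4} (hx : 0 < x 3) :
    Tendsto (fun y ↦ upperDist x y) (𝓝 x) (𝓝 0) := by
  have hpos : ∀ᶠ y : E4 in 𝓝 x, x 3 / 2 < y 3 :=
    continuous_height.continuousAt.eventually (lt_mem_nhds (by linarith))
  have h1 : Tendsto (fun y : E4 ↦ ‖x - y‖ / (x 3 / 2)) (𝓝 x) (𝓝 0) := by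
    have : Continuous fun y : E4 ↦ ‖x - y‖ / (x 3 / 2) := by fun_prop
    simpa using this.tendsto x
  refine tendsto_of_tendsto_of_tendsto_of_le_of_le' tendsto_const_nhds h1 ?_ ?_
  · filter_upwards [hpos] with y hy using upperDist_nonneg hx (by linarith)
  · filter_upwards [hpos] with y hy using upperDist_le_norm_div (by linarith) (by linarith) hy.le

/-- A bi-Lipschitz map of cusps is continuous for the quotient topology of the target, so it lifts
to the convex set `tube ε α N`. -/
theorem exists_isLocalLift (hε : 0 < ε) {N : ℤ} (hN : N ≠ 0)
    {f : MargulisCusp ε α → MargulisCusp ε β} (hf : IsBiLipschitzEmbedding f) :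
    ∃ F : E4 → E4, IsLocalLift f (tube ε α N) F := by
  obtain ⟨k, hk1, hk⟩ := hf
  set V := tube ε α N with hV
  set P : V → margulisRegion ε α := fun x ↦
    ⟨⟨x.1, pos_of_mem_tube hε x.2⟩, mem_margulisRegion_of_mem_tube hε hN x.2⟩ with hP
  set Q : V → margulisRegion ε β := fun x ↦ Quotient.out (f (cuspMk (P x))) with hQ
  have hfQ : ∀ x, f (cuspMk (P x)) = cuspMk (Q x) := fun x ↦ (Quotient.out_eq _).symm
  set pr := Quotient.mk (MulAction.orbitRel (Subgroup.zpowers (screw β)) H4) with hpr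
  have hcov := isQuotientCoveringMap_orbit β
  -- the representatives `Q x` are chosen arbitrarily, but their orbits depend continuously on `x`:
  -- the bound for `cuspDist` supplies a translate of `Q y` close to `Q x`
  have hcont : Continuous fun x : V ↦ pr (Q x).1 := by
    rw [continuous_iff_continuousAt]
    intro x O hO
    have hO' : pr ⁻¹' O ∈ 𝓝 (Q x).1 := hcov.continuous.continuousAt hO
    rw [nhds_subtype_eq_comap, Filter.mem_comap] at hO'
    obtain ⟨W, hW, hWO⟩ := hO'
    obtain ⟨η, hη, hηW⟩ := Metric.mem_nhds_iff.1 hW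
    have hx3 := pos_of_mem_tube hε x.2
    have h1 : Tendsto (fun y : V ↦ (Q x).1.1 3 * (Real.exp (k * upperDist x.1 y.1) - 1)) (𝓝 x)
        (𝓝 0) := by
      have h2 : Tendsto (fun y : V ↦ upperDist x.1 y.1) (𝓝 x) (𝓝 0) :=
        (tendsto_upperDist_nhds hx3).comp continuous_subtype_val.continuousAt
      have h3 := ((Real.continuous_exp.tendsto _).comp (h2.const_mul k)).sub_const 1
      simpa using h3.const_mul ((Q x).1.1 3)
    have h4 := h1.eventually (gt_mem_nhds hη)
    change ∀ᶠ y in 𝓝 x, pr (Q y).1 ∈ O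
    filter_upwards [h4] with y hy
    obtain ⟨n, hn⟩ := exists_cuspDist_eq hε (Q x) (Q y)
    have h5 : upperDist (Q x).1.1 (spow β n (Q y).1.1) ≤ k * upperDist x.1 y.1 := by
      rw [← hn, ← hfQ, ← hfQ]
      exact ((hk _ _).2).trans (mul_le_mul_of_nonneg_left (cuspDist_le (P x) (P y)) (by linarith))
    have h6 := norm_sub_le_mul_exp_sub_one (y := spow β n (Q y).1.1) (Q x).1.2 (Q y).1.2
    have h7 : ‖(Q x).1.1 - spow β n (Q y).1.1‖ < η := by
      refine h6.trans_lt (lt_of_le_of_lt ?_ hy)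
      exact mul_le_mul_of_nonneg_left (by linarith [Real.exp_le_exp.2 h5]) (Q x).1.2.le
    have h8 : (screw β ^ n) (Q y).1 ∈ pr ⁻¹' O := by
      refine hWO (hηW ?_)
      rw [Metric.mem_ball, dist_comm, dist_eq_norm, screw_zpow_val]
      exact h7
    have h9 : pr ((screw β ^ n) (Q y).1) = pr (Q y).1 :=
      hcov.map_smul (⟨screw β ^ n, n, rfl⟩ : Subgroup.zpowers (screw β))
    rw [← h9]
    exact h8
  obtain ⟨x₀, hx₀⟩ := tube_nonempty hε α N
  have : ContractibleSpace V := (convex_tube ε α N).contractibleSpace ⟨x₀, hx₀⟩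
  have : LocallyPathConnectedSpace V := (isOpen_tube ε α N).locallyPathConnectedSpace
  obtain ⟨F, ⟨-, hF⟩, -⟩ := hcov.isCoveringMap.existsUnique_continuousMap_lifts
    ⟨_, hcont⟩ ⟨x₀, hx₀⟩ (Q ⟨x₀, hx₀⟩).1 rfl
  classical
  -- the value outside the tube is irrelevant
  refine ⟨fun x ↦ if h : x ∈ V then (F ⟨x, h⟩).1 else 0, isOpen_tube ε α N, ?_, ?_⟩
  · rw [continuousOn_iff_continuous_domRestrict]
    refine (continuous_subtype_val.comp F.continuous).congr fun x ↦ ?_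
    simp [Set.domRestrict]
  · intro x hx
    have h1 : pr (F ⟨x, hx⟩) = pr (Q ⟨x, hx⟩).1 := congrFun hF ⟨x, hx⟩
    obtain ⟨⟨γ, n, rfl⟩, hn⟩ := hcov.apply_eq_iff_mem_orbit.1 h1
    have hn' : (screw β ^ n) (Q ⟨x, hx⟩).1 = F ⟨x, hx⟩ := hn
    have hmem : F ⟨x, hx⟩ ∈ margulisRegion ε β := by
      refine mem_margulisRegion_of_eq_spow hε (Q ⟨x, hx⟩).2 (n := n) ?_
      rw [← hn']
      exact screw_zpow_val β n _
    refine ⟨P ⟨x, hx⟩, ⟨_, hmem⟩, rfl, by simp [hx], ?_⟩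
    rw [hfQ]
    refine ((cuspMk_eq_iff _ _).2 ⟨n, ?_⟩).symm
    change (F ⟨x, hx⟩).1 = _
    rw [← hn', screw_zpow_val]
    rfl

end Lift

/-! ### Equivariance and local bi-Lipschitz bounds for lifts -/

section CuspLift

/-- The properties of a lift `F` of a `k`-bi-Lipschitz map of cusps to a convex set `V` that the
argument uses; `m` is the degree of the map on the fundamental groups. -/
structure IsCuspLift (k : ℝ) (V : Set E4) (α β : ℝ) (m : ℤ) (F : E4 → E4) : Prop where
  one_le : 1 ≤ k
  isOpen : IsOpen V
  convex : Convex ℝ V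
  pos_of_mem : ∀ x ∈ V, 0 < x 3
  spow_mem : ∀ x ∈ V, ∀ n : ℤ, spow α n x ∈ V
  pos : ∀ x ∈ V, 0 < F x 3
  continuousOn : ContinuousOn F V
  local_biLipschitz : ∀ x ∈ V, ∃ O ∈ 𝓝 x, O ⊆ V ∧ ∀ y ∈ O, ∀ y' ∈ O,
    upperDist (F y) (F y') ≤ k * upperDist y y' ∧ upperDist y y' ≤ k * upperDist (F y) (F y')
  equivariant : ∀ x ∈ V, ∀ n : ℤ, F (spow α n x) = spow β (m * n) (F x)
  eq_spow : ∀ x ∈ V, ∀ y ∈ V, ∀ j : ℤ, F y = spow β j (F x) → ∃ n : ℤ, y = spow α n x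

/-- If `x` is close to `g_αⁿ y` and the `z`-coordinates of `x` and `y` are close, then `n = 0`. -/
theorem eq_zero_of_upperDist_spow_le {α d : ℝ} {n : ℤ} {x y : E4} (hx : 0 < x 3) (hy : 0 < y 3)
    (hd : upperDist x (spow α n y) ≤ d) (hd' : x 3 * (Real.exp d - 1) ≤ 1 / 2)
    (hxy : |x 2 - y 2| < 1 / 4) : n = 0 := by
  have h1 := norm_sub_le_mul_exp_sub_one (y := spow α n y) hx hy
  have h2 := abs_apply_le_norm (x - spow α n y) 2
  have h3 : Real.exp (upperDist x (spow α n y)) ≤ Real.exp d := Real.exp_le_exp.2 hd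
  have h4 : |x 2 - (y 2 + n)| ≤ 1 / 2 := by
    refine h2.trans (h1.trans (le_trans ?_ hd'))
    exact mul_le_mul_of_nonneg_left (by linarith) hx.le
  rw [abs_le] at h4
  rw [abs_lt] at hxy
  have h5 : (-1 : ℝ) < n := by linarith
  have h6 : (n : ℝ) < 1 := by linarith
  have h7 : (-1 : ℤ) < n := by exact_mod_cast h5
  have h8 : n < 1 := by exact_mod_cast h6
  omega

/-- A lift of a `k`-bi-Lipschitz map of cusps to a tube is locally `k`-bi-Lipschitz, as the
quotient distance is locally the hyperbolic distance. It is equivariant with a degree `m` that does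
not depend on the point, because the tube is connected. -/
theorem exists_isCuspLift {ε α β : ℝ} (hε : 0 < ε) {N : ℤ}
    {f : MargulisCusp ε α → MargulisCusp ε β} {k : ℝ} (hk1 : 1 ≤ k)
    (hk : ∀ p q : MargulisCusp ε α,
      k⁻¹ * cuspDist p q ≤ cuspDist (f p) (f q) ∧ cuspDist (f p) (f q) ≤ k * cuspDist p q)
    {F : E4 → E4} (hF : IsLocalLift f (tube ε α N) F) :
    ∃ m : ℤ, IsCuspLift k (tube ε α N) α β m F := by
  set V := tube ε α N with hV
  obtain ⟨hopen, hcont, hlift⟩ := hF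
  have hk0 : 0 < k := by linarith
  have hpos : ∀ x ∈ V, 0 < F x 3 := by
    intro x hx
    obtain ⟨p, q, hp, hq, -⟩ := hlift x hx
    rw [← hq]; exact q.1.2
  have hposV : ∀ x ∈ V, 0 < x 3 := fun x hx ↦ pos_of_mem_tube hε hx
  have hupper : ∀ x ∈ V, ∀ y ∈ V, ∃ n : ℤ,
      upperDist (F x) (spow β n (F y)) ≤ k * upperDist x y := by
    intro x hx y hy
    obtain ⟨p, q, hp, hq, hpq⟩ := hlift x hx
    obtain ⟨p', q', hp', hq', hpq'⟩ := hlift y hy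
    obtain ⟨n, hn⟩ := exists_cuspDist_eq hε q q'
    refine ⟨n, ?_⟩
    rw [← hq, ← hq', ← hn, ← hpq, ← hpq', ← hp, ← hp']
    exact (hk _ _).2.trans (mul_le_mul_of_nonneg_left (cuspDist_le p p') hk0.le)
  have hlower : ∀ x ∈ V, ∀ y ∈ V, ∃ n : ℤ,
      upperDist x (spow α n y) ≤ k * upperDist (F x) (F y) := by
    intro x hx y hy
    obtain ⟨p, q, hp, hq, hpq⟩ := hlift x hx
    obtain ⟨p', q', hp', hq', hpq'⟩ := hlift y hy
    obtain ⟨n, hn⟩ := exists_cuspDist_eq hε p p'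
    refine ⟨n, ?_⟩
    rw [← hq, ← hq', ← hp, ← hp', ← hn]
    have h1 := (hk (cuspMk p) (cuspMk p')).1
    rw [hpq, hpq', inv_mul_le_iff₀ hk0] at h1
    exact h1.trans (mul_le_mul_of_nonneg_left (cuspDist_le q q') hk0.le)
  have heq : ∀ x ∈ V, ∀ y ∈ V, ∀ j : ℤ, F y = spow β j (F x) → ∃ n : ℤ, y = spow α n x := by
    intro x hx y hy j hj
    obtain ⟨p, q, hp, hq, hpq⟩ := hlift x hx
    obtain ⟨p', q', hp', hq', hpq'⟩ := hlift y hy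
    have h1 : cuspMk q' = cuspMk q := (cuspMk_eq_iff _ _).2 ⟨j, by rw [hq, hq', hj]⟩
    have h2 : cuspMk p' = cuspMk p := by
      refine eq_of_cuspDist_nonpos hε ?_
      have h3 := (hk (cuspMk p') (cuspMk p)).1
      rw [hpq, hpq', h1, inv_mul_le_iff₀ hk0] at h3
      refine h3.trans ?_
      have h4 := cuspDist_le q q
      rw [upperDist_self] at h4
      nlinarith
    obtain ⟨n, hn⟩ := (cuspMk_eq_iff _ _).1 h2
    exact ⟨n, by rw [← hp, ← hp', hn]⟩
  have hlocal : ∀ x ∈ V, ∃ O ∈ 𝓝 x, O ⊆ V ∧ ∀ y ∈ O, ∀ y' ∈ O,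
      upperDist (F y) (F y') ≤ k * upperDist y y' ∧
        upperDist y y' ≤ k * upperDist (F y) (F y') := by
    intro x hx
    have hx3 := hposV x hx
    have hFx3 := hpos x hx
    set A := 2 * F x 3 + 2 * x 3 with hA
    have hA0 : 0 < A := by positivity
    set τ₀ := min 1 (1 / (4 * A)) with hτ₀
    have hτ₀0 : 0 < τ₀ := by positivity
    -- up to the distance `τ₀` the `z`-coordinates near `x` and near `F x` change by at most
    -- `1 / 2`, so the infimum in the quotient distance is attained at the identity
    have hexp : ∀ d, 0 ≤ d → d ≤ τ₀ → A * (Real.exp d - 1) ≤ 1 / 2 := by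
      intro d hd0 hd
      have h1 := exp_sub_one_le_two_mul hd0 (hd.trans (min_le_left _ _))
      have h2 : d ≤ 1 / (4 * A) := hd.trans (min_le_right _ _)
      rw [le_div_iff₀ (by positivity)] at h2
      nlinarith
    set τ := τ₀ / (2 * k ^ 2) with hτ
    have hτ0 : 0 < τ := by positivity
    have hFc : ContinuousAt F x := hcont.continuousAt (hopen.mem_nhds hx)
    have e1 : ∀ᶠ y in 𝓝 x, y ∈ V := hopen.mem_nhds hx
    have e2 : ∀ᶠ y in 𝓝 x, |F y 2 - F x 2| < 1 / 8 := by
      have : ContinuousAt (fun y ↦ |F y 2 - F x 2|) x :=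
        (((PiLp.continuous_apply 2 _ 2).continuousAt.comp hFc).sub continuousAt_const).abs
      exact this.eventually (gt_mem_nhds (by simp))
    have e3 : ∀ᶠ y in 𝓝 x, F y 3 < 2 * F x 3 :=
      (continuous_height.continuousAt.comp hFc).eventually
        (gt_mem_nhds (show (F x) 3 < 2 * F x 3 by linarith))
    have e4 : ∀ᶠ y : E4 in 𝓝 x, y 3 < 2 * x 3 :=
      continuous_height.continuousAt.eventually (gt_mem_nhds (by linarith))
    have e5 : ∀ᶠ y : E4 in 𝓝 x, |y 2 - x 2| < 1 / 8 := by
      have : ContinuousAt (fun y : E4 ↦ |y 2 - x 2|) x :=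
        ((PiLp.continuous_apply 2 _ 2).sub continuous_const).abs.continuousAt
      exact this.eventually (gt_mem_nhds (by simp))
    have e6 : ∀ᶠ y : E4 in 𝓝 x, upperDist x y < τ :=
      (tendsto_upperDist_nhds hx3).eventually (gt_mem_nhds hτ0)
    refine ⟨_, e1.and (e2.and (e3.and (e4.and (e5.and e6)))), fun y hy ↦ hy.1, ?_⟩
    rintro y ⟨hyV, h2, h3, h4, h5, h6⟩ y' ⟨hyV', h2', h3', h4', h5', h6'⟩
    have hkk : k ≤ k ^ 2 := by nlinarith
    have hyy : upperDist y y' ≤ 2 * τ := by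
      have := upperDist_triangle (hposV y hyV) hx3 (hposV y' hyV')
      rw [upperDist_comm y x] at this
      linarith
    have hyy0 := upperDist_nonneg (hposV y hyV) (hposV y' hyV')
    have hτeq : k ^ 2 * (2 * τ) = τ₀ := by rw [hτ]; field_simp
    have hup : upperDist (F y) (F y') ≤ k * upperDist y y' := by
      obtain ⟨n, hn⟩ := hupper y hyV y' hyV'
      have hn0 : n = 0 := by
        refine eq_zero_of_upperDist_spow_le (hpos y hyV) (hpos y' hyV') hn ?_ ?_
        · have h7 := hexp (k * upperDist y y') (by positivity) (by nlinarith)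
          have h8 : 1 ≤ Real.exp (k * upperDist y y') := Real.one_le_exp (by positivity)
          nlinarith
        · have := abs_sub_le (F y 2) (F x 2) (F y' 2)
          rw [abs_sub_comm (F x 2)] at this
          linarith
      rwa [hn0, spow_zero] at hn
    refine ⟨hup, ?_⟩
    have hFF0 := upperDist_nonneg (hpos y hyV) (hpos y' hyV')
    obtain ⟨n, hn⟩ := hlower y hyV y' hyV'
    have hn0 : n = 0 := by
      refine eq_zero_of_upperDist_spow_le (hposV y hyV) (hposV y' hyV') hn ?_ ?_
      · have h7 := hexp (k * upperDist (F y) (F y')) (by positivity) (by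
          calc k * upperDist (F y) (F y') ≤ k * (k * (2 * τ)) := by
                refine mul_le_mul_of_nonneg_left (hup.trans ?_) hk0.le
                exact mul_le_mul_of_nonneg_left hyy hk0.le
            _ = τ₀ := by rw [← hτeq]; ring)
        have h8 : 1 ≤ Real.exp (k * upperDist (F y) (F y')) := Real.one_le_exp (by positivity)
        nlinarith
      · have := abs_sub_le (y 2) (x 2) (y' 2)
        rw [abs_sub_comm (x 2)] at this
        linarith
    rwa [hn0, spow_zero] at hn
  -- the degree is locally constant, hence constant
  have hgen : ∀ x ∈ V, ∃ n : ℤ, F (spow α 1 x) = spow β n (F x) := by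
    intro x hx
    obtain ⟨p, q, hp, hq, hpq⟩ := hlift x hx
    obtain ⟨p', q', hp', hq', hpq'⟩ := hlift _ (spow_mem_tube hx 1)
    have h1 : cuspMk p' = cuspMk p := (cuspMk_eq_iff _ _).2 ⟨1, by rw [hp, hp']⟩
    rw [h1, hpq] at hpq'
    obtain ⟨n, hn⟩ := (cuspMk_eq_iff _ _).1 hpq'.symm
    exact ⟨n, by rw [← hq, ← hq', hn]⟩
  obtain ⟨x₀, hx₀⟩ := tube_nonempty hε α N
  obtain ⟨m, hm⟩ := hgen x₀ hx₀
  have hconst : ∀ x ∈ V, F (spow α 1 x) = spow β m (F x) := by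
    intro x hx
    have hφ : ContinuousOn (fun x ↦ F (spow α 1 x) 2 - F x 2) V := by
      have h1 : ContinuousOn (fun x ↦ F (spow α 1 x)) V :=
        hcont.comp (continuous_scr _ _).continuousOn fun y hy ↦ spow_mem_tube hy 1
      have h2 : Continuous fun y : E4 ↦ y 2 := PiLp.continuous_apply 2 _ 2
      exact (h2.comp_continuousOn h1).sub (h2.comp_continuousOn hcont)
    have hmaps : MapsTo (fun x ↦ F (spow α 1 x) 2 - F x 2) V (range ((↑) : ℤ → ℝ)) := by
      intro y hy
      obtain ⟨n, hn⟩ := hgen y hy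
      refine ⟨n, ?_⟩
      dsimp only
      rw [hn, spow_apply_two]; ring
    have hdisc : DiscreteTopology (range ((↑) : ℤ → ℝ)) :=
      Int.isClosedEmbedding_coe_real.isEmbedding.toHomeomorph.symm.isEmbedding.discreteTopology
    have h1 := (convex_tube ε α N).isPreconnected.constant_of_mapsTo ⟨hdisc⟩ hφ hmaps hx hx₀
    obtain ⟨n, hn⟩ := hgen x hx
    dsimp only at h1
    rw [hn, hm, spow_apply_two, spow_apply_two] at h1
    have h2 : n = m := by
      have : (n : ℝ) = m := by linarith
      exact_mod_cast this
    rw [hn, h2]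
  refine ⟨m, hk1, hopen, convex_tube ε α N, hposV, fun x hx n ↦ spow_mem_tube hx n, hpos, hcont,
    hlocal, fun x hx n ↦ ?_, heq⟩
  induction n with
  | zero => simp [spow_zero]
  | succ n ih =>
    rw [add_comm, ← spow_spow, hconst _ (spow_mem_tube hx _), ih, spow_spow]
    congr 1; ring
  | pred n ih =>
    have h1 := hconst _ (spow_mem_tube (α := α) hx (-(n : ℤ) - 1))
    rw [spow_spow, show 1 + (-(n : ℤ) - 1) = -n by ring, ih] at h1
    rw [show m * (-(n : ℤ) - 1) = -m + m * -n by ring, ← spow_spow, h1, spow_spow,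
      neg_add_cancel, spow_zero]

end CuspLift

/-! ### Images and lifts of segments -/

section Segments

theorem continuousOn_upperDist {x : E4} (hx : 0 < x 3) :
    ContinuousOn (fun y ↦ upperDist x y) {y : E4 | 0 < y 3} := by
  refine Real.continuousOn_arcosh.comp ?_ fun y hy ↦ upperDist_arg hx hy
  refine continuousOn_const.add (ContinuousOn.div ?_ ?_ fun y hy ↦ ?_)
  · fun_prop
  · fun_prop
  · have hy : 0 < y 3 := hy
    positivity

theorem lineMap_height_ge {x y : E4} {μ s : ℝ} (hx : μ ≤ x 3) (hy : μ ≤ y 3)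
    (hs : s ∈ Icc (0 : ℝ) 1) :
    μ ≤ (AffineMap.lineMap x y s : E4) 3 := by
  have : (AffineMap.lineMap x y s : E4) 3 = (1 - s) * x 3 + s * y 3 := by
    simp [AffineMap.lineMap_apply]; ring
  rw [this]
  nlinarith [hs.1, hs.2]

theorem upperDist_lineMap_le {x y : E4} {μ s u : ℝ} (hμ : 0 < μ) (hx : μ ≤ x 3) (hy : μ ≤ y 3)
    (hs : s ∈ Icc (0 : ℝ) 1) (hu : u ∈ Icc (0 : ℝ) 1) (hsu : s ≤ u) :
    upperDist (AffineMap.lineMap x y s) (AffineMap.lineMap x y u)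
      ≤ (u - s) * (‖x - y‖ / μ) := by
  refine (upperDist_le_norm_div hμ (lineMap_height_ge hx hy hs) (lineMap_height_ge hx hy hu)).trans
    (le_of_eq ?_)
  rw [← dist_eq_norm, dist_lineMap_lineMap, Real.dist_eq, abs_sub_comm,
    abs_of_nonneg (sub_nonneg.2 hsu), dist_eq_norm, mul_div_assoc]

namespace IsCuspLift

variable {k α β : ℝ} {V : Set E4} {m : ℤ} {F : E4 → E4}

/-- A lift stretches the hyperbolic length of a Euclidean segment by at most the factor `k`. -/
theorem upperDist_map_le (h : IsCuspLift k V α β m F) {x y : E4} (hx : x ∈ V) (hy : y ∈ V) {μ : ℝ}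
    (hμ : 0 < μ) (hμx : μ ≤ x 3) (hμy : μ ≤ y 3) :
    upperDist (F x) (F y) ≤ k * (‖x - y‖ / μ) := by
  have hk0 : 0 < k := zero_lt_one.trans_le h.one_le
  set σ : ℝ → E4 := fun s ↦ AffineMap.lineMap x y s with hσ
  have hσc : Continuous σ := AffineMap.lineMap_continuous
  have hσV : ∀ s ∈ Icc (0 : ℝ) 1, σ s ∈ V := fun s hs ↦ h.convex.lineMap_mem hx hy hs
  set ℓ := ‖x - y‖ / μ with hℓ
  set S : Set ℝ := {s | upperDist (F x) (F (σ s)) ≤ k * (s * ℓ)} with hS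
  have hcl : IsClosed (S ∩ Icc 0 1) := by
    have h1 : ContinuousOn (fun s ↦ upperDist (F x) (F (σ s))) (Icc 0 1) :=
      (continuousOn_upperDist (h.pos x hx)).comp (h.continuousOn.comp hσc.continuousOn hσV)
        fun s hs ↦ h.pos _ (hσV s hs)
    have h2 : ContinuousOn (fun s : ℝ ↦ k * (s * ℓ)) (Icc 0 1) := by fun_prop
    rw [inter_comm]
    exact isClosed_Icc.isClosed_le h1 h2
  have h0 : (0 : ℝ) ∈ S := by
    simp [hS, hσ, upperDist_self]
  have hsub : Icc (0 : ℝ) 1 ⊆ S := by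
    refine hcl.Icc_subset_of_forall_exists_gt h0 ?_
    rintro s ⟨hsS, hs0, hs1⟩ u hu
    have hs01 : s ∈ Icc (0 : ℝ) 1 := ⟨hs0, hs1.le⟩
    obtain ⟨O, hO, hOV, hOk⟩ := h.local_biLipschitz _ (hσV s hs01)
    have h1 : ∀ᶠ u' in 𝓝[>] s, σ u' ∈ O :=
      (hσc.continuousAt.eventually hO).filter_mono nhdsWithin_le_nhds
    have h2 : ∀ᶠ u' in 𝓝[>] s, u' ∈ Ioc s (min u 1) :=
      Ioc_mem_nhdsGT (lt_min hu hs1)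
    obtain ⟨u', hu'O, hu's, hu'u⟩ := (h1.and h2).exists
    have hu'01 : u' ∈ Icc (0 : ℝ) 1 := ⟨hs0.trans hu's.le, hu'u.trans (min_le_right _ _)⟩
    refine ⟨u', ?_, hu's, hu'u.trans (min_le_left _ _)⟩
    have h3 := (hOk _ (mem_of_mem_nhds hO) _ hu'O).1
    have h4 := upperDist_lineMap_le hμ hμx hμy hs01 hu'01 hu's.le
    have h5 := upperDist_triangle (h.pos x hx) (h.pos _ (hσV s hs01)) (h.pos _ (hσV u' hu'01))
    have h6 : k * upperDist (σ s) (σ u') ≤ k * ((u' - s) * ℓ) :=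
      mul_le_mul_of_nonneg_left h4 hk0.le
    have h7 : upperDist (F x) (F (σ s)) ≤ k * (s * ℓ) := hsS
    change upperDist (F x) (F (σ u')) ≤ k * (u' * ℓ)
    calc upperDist (F x) (F (σ u')) ≤ k * (s * ℓ) + k * ((u' - s) * ℓ) := by linarith
      _ = k * (u' * ℓ) := by ring
  have h1 : upperDist (F x) (F (σ 1)) ≤ k * (1 * ℓ) := hsub ⟨zero_le_one, le_rfl⟩
  simpa [hσ] using h1

/-- A lift is locally bi-Lipschitz for the Euclidean metric. -/
theorem exists_closedBall_biLipschitz (h : IsCuspLift k V α β m F) {x : E4} (hx : x ∈ V)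
    {O : Set E4} (hO : O ∈ 𝓝 x) :
    ∃ δ > 0, ∃ (K : ℝ≥0) (c : ℝ), 0 < c ∧ Metric.closedBall x δ ⊆ O ∧
      LipschitzOnWith K F (Metric.closedBall x δ) ∧
      ∀ y ∈ Metric.closedBall x δ, ∀ y' ∈ Metric.closedBall x δ, c * ‖y - y'‖ ≤ ‖F y - F y'‖ := by
  have hk0 : 0 < k := zero_lt_one.trans_le h.one_le
  have hx3 := h.pos_of_mem x hx
  have hFx3 := h.pos x hx
  obtain ⟨O', hO', hO'V, hO'k⟩ := h.local_biLipschitz x hx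
  have hFc : ContinuousAt F x := h.continuousOn.continuousAt (h.isOpen.mem_nhds hx)
  have hF3c : ContinuousAt (fun y ↦ F y 3) x := continuous_height.continuousAt.comp hFc
  have e1 : ∀ᶠ y in 𝓝 x, F y 3 < 2 * F x 3 :=
    hF3c.eventually (gt_mem_nhds (show (F x) 3 < 2 * F x 3 by linarith))
  have e1' : ∀ᶠ y in 𝓝 x, F x 3 / 2 < F y 3 :=
    hF3c.eventually (lt_mem_nhds (show F x 3 / 2 < F x 3 by linarith))
  have e2 : ∀ᶠ y : E4 in 𝓝 x, y 3 < 2 * x 3 :=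
    continuous_height.continuousAt.eventually (gt_mem_nhds (by linarith))
  have e2' : ∀ᶠ y : E4 in 𝓝 x, x 3 / 2 < y 3 :=
    continuous_height.continuousAt.eventually (lt_mem_nhds (by linarith))
  have e3 : ∀ᶠ y : E4 in 𝓝 x, upperDist x y < 1 / (2 * k) :=
    (tendsto_upperDist_nhds hx3).eventually (gt_mem_nhds (by positivity))
  obtain ⟨δ, hδ, hball⟩ := Metric.nhds_basis_closedBall.mem_iff.1
    (inter_mem (inter_mem hO hO') (e1.and (e1'.and (e2.and (e2'.and e3)))))
  have hk1 := h.one_le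
  -- distances of points of the ball, upstairs and downstairs, are at most one
  have hone : ∀ y ∈ Metric.closedBall x δ, ∀ y' ∈ Metric.closedBall x δ,
      0 ≤ upperDist y y' ∧ k * upperDist y y' ≤ 1 := by
    intro y hy y' hy'
    have hyV := h.pos_of_mem y (hO'V (hball hy).1.2)
    have hyV' := h.pos_of_mem y' (hO'V (hball hy').1.2)
    refine ⟨upperDist_nonneg hyV hyV', ?_⟩
    have h1 := upperDist_triangle hyV hx3 hyV'
    rw [upperDist_comm y x] at h1
    have h2 : upperDist y y' ≤ 1 / k := by
      have h3 := (hball hy).2.2.2.2.2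
      have h4 := (hball hy').2.2.2.2.2
      have h5 : 1 / (2 * k) + 1 / (2 * k) = 1 / k := by field_simp; ring_nf
      linarith
    rwa [le_div_iff₀ hk0, mul_comm] at h2
  refine ⟨δ, hδ, (8 * F x 3 * k / x 3).toNNReal, F x 3 / (8 * x 3 * k), by positivity,
    fun y hy ↦ (hball hy).1.1, ?_, ?_⟩
  · refine LipschitzOnWith.of_dist_le_mul fun y hy y' hy' ↦ ?_
    obtain ⟨⟨-, hyO⟩, hF2, hF2', h2, h2', -⟩ := hball hy
    obtain ⟨⟨-, hyO'⟩, hG2, hG2', g2, g2', -⟩ := hball hy'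
    obtain ⟨h01, h11⟩ := hone y hy y' hy'
    rw [Real.coe_toNNReal _ (by positivity), dist_eq_norm, dist_eq_norm]
    have hFy := h.pos y (hO'V hyO)
    have hFy' := h.pos y' (hO'V hyO')
    have h3 := (hO'k y hyO y' hyO').1
    have h4 := norm_sub_le_mul_exp_sub_one hFy hFy'
    have h5 := exp_sub_one_le_two_mul (upperDist_nonneg hFy hFy') (h3.trans h11)
    have h6 := upperDist_le_norm_div (show 0 < x 3 / 2 by positivity) h2'.le g2'.le
    have h7 : 8 * F x 3 * k / x 3 * ‖y - y'‖
        = (2 * F x 3) * (2 * (k * (‖y - y'‖ / (x 3 / 2)))) := by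
      field_simp; ring_nf
    rw [h7]
    refine h4.trans (mul_le_mul hF2.le ?_ ?_ (by positivity))
    · have := mul_le_mul_of_nonneg_left h6 hk0.le
      linarith
    · linarith [Real.one_le_exp (upperDist_nonneg hFy hFy')]
  · intro y hy y' hy'
    obtain ⟨⟨-, hyO⟩, hF2, hF2', h2, h2', -⟩ := hball hy
    obtain ⟨⟨-, hyO'⟩, hG2, hG2', g2, g2', -⟩ := hball hy'
    obtain ⟨h01, h11⟩ := hone y hy y' hy'
    have hy3 := h.pos_of_mem y (hO'V hyO)
    have hy3' := h.pos_of_mem y' (hO'V hyO')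
    have h3 := (hO'k y hyO y' hyO').2
    have h4 := norm_sub_le_mul_exp_sub_one hy3 hy3'
    have h5 := exp_sub_one_le_two_mul h01 (by nlinarith)
    have h6 := upperDist_le_norm_div (show 0 < F x 3 / 2 by positivity) hF2'.le hG2'.le
    rw [div_mul_eq_mul_div, div_le_iff₀ (by positivity)]
    have h7 : ‖y - y'‖ ≤ (2 * x 3) * (2 * (k * (‖F y - F y'‖ / (F x 3 / 2)))) := by
      refine h4.trans (mul_le_mul h2.le ?_ ?_ (by positivity))
      · have := mul_le_mul_of_nonneg_left h6 hk0.le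
        linarith
      · linarith [Real.one_le_exp h01]
    have h8 : (2 * x 3) * (2 * (k * (‖F y - F y'‖ / (F x 3 / 2))))
        = ‖F y - F y'‖ * (8 * x 3 * k) / F x 3 := by
      field_simp; ring_nf
    rw [h8, le_div_iff₀ hFx3] at h7
    linarith

/-- Hyperbolic balls are relatively compact in the upper half-space. -/
theorem isCompact_upperDist_le {x : E4} (hx : 0 < x 3) (R : ℝ) :
    IsCompact {y : E4 | 0 < y 3 ∧ upperDist x y ≤ R} := by
  have heq : {y : E4 | 0 < y 3 ∧ upperDist x y ≤ R}
      = {y ∈ {y : E4 | x 3 * Real.exp (-R) ≤ y 3} | upperDist x y ≤ R} := by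
    ext y
    refine ⟨fun hy ↦ ⟨?_, hy.2⟩, fun hy ↦
      ⟨lt_of_lt_of_le (show 0 < x 3 * Real.exp (-R) by positivity) hy.1, hy.2⟩⟩
    have h1 := height_le_mul_exp hy.1 hx
    rw [upperDist_comm] at h1
    have h2 : x 3 ≤ y 3 * Real.exp R :=
      h1.trans (mul_le_mul_of_nonneg_left (Real.exp_le_exp.2 hy.2) hy.1.le)
    change x 3 * Real.exp (-R) ≤ y 3
    rw [Real.exp_neg, ← div_eq_mul_inv, div_le_iff₀ (Real.exp_pos R)]
    exact h2
  have hclosed : IsClosed {y : E4 | 0 < y 3 ∧ upperDist x y ≤ R} := by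
    rw [heq]
    refine IsClosed.isClosed_le (isClosed_le continuous_const continuous_height) ?_
      continuousOn_const
    exact (continuousOn_upperDist hx).mono fun y hy ↦
      lt_of_lt_of_le (show 0 < x 3 * Real.exp (-R) by positivity) hy
  refine (isCompact_closedBall x (x 3 * (Real.exp R - 1))).of_isClosed_subset hclosed ?_
  rintro y ⟨hy, hyR⟩
  rw [Metric.mem_closedBall, dist_comm, dist_eq_norm]
  refine (norm_sub_le_mul_exp_sub_one hx hy).trans (mul_le_mul_of_nonneg_left ?_ hx.le)
  linarith [Real.exp_le_exp.2 hyR]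

/-- Lifting of segments: as the lift is open, a segment that starts at `F x` is covered by a path
starting at `x`, as long as that path stays in the domain. -/
theorem exists_eq_of_ball_subset (h : IsCuspLift k V α β m F) {x : E4} (hx : x ∈ V) {R : ℝ}
    (hR : ∀ y : E4, 0 < y 3 → upperDist x y ≤ R → y ∈ V) {w : E4} {μ : ℝ} (hμ : 0 < μ)
    (hμx : μ ≤ F x 3) (hμw : μ ≤ w 3) (hℓR : k * (‖F x - w‖ / μ) ≤ R) :
    ∃ y ∈ V, upperDist x y ≤ k * (‖F x - w‖ / μ) ∧ F y = w := by
  have hk0 : 0 < k := zero_lt_one.trans_le h.one_le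
  have hx3 := h.pos_of_mem x hx
  set σ : ℝ → E4 := fun s ↦ AffineMap.lineMap (F x) w s with hσ
  have hσc : Continuous σ := AffineMap.lineMap_continuous
  set ℓ := ‖F x - w‖ / μ with hℓ
  have hℓ0 : 0 ≤ ℓ := by positivity
  set B : Set E4 := {y : E4 | 0 < y 3 ∧ upperDist x y ≤ R} with hB
  have hBV : B ⊆ V := fun y hy ↦ hR y hy.1 hy.2
  have hBc : IsCompact B := isCompact_upperDist_le hx3 R
  set S : Set ℝ := {s | ∃ y ∈ B, upperDist x y ≤ k * (s * ℓ) ∧ F y = σ s} with hS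
  have hcl : IsClosed (S ∩ Icc 0 1) := by
    set D : Set (E4 × ℝ) := B ×ˢ Icc (0 : ℝ) 1 with hD
    have hDc : IsCompact D := hBc.prod isCompact_Icc
    have h1 : IsClosed {p ∈ D | upperDist x p.1 ≤ k * (p.2 * ℓ)} := by
      refine hDc.isClosed.isClosed_le ?_ (by fun_prop)
      exact (continuousOn_upperDist hx3).comp continuous_fst.continuousOn fun p hp ↦ hp.1.1
    have h2 : IsClosed {p ∈ D | ‖F p.1 - σ p.2‖ ≤ 0} := by
      refine hDc.isClosed.isClosed_le (ContinuousOn.norm (ContinuousOn.sub ?_ ?_))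
        continuousOn_const
      · exact h.continuousOn.comp continuous_fst.continuousOn fun p hp ↦ hBV hp.1
      · exact (hσc.comp continuous_snd).continuousOn
    have h3 : S ∩ Icc 0 1 = Prod.snd '' ({p ∈ D | upperDist x p.1 ≤ k * (p.2 * ℓ)} ∩
        {p ∈ D | ‖F p.1 - σ p.2‖ ≤ 0}) := by
      ext s
      constructor
      · rintro ⟨⟨y, hyB, hy1, hy2⟩, hs⟩
        exact ⟨(y, s), ⟨⟨⟨hyB, hs⟩, hy1⟩, ⟨hyB, hs⟩, by simp [hy2]⟩, rfl⟩
      · rintro ⟨⟨y, s'⟩, ⟨⟨hyD, hy1⟩, -, hy2⟩, rfl⟩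
        exact ⟨⟨y, hyD.1, hy1, sub_eq_zero.1 (norm_le_zero_iff.1 hy2)⟩, hyD.2⟩
    rw [h3]
    exact ((hDc.of_isClosed_subset (h1.inter h2) fun p hp ↦ hp.1.1).image continuous_snd).isClosed
  have h0 : (0 : ℝ) ∈ S := by
    refine ⟨x, ⟨hx3, ?_⟩, ?_, ?_⟩
    · rw [upperDist_self]; exact le_trans (by positivity) hℓR
    · simp [upperDist_self]
    · simp [hσ]
  have hsub : Icc (0 : ℝ) 1 ⊆ S := by
    refine hcl.Icc_subset_of_forall_exists_gt h0 ?_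
    rintro s ⟨⟨y, hyB, hy1, hy2⟩, hs0, hs1⟩ u hu
    have hs01 : s ∈ Icc (0 : ℝ) 1 := ⟨hs0, hs1.le⟩
    have hyV := hBV hyB
    obtain ⟨O, hO, hOV, hOk⟩ := h.local_biLipschitz y hyV
    obtain ⟨δ, hδ, K, c, hc, hballO, hFL, hFc⟩ := h.exists_closedBall_biLipschitz hyV hO
    have hcover := ball_subset_image_closedBall hc hδ hFL hFc
    have h1 : ∀ᶠ u' in 𝓝[>] s, σ u' ∈ Metric.ball (F y) (c * δ / 4) := by
      refine (hσc.continuousAt.eventually ?_).filter_mono nhdsWithin_le_nhds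
      rw [hy2]
      exact Metric.ball_mem_nhds _ (by positivity)
    have h2 : ∀ᶠ u' in 𝓝[>] s, u' ∈ Ioc s (min u 1) :=
      Ioc_mem_nhdsGT (lt_min hu hs1)
    obtain ⟨u', hu'B, hu's, hu'u⟩ := (h1.and h2).exists
    have hu'01 : u' ∈ Icc (0 : ℝ) 1 := ⟨hs0.trans hu's.le, hu'u.trans (min_le_right _ _)⟩
    obtain ⟨y', hy'ball, hy'F⟩ := hcover hu'B
    have hy'O := hballO hy'ball
    have h3 := (hOk y (mem_of_mem_nhds hO) y' hy'O).2
    rw [hy2, hy'F] at h3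
    have h4 := upperDist_lineMap_le hμ hμx hμw hs01 hu'01 hu's.le
    have hy'3 := h.pos_of_mem y' (hOV hy'O)
    have h5 := upperDist_triangle hx3 (h.pos_of_mem y hyV) hy'3
    have h6 : k * upperDist (σ s) (σ u') ≤ k * ((u' - s) * ℓ) :=
      mul_le_mul_of_nonneg_left h4 hk0.le
    have h7 : upperDist x y' ≤ k * (u' * ℓ) := by
      calc upperDist x y' ≤ k * (s * ℓ) + k * ((u' - s) * ℓ) := by linarith
        _ = k * (u' * ℓ) := by ring
    refine ⟨u', ⟨y', ⟨hy'3, h7.trans ?_⟩, h7, hy'F⟩, hu's, hu'u.trans (min_le_left _ _)⟩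
    refine le_trans (mul_le_mul_of_nonneg_left ?_ hk0.le) hℓR
    exact mul_le_of_le_one_left hℓ0 hu'01.2
  obtain ⟨y, hyB, hy1, hy2⟩ := hsub (⟨zero_le_one, le_rfl⟩ : (1 : ℝ) ∈ Icc (0 : ℝ) 1)
  exact ⟨y, hBV hyB, by simpa using hy1, by simpa [hσ] using hy2⟩

end IsCuspLift

end Segments

/-! ### Comparison of displacements far up in the cone -/

section Displacement

namespace IsCuspLift

variable {k α β : ℝ} {V : Set E4} {m : ℤ} {F : E4 → E4}

/-- If `g_αⁿ` moves `x` a little, then `g_β^(mn)` moves `F x` a little. -/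
theorem upperDist_spow_map_le (h : IsCuspLift k V α β m F) {x : E4} (hx : x ∈ V) (n : ℤ) :
    upperDist (F x) (spow β (m * n) (F x)) ≤ k * disp α n x := by
  rw [← h.equivariant x hx n, disp, norm_sub_rev]
  exact h.upperDist_map_le hx (h.spow_mem x hx n) (h.pos_of_mem x hx) le_rfl le_rfl

/-- If `g_βʲ` moves `F x` a little, then `j` is in the image of the map of fundamental groups. -/
theorem exists_mul_eq (h : IsCuspLift k V α β m F) {x : E4} (hx : x ∈ V) {R : ℝ}
    (hR : ∀ y : E4, 0 < y 3 → upperDist x y ≤ R → y ∈ V) {j : ℤ} (hj : k * disp β j (F x) ≤ R) :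
    ∃ n : ℤ, m * n = j ∧ upperDist x (spow α n x) ≤ k * disp β j (F x) := by
  have hd : ‖F x - spow β j (F x)‖ / F x 3 = disp β j (F x) := by rw [disp, norm_sub_rev]
  obtain ⟨y, hyV, hxy, hy⟩ := h.exists_eq_of_ball_subset hx hR (h.pos x hx) le_rfl
    (w := spow β j (F x)) le_rfl (by rwa [hd])
  obtain ⟨n, rfl⟩ := h.eq_spow x hx y hyV j hy
  rw [h.equivariant x hx n] at hy
  exact ⟨n, spow_right_injective hy, by rwa [hd] at hxy⟩

end IsCuspLift

/-- The point of the half-plane `θ = 0`, `z = 0` with cylindrical coordinates `r` and `t`. -/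
noncomputable def cyl (r t : ℝ) : E4 := !₂[r, 0, 0, t]

@[simp] theorem cyl_apply_zero (r t : ℝ) : cyl r t 0 = r := rfl
@[simp] theorem cyl_apply_one (r t : ℝ) : cyl r t 1 = 0 := rfl
@[simp] theorem cyl_apply_two (r t : ℝ) : cyl r t 2 = 0 := rfl
@[simp] theorem cyl_apply_three (r t : ℝ) : cyl r t 3 = t := rfl

@[simp] theorem radSq_cyl (r t : ℝ) : radSq (cyl r t) = r ^ 2 := by simp [radSq]

theorem radSq_le_two_mul (x y : E4) : radSq y ≤ 2 * radSq x + 2 * ‖x - y‖ ^ 2 := by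
  rw [E4.norm_sq, radSq, radSq]
  simp only [PiLp.sub_apply]
  nlinarith [sq_nonneg (2 * x 0 - y 0), sq_nonneg (2 * x 1 - y 1), sq_nonneg (x 2 - y 2),
    sq_nonneg (x 3 - y 3)]

/-- Far up in the cone `r ≤ t`, hyperbolic balls of a given radius lie in a single tube: one
chooses `N` such that `g_α ^ N` rotates by a very small angle. -/
theorem exists_ball_subset_tube {ε α : ℝ} (hε : 0 < ε) (hα : Irrational α) {R : ℝ} (hR : 0 ≤ R) :
    ∃ N : ℤ, N ≠ 0 ∧ ∃ T > 0, ∀ x : E4, T ≤ x 3 → radSq x ≤ x 3 ^ 2 →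
      ∀ y : E4, 0 < y 3 → upperDist x y ≤ R → y ∈ tube ε α N := by
  set c := chordBound ε with hc
  have hc0 : 0 < c := chordBound_pos hε
  set E := Real.exp R with hE
  have hE1 : 1 ≤ E := Real.one_le_exp hR
  have hE0 : 0 < E := by linarith
  obtain ⟨N, p, hN, -, hNp⟩ := hα.exists_int_mul_sub_small
    (η := c / (4 * Real.pi * E ^ 2)) (by positivity)
  have hN0 : (0 : ℝ) < N := by exact_mod_cast hN
  refine ⟨N, hN.ne', 2 * E * N / c, by positivity, fun x hxT hxr y hy hxy ↦ ?_⟩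
  have hx : 0 < x 3 := lt_of_lt_of_le (show 0 < 2 * E * N / c by positivity) hxT
  rw [mem_tube_iff_sq hε hy]
  have hS : chordSq (N * α) ≤ c ^ 2 / (4 * E ^ 4) := by
    refine (chordSq_le_sq _ p).trans ?_
    have h1 : (N * α - p) ^ 2 ≤ (c / (4 * Real.pi * E ^ 2)) ^ 2 := by
      rw [← sq_abs (N * α - p)]
      exact pow_le_pow_left₀ (abs_nonneg _) hNp.le 2
    calc 4 * Real.pi ^ 2 * (N * α - p) ^ 2
        ≤ 4 * Real.pi ^ 2 * (c / (4 * Real.pi * E ^ 2)) ^ 2 :=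
          mul_le_mul_of_nonneg_left h1 (by positivity)
      _ = c ^ 2 / (4 * E ^ 4) := by
          have := Real.pi_ne_zero
          field_simp
  have hyx : Real.exp (upperDist x y) ≤ E := Real.exp_le_exp.2 hxy
  have h1 : x 3 ≤ y 3 * E := by
    have := height_le_mul_exp hy hx
    rw [upperDist_comm] at this
    exact this.trans (mul_le_mul_of_nonneg_left hyx hy.le)
  have h2 : ‖x - y‖ ≤ x 3 * (E - 1) := (norm_sub_le_mul_exp_sub_one hx hy).trans
    (mul_le_mul_of_nonneg_left (by linarith) hx.le)
  have h3 : radSq y ≤ 2 * x 3 ^ 2 * E ^ 2 := by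
    have h4 := radSq_le_two_mul x y
    have h5 : ‖x - y‖ ^ 2 ≤ (x 3 * (E - 1)) ^ 2 := pow_le_pow_left₀ (norm_nonneg _) h2 2
    have h6 : 0 ≤ x 3 ^ 2 * (E - 1) := mul_nonneg (sq_nonneg _) (by linarith)
    nlinarith
  have h4 : chordSq (N * α) * radSq y ≤ c ^ 2 / (4 * E ^ 4) * (2 * x 3 ^ 2 * E ^ 2) :=
    mul_le_mul hS h3 (radSq_nonneg y) (by positivity)
  have h5 : c ^ 2 / (4 * E ^ 4) * (2 * x 3 ^ 2 * E ^ 2) = c ^ 2 * (x 3 / E) ^ 2 / 2 := by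
    field_simp; ring
  have h6 : x 3 / E ≤ y 3 := by rwa [div_le_iff₀ hE0]
  have h7 : (x 3 / E) ^ 2 ≤ y 3 ^ 2 := pow_le_pow_left₀ (by positivity) h6 2
  have h8 : 2 * (N : ℝ) ≤ c * (x 3 / E) := by
    rw [div_le_iff₀ hc0] at hxT
    rw [mul_div_assoc', le_div_iff₀ hE0]
    linarith
  have h9 : (2 * (N : ℝ)) ^ 2 ≤ (c * (x 3 / E)) ^ 2 := pow_le_pow_left₀ (by positivity) h8 2
  have h10 : c ^ 2 * (x 3 / E) ^ 2 ≤ c ^ 2 * y 3 ^ 2 :=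
    mul_le_mul_of_nonneg_left h7 (by positivity)
  nlinarith [sq_pos_of_pos hN0]

/-- A lift on a domain that contains the part `x 3 ≥ T` of the cone `r ≤ t`, and that is an
isomorphism on fundamental groups; the small displacements of `g_αⁿ` at `x` and of `g_βⁿ` at
`F x` are comparable. -/
structure IsConeLift (k : ℝ) (V : Set E4) (α β : ℝ) (m : ℤ) (F : E4 → E4) (T : ℝ) : Prop extends
    IsCuspLift k V α β m F where
  pos_T : 0 < T
  eq_or : m = 1 ∨ m = -1
  mem_of_le : ∀ x : E4, T ≤ x 3 → radSq x ≤ x 3 ^ 2 → x ∈ V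
  disp_map_le : ∀ x : E4, T ≤ x 3 → radSq x ≤ x 3 ^ 2 → ∀ n : ℤ, k * disp α n x ≤ 1 →
    disp β n (F x) ≤ 2 * k * disp α n x
  disp_le_map : ∀ x : E4, T ≤ x 3 → radSq x ≤ x 3 ^ 2 → ∀ n : ℤ, k * disp β n (F x) ≤ 1 →
    disp α n x ≤ 2 * k * disp β n (F x)

/-- Every bi-Lipschitz map of cusps lifts to a neighbourhood of the far part of the cone, with
degree `±1`. -/
theorem exists_isConeLift {ε α β : ℝ} (hε : 0 < ε) (hα : Irrational α) (hβ : Irrational β)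
    {f : MargulisCusp ε α → MargulisCusp ε β} (hf : IsBiLipschitzEmbedding f) :
    ∃ (k : ℝ) (V : Set E4) (m : ℤ) (F : E4 → E4) (T : ℝ), IsLocalLift f V F ∧
      IsConeLift k V α β m F T := by
  obtain ⟨k, hk1, hk⟩ := hf
  have hk0 : 0 < k := by linarith
  have hc := chordBound_pos hε
  -- the radius allows to lift the segments from `F x` to `g_βʲ (F x)` when the displacement is less
  -- than `chordBound ε`, or at most `1 / k`
  set R := k * chordBound ε + 1 with hR
  have hR1 : 1 ≤ R := by have : 0 < k * chordBound ε := by positivity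
                         linarith
  obtain ⟨N, hN, T, hT, hVR⟩ := exists_ball_subset_tube hε hα (show 0 ≤ R by linarith)
  obtain ⟨F, hF⟩ := exists_isLocalLift hε hN (f := f) ⟨k, hk1, hk⟩
  obtain ⟨m, h⟩ := exists_isCuspLift hε hk1 hk hF
  have hmem : ∀ x : E4, T ≤ x 3 → radSq x ≤ x 3 ^ 2 → x ∈ tube ε α N := fun x h1 h2 ↦
    hVR x h1 h2 x (hT.trans_le h1) (by rw [upperDist_self]; linarith)
  -- `F x` lies in the Margulis region of `g_β`, so a power of `g_β` with non-zero exponent moves it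
  -- by less than `ε`, and this exponent is a multiple of `m`
  have hm0 : m ≠ 0 := by
    have hx : cyl 0 T ∈ tube ε α N := hmem _ le_rfl (by simp; positivity)
    obtain ⟨p, q, -, hq, -⟩ := hF.2.2 _ hx
    obtain ⟨j, hj, hlt⟩ := (mem_margulisRegion_iff hε _).1 q.2
    rw [hq] at hlt
    obtain ⟨n, hn, -⟩ := h.exists_mul_eq hx (hVR _ le_rfl (by simp; positivity)) (j := j) (by
      have := mul_le_mul_of_nonneg_left hlt.le hk0.le
      linarith)
    rintro rfl
    exact hj (by simpa using hn.symm)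
  -- on the axis `g_α` moves `x` by `1 / t`, so high up `g_βᵐ` moves `F x` very little; then so does
  -- `g_β` itself, up to the constant `C`, and the exponent `1` is a multiple of `m`
  have hm1 : m = 1 ∨ m = -1 := by
    have hmβ : Irrational (m * β) := hβ.intCast_mul hm0
    have hSm := chordSq_pos hmβ
    have hSβ := chordSq_nonneg β
    set C := 1 + chordSq β / chordSq (m * β) with hC
    have hC0 : 0 < C := by positivity
    set t := max T (2 * k ^ 2 * (C + 1)) with ht
    have htT : T ≤ t := le_max_left _ _
    have ht2 : 2 * k ^ 2 * (C + 1) ≤ t := le_max_right _ _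
    have ht0 : 0 < t := hT.trans_le htT
    have hr : radSq (cyl 0 t) ≤ cyl 0 t 3 ^ 2 := by simp; positivity
    have hx : cyl 0 t ∈ tube ε α N := hmem _ htT hr
    have hFx := h.pos _ hx
    have hd1 : disp α 1 (cyl 0 t) = 1 / t := by
      refine (sq_eq_sq₀ (disp_nonneg _ _ (by simpa using ht0)) (by positivity)).1 ?_
      rw [disp_sq]; simp
    have h1 := h.upperDist_spow_map_le hx 1
    rw [hd1, mul_one] at h1
    have h2 : k * (1 / t) ≤ 1 := by
      rw [mul_one_div, div_le_one ht0]
      nlinarith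
    have h3 := disp_le_two_mul β m hFx (h1.trans h2)
    have h4 : disp β m (F (cyl 0 t)) ≤ 2 * (k * (1 / t)) := by linarith
    have h5 : disp β 1 (F (cyl 0 t)) ^ 2 ≤ C * disp β m (F (cyl 0 t)) ^ 2 := by
      rw [disp_sq, disp_sq, mul_div_assoc']
      refine div_le_div_of_nonneg_right ?_ (by positivity)
      have hm2 : (1 : ℝ) ≤ (m : ℝ) ^ 2 := by
        have : 1 ≤ m ^ 2 := by have := sq_pos_of_ne_zero hm0; omega
        exact_mod_cast this
      have hr := radSq_nonneg (F (cyl 0 t))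
      have e : C * (chordSq (m * β) * radSq (F (cyl 0 t)))
          = (chordSq (m * β) + chordSq β) * radSq (F (cyl 0 t)) := by
        rw [hC]; field_simp
      rw [mul_add, e]
      have h6 : 1 ≤ C * (m : ℝ) ^ 2 := by
        have : 1 ≤ C := by rw [hC]; have : 0 ≤ chordSq β / chordSq (m * β) := by positivity
                           linarith
        nlinarith
      push_cast
      rw [one_mul]
      nlinarith [mul_nonneg hSm.le hr]
    have h6 : k * disp β 1 (F (cyl 0 t)) ≤ 1 := by
      have h7 : disp β m (F (cyl 0 t)) ^ 2 ≤ (2 * (k * (1 / t))) ^ 2 :=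
        pow_le_pow_left₀ (disp_nonneg _ _ hFx) h4 2
      refine (sq_le_sq₀ (mul_nonneg hk0.le (disp_nonneg _ _ hFx)) zero_le_one).1 ?_
      have h8 : C * (2 * (k * (1 / t))) ^ 2 * k ^ 2 ≤ 1 := by
        rw [show C * (2 * (k * (1 / t))) ^ 2 * k ^ 2 = C * (2 * k ^ 2) ^ 2 / t ^ 2 by
          field_simp, div_le_one (by positivity)]
        have h9 : (2 * k ^ 2 * (C + 1)) ^ 2 ≤ t ^ 2 := pow_le_pow_left₀ (by positivity) ht2 2
        refine le_trans ?_ h9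
        calc C * (2 * k ^ 2) ^ 2 ≤ (C + 1) ^ 2 * (2 * k ^ 2) ^ 2 :=
              mul_le_mul_of_nonneg_right (by nlinarith) (by positivity)
          _ = (2 * k ^ 2 * (C + 1)) ^ 2 := by ring
      rw [mul_pow, one_pow]
      have h10 := mul_le_mul_of_nonneg_left h7 hC0.le
      nlinarith [mul_le_mul_of_nonneg_left (h5.trans h10) (sq_nonneg k)]
    obtain ⟨n, hn, -⟩ := h.exists_mul_eq hx (hVR _ htT hr) (j := 1) (h6.trans hR1)
    exact Int.isUnit_iff.1 (IsUnit.of_mul_eq_one n hn)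
  have hdm : ∀ (γ : ℝ) (n : ℤ) (x : E4), 0 < x 3 → disp γ (m * n) x = disp γ n x := by
    rintro γ n x hx
    rcases hm1 with rfl | rfl
    · rw [one_mul]
    · rw [neg_one_mul, disp_neg γ n hx]
  refine ⟨k, tube ε α N, m, F, T, hF, { h with
    pos_T := hT
    eq_or := hm1
    mem_of_le := hmem
    disp_map_le := ?_
    disp_le_map := ?_ }⟩
  · intro x hxT hxr n hn
    have hx := hmem x hxT hxr
    have h1 := h.upperDist_spow_map_le hx n
    have h2 := disp_le_two_mul β (m * n) (h.pos x hx) (h1.trans hn)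
    rw [hdm β n _ (h.pos x hx)] at h2
    linarith
  · intro x hxT hxr n hn
    have hx := hmem x hxT hxr
    obtain ⟨n', hn', hd⟩ := h.exists_mul_eq hx (hVR _ hxT hxr) (hn.trans hR1)
    have h2 := disp_le_two_mul α n' (hT.trans_le hxT) (hd.trans hn)
    rw [← hdm α n' x (hT.trans_le hxT), hn'] at h2
    linarith

end Displacement

/-! ### The rotation angles agree up to sign -/

section RotationAngle

theorem le_of_eventually_le_div_sq_add {A B c : ℝ}
    (h : ∀ᶠ l : ℕ in atTop, A ≤ c / (l : ℝ) ^ 2 + B) : A ≤ B := by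
  have h1 : Tendsto (fun l : ℕ ↦ c / (l : ℝ) ^ 2 + B) atTop (𝓝 (0 + B)) :=
    (tendsto_const_nhds.div_atTop ((tendsto_pow_atTop two_ne_zero).comp
      tendsto_natCast_atTop_atTop)).add_const B
  rw [zero_add] at h1
  exact ge_of_tendsto h1 h

/-- The slope `t / r` of the ray of base points at which the displacements are compared. At a base
point with `r = l` the displacement of `g_αⁿ` is at most `3 / (12 k²)` for `|n| ≤ l`, hence that of
`g_βⁿ` at the image at most `1 / (2 k)`, and the comparison applies in both directions. -/
noncomputable def baseSlope (k : ℝ) : ℝ := 12 * k ^ 2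

/-- The base points, on a ray that leaves every compact subset of the cone. -/
noncomputable def basePoint (k : ℝ) (l : ℕ) : E4 := cyl l (baseSlope k * l)

namespace IsConeLift

variable {k α β : ℝ} {V : Set E4} {m : ℤ} {F : E4 → E4} {T : ℝ}

theorem le_baseSlope (h : IsConeLift k V α β m F T) : 12 ≤ baseSlope k := by
  have := h.one_le
  unfold baseSlope
  nlinarith

theorem radSq_basePoint_le (h : IsConeLift k V α β m F T) (l : ℕ) :
    radSq (basePoint k l) ≤ basePoint k l 3 ^ 2 := by
  have hK := h.le_baseSlope
  rw [basePoint, radSq_cyl, cyl_apply_three, mul_pow]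
  exact le_mul_of_one_le_left (by positivity) (by nlinarith)

theorem eventually_le_basePoint (h : IsConeLift k V α β m F T) :
    ∀ᶠ l : ℕ in atTop, 0 < l ∧ T ≤ basePoint k l 3 := by
  have h1 : Tendsto (fun l : ℕ ↦ baseSlope k * l) atTop atTop :=
    tendsto_natCast_atTop_atTop.const_mul_atTop (by linarith [h.le_baseSlope])
  exact (eventually_gt_atTop 0).and (h1.eventually_ge_atTop T)

theorem disp_basePoint_sq (h : IsConeLift k V α β m F T) (γ : ℝ) (n : ℤ) {l : ℕ} (hl : 0 < l) :
    disp γ n (basePoint k l) ^ 2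
      = ((n : ℝ) ^ 2 / (l : ℝ) ^ 2 + chordSq (n * γ)) / baseSlope k ^ 2 := by
  have hK := h.le_baseSlope
  have hK0 : baseSlope k ≠ 0 := by linarith
  have : (l : ℝ) ≠ 0 := by positivity
  rw [disp_sq, basePoint, radSq_cyl, cyl_apply_three]
  field_simp

/-- The comparison of the displacements of `g_αⁿ` at the base points and of `g_βⁿ` at their
images. -/
theorem disp_basePoint_bounds (h : IsConeLift k V α β m F T) {l : ℕ} (hl : 0 < l)
    (hT : T ≤ basePoint k l 3) {n : ℤ} (hn : |n| ≤ l) :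
    disp β n (F (basePoint k l)) ^ 2 ≤ (n : ℝ) ^ 2 / (l : ℝ) ^ 2 + chordSq (n * α) ∧
      disp β n (F (basePoint k l)) ≤ 1 ∧
      (n : ℝ) ^ 2 / (l : ℝ) ^ 2 + chordSq (n * α)
        ≤ (2 * k * baseSlope k) ^ 2 * disp β n (F (basePoint k l)) ^ 2 := by
  have hk := h.one_le
  have hk0 : 0 < k := by linarith
  have hK := h.le_baseSlope
  have hK0 : 0 < baseSlope k := by linarith
  have hr := h.radSq_basePoint_le l
  set x := basePoint k l with hx
  have hx3 : 0 < x 3 := h.pos_T.trans_le hT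
  have hxV := h.mem_of_le x hT hr
  have hsq := h.disp_basePoint_sq α n hl
  have hl0 : (0 : ℝ) < l := by positivity
  have hn2 : (n : ℝ) ^ 2 / (l : ℝ) ^ 2 ≤ 1 := by
    rw [div_le_one (by positivity), sq_le_sq, abs_of_pos hl0]
    exact_mod_cast hn
  set S := (n : ℝ) ^ 2 / (l : ℝ) ^ 2 + chordSq (n * α) with hS
  have hS5 : S ≤ 9 := by linarith [chordSq_le_four (n * α)]
  have h1 : disp α n x ≤ 3 / baseSlope k := by
    refine (sq_le_sq₀ (disp_nonneg _ _ hx3) (by positivity)).1 ?_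
    rw [hsq, div_pow]
    exact div_le_div_of_nonneg_right (by linarith) (by positivity)
  have h2 : 2 * k * disp α n x ≤ 1 / (2 * k) := by
    have : 2 * k * (3 / baseSlope k) = 1 / (2 * k) := by
      unfold baseSlope; field_simp; norm_num
    rw [← this]
    exact mul_le_mul_of_nonneg_left h1 (by positivity)
  have h3 : 1 / (2 * k) ≤ 1 := by rw [div_le_one (by positivity)]; linarith
  have h4 := h.disp_map_le x hT hr n (by linarith)
  have hd0 := disp_nonneg β n (h.pos x hxV)
  have h5 := h.disp_le_map x hT hr n (by
    have := mul_le_mul_of_nonneg_left (h4.trans h2) hk0.le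
    have e : k * (1 / (2 * k)) = 1 / 2 := by field_simp
    linarith)
  have h6 : disp β n (F x) ^ 2 ≤ (2 * k * disp α n x) ^ 2 := pow_le_pow_left₀ hd0 h4 2
  have h7 : disp α n x ^ 2 ≤ (2 * k * disp β n (F x)) ^ 2 :=
    pow_le_pow_left₀ (disp_nonneg _ _ hx3) h5 2
  rw [mul_pow, hsq] at h6
  refine ⟨h6.trans ?_, by linarith, ?_⟩
  · rw [mul_div_assoc', div_le_iff₀ (by positivity), mul_comm]
    have hS0 : 0 ≤ S := by have := chordSq_nonneg (n * α); positivity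
    refine mul_le_mul_of_nonneg_left ?_ hS0
    refine pow_le_pow_left₀ (by positivity) ?_ 2
    unfold baseSlope
    nlinarith
  · rw [hsq, div_le_iff₀ (by positivity)] at h7
    calc S ≤ (2 * k * disp β n (F x)) ^ 2 * baseSlope k ^ 2 := h7
      _ = _ := by ring

/-- The translation part of `g_βˡ` alone moves the image of the base point by `l`, so the bound for
the displacement forces the image to be high. -/
theorem le_height_map_basePoint (h : IsConeLift k V α β m F T) {l : ℕ} (hl : 0 < l)
    (hT : T ≤ basePoint k l 3) : (l : ℝ) ≤ F (basePoint k l) 3 := by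
  obtain ⟨-, h1, -⟩ := h.disp_basePoint_bounds hl hT (n := l) (by simp)
  have hpos := h.pos _ (h.mem_of_le _ hT (h.radSq_basePoint_le l))
  have h2 : disp β l (F (basePoint k l)) ^ 2 ≤ 1 := pow_le_one₀ (disp_nonneg _ _ hpos) h1
  rw [disp_sq, div_le_one (by positivity)] at h2
  have h3 := mul_nonneg (chordSq_nonneg ((l : ℤ) * β)) (radSq_nonneg (F (basePoint k l)))
  refine (sq_le_sq₀ (by positivity) hpos.le).1 ?_
  push_cast at h2 h3
  linarith

/-- The rotation part of `g_β` moves the image of the base point by a definite multiple of its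
distance to the axis, so the bound for the displacement confines the image to a cone. -/
theorem radSq_map_basePoint_le (h : IsConeLift k V α β m F T) {l : ℕ} (hl : 0 < l)
    (hT : T ≤ basePoint k l 3) :
    chordSq β * (radSq (F (basePoint k l)) / F (basePoint k l) 3 ^ 2) ≤ 1 := by
  obtain ⟨-, h1, -⟩ := h.disp_basePoint_bounds hl hT (n := 1) (by simp; omega)
  have hpos := h.pos _ (h.mem_of_le _ hT (h.radSq_basePoint_le l))
  have h2 : disp β 1 (F (basePoint k l)) ^ 2 ≤ 1 := pow_le_one₀ (disp_nonneg _ _ hpos) h1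
  rw [disp_sq, Int.cast_one, one_mul, add_div, mul_div_assoc] at h2
  have : 0 ≤ (1 : ℝ) ^ 2 / F (basePoint k l) 3 ^ 2 := by positivity
  linarith

/-- The rotation angles of `g_α` and `g_β` agree up to sign: the angles of `g_αⁿ` and `g_βⁿ` have
comparable sizes, for all `n`. -/
theorem eq_or_eq_neg (h : IsConeLift k V α β m F T) (hα : Irrational α) (hβ : Irrational β) :
    ∃ σ j : ℤ, (σ = 1 ∨ σ = -1) ∧ β = σ * α + j := by
  have hSα := chordSq_pos hα
  have hSβ := chordSq_pos hβ
  set C := (2 * k * baseSlope k) ^ 2 with hC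
  have hK := h.le_baseSlope
  have hk := h.one_le
  have hC0 : 0 < C := by
    have : 0 < 2 * k * baseSlope k := mul_pos (by linarith) (by linarith)
    positivity
  -- `P l` is the squared slope `r² / t²` of the image of the base point
  set P : ℕ → ℝ := fun l ↦ radSq (F (basePoint k l)) / F (basePoint k l) 3 ^ 2 with hP
  have hP0 : ∀ l, 0 ≤ P l := fun l ↦ div_nonneg (radSq_nonneg _) (sq_nonneg _)
  have key : ∀ n : ℤ, ∀ᶠ l : ℕ in atTop,
      chordSq (n * β) * P l ≤ (n : ℝ) ^ 2 / (l : ℝ) ^ 2 + chordSq (n * α) ∧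
      chordSq (n * α) ≤ C * ((n : ℝ) ^ 2 / (l : ℝ) ^ 2 + chordSq (n * β) * P l) := by
    intro n
    filter_upwards [h.eventually_le_basePoint, eventually_ge_atTop n.natAbs] with l hl hn
    obtain ⟨h1, -, h2⟩ := h.disp_basePoint_bounds hl.1 hl.2 (n := n) (by
      rw [Int.abs_eq_natAbs]; exact_mod_cast hn)
    have hl0 : (0 : ℝ) < l := by exact_mod_cast hl.1
    have hh := h.le_height_map_basePoint hl.1 hl.2
    have e : disp β n (F (basePoint k l)) ^ 2
        = (n : ℝ) ^ 2 / F (basePoint k l) 3 ^ 2 + chordSq (n * β) * P l := by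
      rw [disp_sq, add_div, mul_div_assoc]
    rw [e] at h1 h2
    have h3 : (n : ℝ) ^ 2 / F (basePoint k l) 3 ^ 2 ≤ (n : ℝ) ^ 2 / (l : ℝ) ^ 2 :=
      div_le_div_of_nonneg_left (sq_nonneg _) (by positivity) (pow_le_pow_left₀ hl0.le hh 2)
    have h4 : 0 ≤ (n : ℝ) ^ 2 / F (basePoint k l) 3 ^ 2 := by positivity
    have h5 : 0 ≤ (n : ℝ) ^ 2 / (l : ℝ) ^ 2 := by positivity
    refine ⟨by linarith, ?_⟩
    have := mul_le_mul_of_nonneg_left (add_le_add_left h3 (chordSq (n * β) * P l)) hC0.le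
    linarith
  -- the slopes `P l` are bounded, and bounded away from zero
  have hP1 : ∀ᶠ l : ℕ in atTop, P l ≤ 1 / chordSq β := by
    filter_upwards [h.eventually_le_basePoint] with l hl
    rw [le_div_iff₀ hSβ, mul_comm]
    exact h.radSq_map_basePoint_le hl.1 hl.2
  have hP2 : ∀ᶠ l : ℕ in atTop, chordSq α / (2 * C * chordSq β) ≤ P l := by
    have h1 : Tendsto (fun l : ℕ ↦ C * ((1 : ℝ) / (l : ℝ) ^ 2)) atTop (𝓝 (C * 0)) :=
      (tendsto_const_nhds.div_atTop ((tendsto_pow_atTop two_ne_zero).comp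
        tendsto_natCast_atTop_atTop)).const_mul C
    rw [mul_zero] at h1
    filter_upwards [key 1, h1.eventually (gt_mem_nhds (half_pos hSα))] with l hl hl'
    have h2 := hl.2
    simp only [Int.cast_one, one_mul, one_pow] at h2
    rw [div_le_iff₀ (by positivity)]
    linarith
  refine hα.eq_or_eq_neg_of_chordSq hβ (C := 2 * C * chordSq β / chordSq α) (C' := C / chordSq β)
    (fun n ↦ ?_) fun n ↦ ?_
  · have h1 : chordSq (n * β) * (chordSq α / (2 * C * chordSq β)) ≤ chordSq (n * α) := by
      refine le_of_eventually_le_div_sq_add (c := (n : ℝ) ^ 2) ?_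
      filter_upwards [key n, hP2] with l hl hl'
      exact (mul_le_mul_of_nonneg_left hl' (chordSq_nonneg _)).trans hl.1
    rw [mul_div_assoc', div_le_iff₀ (by positivity)] at h1
    rw [div_mul_eq_mul_div, le_div_iff₀ hSα]
    linarith
  · refine le_of_eventually_le_div_sq_add (c := C * (n : ℝ) ^ 2) ?_
    filter_upwards [key n, hP1] with l hl hl'
    refine hl.2.trans ?_
    have h1 := mul_le_mul_of_nonneg_left
      (mul_le_mul_of_nonneg_left hl' (chordSq_nonneg (n * β))) hC0.le
    calc C * ((n : ℝ) ^ 2 / (l : ℝ) ^ 2 + chordSq (n * β) * P l)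
        = C * (n : ℝ) ^ 2 / (l : ℝ) ^ 2 + C * (chordSq (n * β) * P l) := by ring
      _ ≤ C * (n : ℝ) ^ 2 / (l : ℝ) ^ 2 + C * (chordSq (n * β) * (1 / chordSq β)) := by linarith
      _ = _ := by ring

end IsConeLift

end RotationAngle

/-! ### Blow-ups of a lift -/

section BlowUp

/-- A diagonal sequence: in each scale `l` the index `n l` almost minimizes `f l`. -/
theorem exists_seq_tendsto_zero {f : ℕ → ℤ → ℝ} (hf : ∀ l n, 0 ≤ f l n)
    (h : ∀ η > 0, ∀ᶠ l in atTop, ∃ n, f l n < η) :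
    ∃ n : ℕ → ℤ, Tendsto (fun l ↦ f l (n l)) atTop (𝓝 0) := by
  have hbdd : ∀ l, BddBelow (range (f l)) := fun l ↦ ⟨0, by rintro _ ⟨n, rfl⟩; exact hf l n⟩
  have h1 : ∀ l : ℕ, ∃ n, f l n < (⨅ n, f l n) + 1 / ((l : ℝ) + 1) := fun l ↦
    exists_lt_of_ciInf_lt (lt_add_of_pos_right _ (by positivity))
  choose n hn using h1
  refine ⟨n, tendsto_order.2 ⟨fun a ha ↦ Eventually.of_forall fun l ↦ ha.trans_le (hf l _),
    fun a ha ↦ ?_⟩⟩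
  have h2 := tendsto_one_div_add_atTop_nhds_zero_nat (𝕜 := ℝ)
  filter_upwards [h (a / 2) (half_pos ha), h2.eventually (gt_mem_nhds (half_pos ha))] with l hl hl'
  obtain ⟨n', hn'⟩ := hl
  linarith [hn l, ciInf_le (hbdd l) n']

/-- The rotations by multiples `n α` with `n` close to `b l` come close to any given rotation. -/
theorem Irrational.exists_seq_tendsto {α : ℝ} (hα : Irrational α) (a b : ℝ) :
    ∃ n : ℕ → ℤ, Tendsto (fun l ↦ (n l : ℝ) / l) atTop (𝓝 b) ∧
      Tendsto (fun l ↦ chordSq (n l * α - a)) atTop (𝓝 0) := by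
  obtain ⟨n, hn⟩ := exists_seq_tendsto_zero
    (f := fun l n ↦ |(n : ℝ) / l - b| + chordSq (n * α - a))
    (fun l n ↦ add_nonneg (abs_nonneg _) (chordSq_nonneg _)) (by
      intro η hη
      obtain ⟨L, hL⟩ := hα.exists_chordSq_le_of_window (show 0 < η / 3 by positivity) a
      have h1 : Tendsto (fun l : ℕ ↦ (1 + L) / (l : ℝ)) atTop (𝓝 0) :=
        tendsto_const_nhds.div_atTop tendsto_natCast_atTop_atTop
      filter_upwards [h1.eventually (gt_mem_nhds (show 0 < η / 3 by positivity)),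
        eventually_gt_atTop 0] with l hl hl0
      have hl0 : (0 : ℝ) < l := by exact_mod_cast hl0
      obtain ⟨n, hn1, hn2, hn3⟩ := hL ⌈b * l⌉
      refine ⟨n, ?_⟩
      have h2 : b * l ≤ n := (Int.le_ceil _).trans (by exact_mod_cast hn1)
      have h3 : (n : ℝ) ≤ b * l + (1 + L) := by linarith [Int.ceil_lt_add_one (b * l)]
      have h4 : b ≤ (n : ℝ) / l := by rwa [le_div_iff₀ hl0]
      have h5 : (n : ℝ) / l - b ≤ (1 + L) / l := by
        rw [sub_le_iff_le_add, div_le_iff₀ hl0, add_mul, div_mul_cancel₀ _ hl0.ne']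
        linarith
      rw [abs_of_nonneg (by linarith)]
      linarith)
  refine ⟨n, ?_, ?_⟩
  · have h1 : Tendsto (fun l ↦ (n l : ℝ) / l - b) atTop (𝓝 0) :=
      squeeze_zero_norm (fun l ↦ by
        rw [Real.norm_eq_abs]; exact le_add_of_nonneg_right (chordSq_nonneg _)) hn
    simpa using h1.add_const b
  · exact squeeze_zero (fun l ↦ chordSq_nonneg _)
      (fun l ↦ le_add_of_nonneg_left (abs_nonneg _)) hn

/-- The unit vector of the `z`-axis. -/
noncomputable def vert : E4 := EuclideanSpace.single 2 1

@[simp] theorem vert_apply_zero : vert 0 = 0 := by simp [vert]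
@[simp] theorem vert_apply_one : vert 1 = 0 := by simp [vert]
@[simp] theorem vert_apply_two : vert 2 = 1 := by simp [vert]
@[simp] theorem vert_apply_three : vert 3 = 0 := by simp [vert]

theorem scr_smul_sub (a b c z : ℝ) (x : E4) :
    c • (scr a b x - z • vert) = scr a (c * b) (c • (x - z • vert)) := by
  apply E4.ext <;> simp <;> ring

theorem scr_smul (a b c : ℝ) (x : E4) : c • scr a b x = scr a (c * b) (c • x) := by
  simpa using scr_smul_sub a b c 0 x

theorem radSq_smul (c : ℝ) (x : E4) : radSq (c • x) = c ^ 2 * radSq x := by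
  simp [radSq]; ring

/-- The cone `r < t`. -/
def openCone : Set E4 := {x | 0 < x 3 ∧ radSq x < x 3 ^ 2}

theorem isOpen_openCone : IsOpen openCone := by
  have h1 : IsOpen {x : E4 | radSq x < x 3 ^ 2} := by
    refine isOpen_lt ?_ (by fun_prop)
    unfold radSq
    fun_prop
  exact (isOpen_lt continuous_const continuous_height).inter h1

theorem scr_mem_openCone {x : E4} (hx : x ∈ openCone) (a b : ℝ) : scr a b x ∈ openCone :=
  ⟨hx.1, by rw [radSq_scr]; exact hx.2⟩

theorem cyl_mem_openCone {r t : ℝ} (hr : 0 ≤ r) (hrt : r < t) : cyl r t ∈ openCone :=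
  ⟨hr.trans_lt hrt, by simpa using pow_lt_pow_left₀ hrt hr two_ne_zero⟩

/-- The map `F` in the scale `l`, normalized such that the image of `cyl 1 (baseSlope k)` has height
one and `z`-coordinate zero. -/
noncomputable def blowUp (k : ℝ) (F : E4 → E4) (l : ℕ) (x : E4) : E4 :=
  (F (basePoint k l) 3)⁻¹ • (F ((l : ℝ) • x) - F (basePoint k l) 2 • vert)

namespace IsConeLift

variable {k α β : ℝ} {V : Set E4} {m : ℤ} {F : E4 → E4} {T : ℝ}

theorem eventually_le_smul (h : IsConeLift k V α β m F T) {x : E4} (hx : x ∈ openCone) :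
    ∀ᶠ l : ℕ in atTop, 0 < l ∧ T ≤ basePoint k l 3 ∧ T ≤ ((l : ℝ) • x) 3 := by
  have h1 : Tendsto (fun l : ℕ ↦ (l : ℝ) * x 3) atTop atTop :=
    tendsto_natCast_atTop_atTop.atTop_mul_const hx.1
  filter_upwards [h.eventually_le_basePoint, h1.eventually_ge_atTop T] with l h1 h2
  exact ⟨h1.1, h1.2, by simpa using h2⟩

theorem radSq_smul_le {x : E4} (hx : x ∈ openCone) (l : ℕ) :
    radSq ((l : ℝ) • x) ≤ ((l : ℝ) • x) 3 ^ 2 := by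
  rw [radSq_smul, PiLp.smul_apply, smul_eq_mul, mul_pow]
  exact mul_le_mul_of_nonneg_left hx.2.le (sq_nonneg _)

theorem height_map_basePoint_pos (h : IsConeLift k V α β m F T) {l : ℕ}
    (hT : T ≤ basePoint k l 3) : 0 < F (basePoint k l) 3 :=
  h.pos _ (h.mem_of_le _ hT (h.radSq_basePoint_le l))

theorem blowUp_three (x : E4) (l : ℕ) :
    blowUp k F l x 3 = F ((l : ℝ) • x) 3 / F (basePoint k l) 3 := by
  simp [blowUp, div_eq_inv_mul]

theorem radSq_blowUp (x : E4) (l : ℕ) :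
    radSq (blowUp k F l x) = radSq (F ((l : ℝ) • x)) / F (basePoint k l) 3 ^ 2 := by
  simp [blowUp, radSq]; ring

theorem blowUp_pos (h : IsConeLift k V α β m F T) {x : E4} (hx : x ∈ openCone) {l : ℕ}
    (hT : T ≤ basePoint k l 3) (hTx : T ≤ ((l : ℝ) • x) 3) : 0 < blowUp k F l x 3 := by
  rw [blowUp_three]
  exact div_pos (h.pos _ (h.mem_of_le _ hTx (radSq_smul_le hx l))) (h.height_map_basePoint_pos hT)

theorem upperDist_blowUp_le (h : IsConeLift k V α β m F T) {x y : E4} (hx : x ∈ openCone)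
    (hy : y ∈ openCone) {l : ℕ} (hl : 0 < l) (hT : T ≤ basePoint k l 3)
    (hTx : T ≤ ((l : ℝ) • x) 3) (hTy : T ≤ ((l : ℝ) • y) 3) {μ : ℝ} (hμ : 0 < μ)
    (hμx : μ ≤ x 3) (hμy : μ ≤ y 3) :
    upperDist (blowUp k F l x) (blowUp k F l y) ≤ k * (‖x - y‖ / μ) := by
  have hl0 : (0 : ℝ) < l := by exact_mod_cast hl
  rw [blowUp, blowUp, upperDist_smul_sub (inv_pos.2 (h.height_map_basePoint_pos hT)) (by simp)]
  have h1 := h.upperDist_map_le (h.mem_of_le _ hTx (radSq_smul_le hx l))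
    (h.mem_of_le _ hTy (radSq_smul_le hy l)) (mul_pos hl0 hμ)
    (by simpa using mul_le_mul_of_nonneg_left hμx hl0.le)
    (by simpa using mul_le_mul_of_nonneg_left hμy hl0.le)
  rwa [← smul_sub, norm_smul, Real.norm_of_nonneg hl0.le, mul_div_mul_left _ _ hl0.ne'] at h1

theorem norm_blowUp_sub_le (h : IsConeLift k V α β m F T) {x y : E4} (hx : x ∈ openCone)
    (hy : y ∈ openCone) {l : ℕ} (hl : 0 < l) (hT : T ≤ basePoint k l 3)
    (hTx : T ≤ ((l : ℝ) • x) 3) (hTy : T ≤ ((l : ℝ) • y) 3) {μ : ℝ} (hμ : 0 < μ)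
    (hμx : μ ≤ x 3) (hμy : μ ≤ y 3) :
    ‖blowUp k F l x - blowUp k F l y‖
      ≤ blowUp k F l x 3 * (Real.exp (k * (‖x - y‖ / μ)) - 1) := by
  have hx0 := h.blowUp_pos hx hT hTx
  refine (norm_sub_le_mul_exp_sub_one hx0 (h.blowUp_pos hy hT hTy)).trans
    (mul_le_mul_of_nonneg_left ?_ hx0.le)
  linarith [Real.exp_le_exp.2 (h.upperDist_blowUp_le hx hy hl hT hTx hTy hμ hμx hμy)]

theorem blowUp_scr (h : IsConeLift k V α β m F T) {x : E4} (hx : x ∈ openCone) {l : ℕ}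
    (hl : 0 < l) (hTx : T ≤ ((l : ℝ) • x) 3) (n : ℤ) :
    blowUp k F l (scr (n * α) (n / l) x)
      = scr (m * n * β) (m * (n / F (basePoint k l) 3)) (blowUp k F l x) := by
  have hl0 : (l : ℝ) ≠ 0 := by positivity
  have h1 := h.equivariant _ (h.mem_of_le _ hTx (radSq_smul_le hx l)) n
  rw [spow, spow] at h1
  rw [blowUp, scr_smul, mul_div_cancel₀ _ hl0, h1, scr_smul_sub]
  push_cast
  congr 1
  ring

theorem basePoint_eq_smul (l : ℕ) : basePoint k l = (l : ℝ) • cyl 1 (baseSlope k) := by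
  apply E4.ext <;> simp [basePoint, mul_comm]

theorem cyl_one_mem_openCone (h : IsConeLift k V α β m F T) : cyl 1 (baseSlope k) ∈ openCone :=
  cyl_mem_openCone zero_le_one (by linarith [h.le_baseSlope])

theorem norm_blowUp_cyl_one_le (h : IsConeLift k V α β m F T) (hβ : Irrational β) {l : ℕ}
    (hl : 0 < l) (hT : T ≤ basePoint k l 3) :
    ‖blowUp k F l (cyl 1 (baseSlope k))‖ ^ 2 ≤ 1 / chordSq β + 1 := by
  have h1 := h.radSq_map_basePoint_le hl hT
  have h0 := h.height_map_basePoint_pos hT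
  have h2 := radSq_blowUp (k := k) (F := F) (cyl 1 (baseSlope k)) l
  have h3 := blowUp_three (k := k) (F := F) (cyl 1 (baseSlope k)) l
  rw [← basePoint_eq_smul] at h2 h3
  rw [div_self h0.ne'] at h3
  have h4 : blowUp k F l (cyl 1 (baseSlope k)) 2 = 0 := by
    simp [blowUp, ← basePoint_eq_smul]
  rw [mul_comm, ← le_div_iff₀ (chordSq_pos hβ), ← h2, radSq] at h1
  rw [E4.norm_sq, h3, h4]
  linarith

/-- The blow-ups stay in a compact set, so they converge along an ultrafilter. -/
theorem exists_tendsto_blowUp (h : IsConeLift k V α β m F T) (hβ : Irrational β) {x : E4}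
    (hx : x ∈ openCone) :
    ∃ y : E4, Tendsto (fun l ↦ blowUp k F l x) (hyperfilter ℕ : Filter ℕ) (𝓝 y) := by
  set p := cyl 1 (baseSlope k) with hp
  have hpc := h.cyl_one_mem_openCone
  set D := k * (‖p - x‖ / min (p 3) (x 3)) with hD
  set B := √(1 / chordSq β + 1) with hB
  have h1 : ∀ᶠ l : ℕ in (hyperfilter ℕ : Filter ℕ),
      blowUp k F l x ∈ Metric.closedBall (0 : E4) (B + (Real.exp D - 1)) := by
    filter_upwards [(h.eventually_le_smul hx).filter_mono Nat.hyperfilter_le_atTop] with l hl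
    obtain ⟨hl0, hT, hTx⟩ := hl
    have hTp : T ≤ ((l : ℝ) • p) 3 := by rwa [hp, ← basePoint_eq_smul]
    have h2 := h.norm_blowUp_sub_le hpc hx hl0 hT hTp hTx (lt_min hpc.1 hx.1) (min_le_left _ _)
      (min_le_right _ _)
    rw [blowUp_three, ← basePoint_eq_smul, div_self (h.height_map_basePoint_pos hT).ne',
      one_mul] at h2
    have h3 := Real.le_sqrt_of_sq_le (h.norm_blowUp_cyl_one_le hβ hl0 hT)
    rw [mem_closedBall_zero_iff]
    have h4 := norm_sub_norm_le (blowUp k F l x) (blowUp k F l p)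
    rw [norm_sub_rev] at h4
    linarith
  obtain ⟨y, -, hy⟩ := isCompact_iff_ultrafilter_le_nhds'.1
    (isCompact_closedBall (0 : E4) (B + (Real.exp D - 1)))
    ((hyperfilter ℕ).map fun l ↦ blowUp k F l x) h1
  exact ⟨y, hy⟩

theorem exists_tendsto_scale (h : IsConeLift k V α β m F T) :
    ∃ q : ℝ, Tendsto (fun l : ℕ ↦ (l : ℝ) / F (basePoint k l) 3) (hyperfilter ℕ : Filter ℕ)
      (𝓝 q) := by
  have h1 : ∀ᶠ l : ℕ in (hyperfilter ℕ : Filter ℕ),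
      (l : ℝ) / F (basePoint k l) 3 ∈ Icc (0 : ℝ) 1 := by
    filter_upwards [h.eventually_le_basePoint.filter_mono Nat.hyperfilter_le_atTop] with l hl
    have h0 := h.height_map_basePoint_pos hl.2
    exact ⟨by positivity, (div_le_one h0).2 (h.le_height_map_basePoint hl.1 hl.2)⟩
  obtain ⟨q, -, hq⟩ := isCompact_iff_ultrafilter_le_nhds'.1 (isCompact_Icc (a := (0 : ℝ)) (b := 1))
    ((hyperfilter ℕ).map fun l : ℕ ↦ (l : ℝ) / F (basePoint k l) 3) h1
  exact ⟨q, hq⟩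

end IsConeLift

end BlowUp

/-! ### Limits of blow-ups and their symmetry -/

section BlowUpLimit

/-- Uniformly Lipschitz maps that converge pointwise on a compact set converge uniformly. -/
theorem eventually_forall_norm_sub_le {ι E E' : Type*} [PseudoMetricSpace E]
    [SeminormedAddCommGroup E'] {𝓕 : Filter ι} [𝓕.NeBot] {F : ι → E → E'} {G : E → E'} {C : ℝ≥0}
    {s : Set E} (hs : IsCompact s) (hF : ∀ᶠ i in 𝓕, LipschitzOnWith C (F i) s)
    (hG : ∀ x ∈ s, Tendsto (fun i ↦ F i x) 𝓕 (𝓝 (G x))) {η : ℝ} (hη : 0 < η) :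
    ∀ᶠ i in 𝓕, ∀ x ∈ s, ‖F i x - G x‖ ≤ η := by
  have hGL : LipschitzOnWith C G s := by
    refine LipschitzOnWith.of_dist_le_mul fun x hx y hy ↦ ?_
    refine le_of_tendsto ((hG x hx).dist (hG y hy)) ?_
    filter_upwards [hF] with i hi using hi.dist_le_mul x hx y hy
  set r := η / (4 * (C + 1)) with hr
  have hr0 : 0 < r := by positivity
  obtain ⟨t, hts, htf, hcov⟩ := hs.finite_cover_balls hr0
  have h1 : ∀ᶠ i in 𝓕, ∀ z ∈ t, dist (F i z) (G z) < η / 2 :=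
    (eventually_all_finite htf).2 fun z hz ↦
      Metric.tendsto_nhds.1 (hG z (hts hz)) _ (half_pos hη)
  filter_upwards [hF, h1] with i hi hi1 x hx
  obtain ⟨z, hz, hxz⟩ := mem_iUnion₂.1 (hcov hx)
  have h2 := hi.dist_le_mul x hx z (hts hz)
  have h3 := hGL.dist_le_mul z (hts hz) x hx
  have h4 : (C : ℝ) * dist x z ≤ η / 4 := by
    have h5 : (C : ℝ) * dist x z ≤ C * r :=
      mul_le_mul_of_nonneg_left (Metric.mem_ball.1 hxz).le C.2
    have h6 : (C : ℝ) * r ≤ η / 4 := by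
      rw [hr, mul_div_assoc', div_le_div_iff₀ (by positivity) (by positivity)]
      nlinarith [C.2]
    linarith
  rw [dist_comm z x] at h3
  rw [← dist_eq_norm]
  have h7 := dist_triangle4 (F i x) (F i z) (G z) (G x)
  linarith [hi1 z hz]

/-- Some multiple of an irrational rotation is small, and it is not trivial. -/
theorem Irrational.exists_chordSq_mul_mem_Ioc {α : ℝ} (hα : Irrational α) {η : ℝ} (hη : 0 < η) :
    ∃ n : ℤ, chordSq (n * α) ∈ Ioc 0 η := by
  obtain ⟨n, p, hn, -, hnp⟩ := hα.exists_int_mul_sub_small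
    (η := √(η / (4 * Real.pi ^ 2))) (Real.sqrt_pos.2 (by positivity))
  refine ⟨n, chordSq_pos (hα.intCast_mul hn.ne'), (chordSq_le_sq _ p).trans ?_⟩
  have h1 : |n * α - p| ^ 2 ≤ √(η / (4 * Real.pi ^ 2)) ^ 2 :=
    pow_le_pow_left₀ (abs_nonneg _) hnp.le 2
  rw [sq_abs, Real.sq_sqrt (by positivity), le_div_iff₀ (by positivity)] at h1
  linarith

theorem chordSq_add_int (a : ℝ) (n : ℤ) : chordSq (a + n) = chordSq a := by
  have := chordSq_sub_int (a + n) n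
  rwa [add_sub_cancel_right, eq_comm] at this

theorem chordSq_intCast_mul {s : ℤ} (hs : s = 1 ∨ s = -1) (a : ℝ) :
    chordSq (s * a) = chordSq a := by
  rcases hs with rfl | rfl
  · simp
  · simp [chordSq_neg]

/-- The properties of a limit of blow-ups: up to bounded factors it respects the height `t` and
the slope `r / t`, and it turns the rotation by `a` and the translation by `b` into the rotation by
`s a` and the translation by `c b`. -/
structure IsConeLimit (k : ℝ) (s : ℤ) (c : ℝ) (G : E4 → E4) : Prop where
  pos : ∀ x ∈ openCone, 0 < G x 3
  norm_sub_le : ∀ x ∈ openCone, ∀ y ∈ openCone, ∀ μ : ℝ, 0 < μ → μ ≤ x 3 → μ ≤ y 3 →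
    ‖G x - G y‖ ≤ G x 3 * (Real.exp (k * (‖x - y‖ / μ)) - 1)
  equivariant : ∀ x ∈ openCone, ∀ a b : ℝ, G (scr a b x) = scr (s * a) (c * b) (G x)
  le_height : ∀ x ∈ openCone, |c| * x 3 ≤ 2 * k * G x 3
  height_le : ∀ x ∈ openCone, G x 3 ≤ 2 * k * |c| * x 3
  radSq_le : ∀ x ∈ openCone, radSq (G x) / G x 3 ^ 2 ≤ (2 * k) ^ 2 * (radSq x / x 3 ^ 2)
  le_radSq : ∀ x ∈ openCone, radSq x / x 3 ^ 2 ≤ (2 * k) ^ 2 * (radSq (G x) / G x 3 ^ 2)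

namespace IsConeLift

variable {k α β : ℝ} {V : Set E4} {m : ℤ} {F : E4 → E4} {T : ℝ}

theorem disp_smul_sq (γ : ℝ) (n : ℤ) {l : ℕ} (hl : 0 < l) (x : E4) :
    disp γ n ((l : ℝ) • x) ^ 2 = (((n : ℝ) / l) ^ 2 + chordSq (n * γ) * radSq x) / x 3 ^ 2 := by
  have hl0 : (l : ℝ) ≠ 0 := by positivity
  rw [disp_sq, radSq_smul, PiLp.smul_apply, smul_eq_mul]
  field_simp

theorem disp_map_smul_sq (h : IsConeLift k V α β m F T) (n : ℤ) {l : ℕ}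
    (hT : T ≤ basePoint k l 3) (x : E4) :
    disp β n (F ((l : ℝ) • x)) ^ 2 = (((n : ℝ) / F (basePoint k l) 3) ^ 2
      + chordSq (n * β) * radSq (blowUp k F l x)) / blowUp k F l x 3 ^ 2 := by
  have h0 := h.height_map_basePoint_pos hT
  rw [disp_sq, blowUp_three, radSq_blowUp]
  field_simp

variable {σ j : ℤ} {q : ℝ} {G : E4 → E4}

theorem tendsto_radSq {𝓕 : Filter ℕ} {u : ℕ → E4} {y : E4} (h : Tendsto u 𝓕 (𝓝 y)) :
    Tendsto (fun l ↦ radSq (u l)) 𝓕 (𝓝 (radSq y)) := by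
  have : Continuous radSq := by unfold radSq; fun_prop
  exact (this.tendsto y).comp h

/-- The blow-ups have height one at `cyl 1 (baseSlope k)`, and their heights at `x` differ from
this by a bounded factor. -/
theorem limit_pos (h : IsConeLift k V α β m F T)
    (hG : ∀ x ∈ openCone, Tendsto (fun l ↦ blowUp k F l x) (hyperfilter ℕ : Filter ℕ) (𝓝 (G x)))
    {x : E4} (hx : x ∈ openCone) : 0 < G x 3 := by
  set p := cyl 1 (baseSlope k) with hp
  have hpc := h.cyl_one_mem_openCone
  set D := k * (‖x - p‖ / min (x 3) (p 3)) with hD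
  have h1 : 1 ≤ G x 3 * Real.exp D := by
    refine ge_of_tendsto (((continuous_height.tendsto _).comp (hG x hx)).mul_const _) ?_
    filter_upwards [(h.eventually_le_smul hx).filter_mono Nat.hyperfilter_le_atTop] with l hl
    obtain ⟨hl0, hT, hTx⟩ := hl
    have hTp : T ≤ ((l : ℝ) • p) 3 := by rwa [hp, ← basePoint_eq_smul]
    have h2 := h.upperDist_blowUp_le hx hpc hl0 hT hTx hTp (lt_min hx.1 hpc.1) (min_le_left _ _)
      (min_le_right _ _)
    have h3 := height_le_mul_exp (h.blowUp_pos hx hT hTx) (h.blowUp_pos hpc hT hTp)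
    rw [blowUp_three (cyl _ _), ← basePoint_eq_smul, div_self (h.height_map_basePoint_pos hT).ne']
      at h3
    exact h3.trans (mul_le_mul_of_nonneg_left (Real.exp_le_exp.2 h2)
      (h.blowUp_pos hx hT hTx).le)
  by_contra! h0
  nlinarith [Real.exp_pos D]

theorem norm_limit_sub_le (h : IsConeLift k V α β m F T)
    (hG : ∀ x ∈ openCone, Tendsto (fun l ↦ blowUp k F l x) (hyperfilter ℕ : Filter ℕ) (𝓝 (G x)))
    {x y : E4} (hx : x ∈ openCone) (hy : y ∈ openCone) {μ : ℝ} (hμ : 0 < μ) (hμx : μ ≤ x 3)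
    (hμy : μ ≤ y 3) : ‖G x - G y‖ ≤ G x 3 * (Real.exp (k * (‖x - y‖ / μ)) - 1) := by
  refine le_of_tendsto_of_tendsto ((hG x hx).sub (hG y hy)).norm
    (((continuous_height.tendsto _).comp (hG x hx)).mul_const _) ?_
  filter_upwards [(h.eventually_le_smul hx).filter_mono Nat.hyperfilter_le_atTop,
    (h.eventually_le_smul hy).filter_mono Nat.hyperfilter_le_atTop] with l hl hl'
  exact h.norm_blowUp_sub_le hx hy hl.1 hl.2.1 hl.2.2 hl'.2.2 hμ hμx hμy

/-- The powers of `g_α` become dense, after rescaling, in the group of all rotations and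
translations. -/
theorem limit_scr (h : IsConeLift k V α β m F T) (hα : Irrational α) (hσ : σ = 1 ∨ σ = -1)
    (hβ : β = σ * α + j)
    (hG : ∀ x ∈ openCone, Tendsto (fun l ↦ blowUp k F l x) (hyperfilter ℕ : Filter ℕ) (𝓝 (G x)))
    (hq : Tendsto (fun l : ℕ ↦ (l : ℝ) / F (basePoint k l) 3) (hyperfilter ℕ : Filter ℕ) (𝓝 q))
    {x : E4} (hx : x ∈ openCone) (a b : ℝ) :
    G (scr a b x) = scr ((m * σ : ℤ) * a) (m * q * b) (G x) := by
  have hsq : ∀ {u : ℕ → ℝ} {L : Filter ℕ}, (∀ l, 0 ≤ u l) → Tendsto (fun l ↦ u l ^ 2) L (𝓝 0) →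
      Tendsto u L (𝓝 0) := fun {u L} hu h2 ↦ by
    have h3 := (Real.continuous_sqrt.tendsto 0).comp h2
    rw [Real.sqrt_zero] at h3
    exact h3.congr fun l ↦ Real.sqrt_sq (hu l)
  obtain ⟨n, hnb, hna⟩ := hα.exists_seq_tendsto a b
  replace hnb := hnb.mono_left Nat.hyperfilter_le_atTop
  replace hna := hna.mono_left Nat.hyperfilter_le_atTop
  have hev := (h.eventually_le_smul hx).filter_mono Nat.hyperfilter_le_atTop
  set y := scr a b x with hy
  set w : ℕ → E4 := fun l ↦ scr (n l * α) (n l / l) x with hw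
  have hyc : y ∈ openCone := scr_mem_openCone hx _ _
  have hwy : Tendsto (fun l ↦ ‖y - w l‖) (hyperfilter ℕ : Filter ℕ) (𝓝 0) := by
    refine hsq (fun l ↦ norm_nonneg _) ?_
    have h1 : ∀ l, ‖y - w l‖ ^ 2 = ((n l : ℝ) / l - b) ^ 2 + chordSq (n l * α - a) * radSq x :=
      fun l ↦ by rw [norm_sub_rev, hw, hy, norm_scr_sub_scr_sq]
    simp only [h1]
    simpa using ((hnb.sub_const b).pow 2).add (hna.mul_const (radSq x))
  have h1 : Tendsto (fun l ↦ blowUp k F l (w l)) (hyperfilter ℕ : Filter ℕ) (𝓝 (G y)) := by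
    have h2 : Tendsto (fun l ↦ blowUp k F l y - blowUp k F l (w l)) (hyperfilter ℕ : Filter ℕ)
        (𝓝 0) := by
      have h3 : Tendsto (fun l ↦ blowUp k F l y 3 * (Real.exp (k * (‖y - w l‖ / x 3)) - 1))
          (hyperfilter ℕ : Filter ℕ) (𝓝 0) := by
        have h4 := ((Real.continuous_exp.tendsto _).comp
          ((hwy.div_const (x 3)).const_mul k)).sub_const 1
        have h5 := ((continuous_height.tendsto _).comp (hG y hyc)).mul h4
        simpa using h5
      refine squeeze_zero_norm' ?_ h3
      filter_upwards [hev] with l hl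
      exact h.norm_blowUp_sub_le hyc (scr_mem_openCone hx _ _) hl.1 hl.2.1 hl.2.2 hl.2.2 hx.1
        le_rfl le_rfl
    simpa using (hG y hyc).sub h2
  have hs : m * σ = 1 ∨ m * σ = -1 := by
    rcases h.eq_or with rfl | rfl <;> rcases hσ with rfl | rfl <;> simp
  have h2 : Tendsto (fun l ↦ scr (m * n l * β) (m * (n l / F (basePoint k l) 3)) (blowUp k F l x))
      (hyperfilter ℕ : Filter ℕ) (𝓝 (scr ((m * σ : ℤ) * a) (m * q * b) (G x))) := by
    have h3 : Tendsto (fun l ↦ scr ((m * σ : ℤ) * a) (m * q * b) (blowUp k F l x))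
        (hyperfilter ℕ : Filter ℕ) (𝓝 (scr ((m * σ : ℤ) * a) (m * q * b) (G x))) :=
      ((continuous_scr _ _).tendsto _).comp (hG x hx)
    have h4 : Tendsto (fun l ↦ ‖scr (m * n l * β) (m * (n l / F (basePoint k l) 3))
        (blowUp k F l x) - scr ((m * σ : ℤ) * a) (m * q * b) (blowUp k F l x)‖)
        (hyperfilter ℕ : Filter ℕ) (𝓝 0) := by
      refine hsq (fun l ↦ norm_nonneg _) ?_
      have h5 : ∀ l, chordSq (m * n l * β - (m * σ : ℤ) * a) = chordSq (n l * α - a) := by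
        intro l
        have e : m * n l * β - (m * σ : ℤ) * a
            = (m * σ : ℤ) * (n l * α - a) + (m * n l * j : ℤ) := by
          rw [hβ]; push_cast; ring
        rw [e, chordSq_add_int, chordSq_intCast_mul hs]
      simp only [norm_scr_sub_scr_sq, h5]
      have h6 : Tendsto (fun l ↦ (n l : ℝ) / F (basePoint k l) 3) (hyperfilter ℕ : Filter ℕ)
          (𝓝 (b * q)) := by
        refine (hnb.mul hq).congr' ?_
        filter_upwards [hev] with l hl
        have hl0 : (l : ℝ) ≠ 0 := by have := hl.1; positivity
        field_simp
      have h7 := (((h6.const_mul (m : ℝ)).sub_const (m * q * b)).pow 2).add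
        (hna.mul (tendsto_radSq (hG x hx)))
      rw [show ((m : ℝ) * (b * q) - m * q * b) ^ 2 + 0 * radSq (G x) = 0 by ring] at h7
      exact h7
    have h8 := (tendsto_zero_iff_norm_tendsto_zero.2 h4).add h3
    simpa using h8
  refine tendsto_nhds_unique h1 (h2.congr' ?_)
  filter_upwards [hev] with l hl
  exact (h.blowUp_scr hx hl.1 hl.2.2 (n l)).symm

/-- The comparison of small displacements passes to the limit. -/
theorem displacement_le_limit (h : IsConeLift k V α β m F T) (hσ : σ = 1 ∨ σ = -1)
    (hβ : β = σ * α + j)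
    (hG : ∀ x ∈ openCone, Tendsto (fun l ↦ blowUp k F l x) (hyperfilter ℕ : Filter ℕ) (𝓝 (G x)))
    (hq : Tendsto (fun l : ℕ ↦ (l : ℝ) / F (basePoint k l) 3) (hyperfilter ℕ : Filter ℕ) (𝓝 q))
    {x : E4} (hx : x ∈ openCone) {n : ℕ → ℤ} {b S : ℝ}
    (hnb : Tendsto (fun l ↦ (n l : ℝ) / l) (hyperfilter ℕ : Filter ℕ) (𝓝 b))
    (hnS : Tendsto (fun l ↦ chordSq (n l * α)) (hyperfilter ℕ : Filter ℕ) (𝓝 S))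
    (hlt : k ^ 2 * (((b * q) ^ 2 + S * radSq (G x)) / G x 3 ^ 2) < 1) :
    (b ^ 2 + S * radSq x) / x 3 ^ 2
      ≤ (2 * k) ^ 2 * (((b * q) ^ 2 + S * radSq (G x)) / G x 3 ^ 2) := by
  have hev := (h.eventually_le_smul hx).filter_mono Nat.hyperfilter_le_atTop
  have hk0 : 0 < k := zero_lt_one.trans_le h.one_le
  have hSβ : ∀ l, chordSq (n l * β) = chordSq (n l * α) := by
    intro l
    rw [← chordSq_intCast_mul hσ (n l * α), ← chordSq_add_int (σ * (n l * α)) (n l * j), hβ]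
    congr 1
    push_cast
    ring
  have h1 : Tendsto (fun l ↦ disp α (n l) ((l : ℝ) • x) ^ 2) (hyperfilter ℕ : Filter ℕ)
      (𝓝 ((b ^ 2 + S * radSq x) / x 3 ^ 2)) := by
    refine (((hnb.pow 2).add (hnS.mul_const (radSq x))).div_const (x 3 ^ 2)).congr' ?_
    filter_upwards [hev] with l hl
    exact (disp_smul_sq α (n l) hl.1 x).symm
  have h2 : Tendsto (fun l ↦ disp β (n l) (F ((l : ℝ) • x)) ^ 2) (hyperfilter ℕ : Filter ℕ)
      (𝓝 (((b * q) ^ 2 + S * radSq (G x)) / G x 3 ^ 2)) := by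
    have h3 := (((hnb.mul hq).pow 2).add (hnS.mul (tendsto_radSq (hG x hx)))).div
      (((continuous_height.tendsto _).comp (hG x hx)).pow 2)
      (pow_ne_zero 2 (h.limit_pos hG hx).ne')
    refine h3.congr' ?_
    filter_upwards [hev] with l hl
    rw [h.disp_map_smul_sq (n l) hl.2.1 x, hSβ]
    have hl0 : (l : ℝ) ≠ 0 := by have := hl.1; positivity
    have e : (n l : ℝ) / l * (l / F (basePoint k l) 3) = n l / F (basePoint k l) 3 := by field_simp
    rw [← e]
    rfl
  refine le_of_tendsto_of_tendsto h1 (h2.const_mul _) ?_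
  filter_upwards [hev, (h2.const_mul (k ^ 2)).eventually (gt_mem_nhds hlt)] with l hl hl1
  have hr := radSq_smul_le hx l
  have h0 := disp_nonneg β (n l) (h.pos _ (h.mem_of_le _ hl.2.2 hr))
  have h3 : k * disp β (n l) (F ((l : ℝ) • x)) ≤ 1 := by
    refine (sq_le_sq₀ (mul_nonneg hk0.le h0) zero_le_one).1 ?_
    rw [mul_pow, one_pow]
    exact hl1.le
  have h4 := h.disp_le_map _ hl.2.2 hr (n l) h3
  calc disp α (n l) ((l : ℝ) • x) ^ 2 ≤ (2 * k * disp β (n l) (F ((l : ℝ) • x))) ^ 2 :=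
        pow_le_pow_left₀ (disp_nonneg _ _ (h.pos_T.trans_le hl.2.2)) h4 2
    _ = _ := by ring

/-- The bounds for the height and the slope are obtained by comparing displacements of suitable
screw translations at `x` and at `G x`: pure translations measure the height, and small rotations
measure the slope. -/
theorem isConeLimit (h : IsConeLift k V α β m F T) (hα : Irrational α) (hσ : σ = 1 ∨ σ = -1)
    (hβ : β = σ * α + j)
    (hG : ∀ x ∈ openCone, Tendsto (fun l ↦ blowUp k F l x) (hyperfilter ℕ : Filter ℕ) (𝓝 (G x)))
    (hq : Tendsto (fun l : ℕ ↦ (l : ℝ) / F (basePoint k l) 3) (hyperfilter ℕ : Filter ℕ)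
      (𝓝 q)) :
    IsConeLimit k (m * σ) (m * q) G := by
  have hk0 : 0 < k := zero_lt_one.trans_le h.one_le
  have hscr := fun x hx a b ↦ h.limit_scr hα hσ hβ hG hq (x := x) hx a b
  have hpos := fun x hx ↦ h.limit_pos hG (x := x) hx
  have hq0 : 0 ≤ q := by
    refine ge_of_tendsto hq ?_
    filter_upwards [h.eventually_le_basePoint.filter_mono Nat.hyperfilter_le_atTop] with l hl
    have h0 := h.height_map_basePoint_pos hl.2
    positivity
  have hmq : |(m : ℝ) * q| = q := by
    rcases h.eq_or with rfl | rfl <;> simp [abs_of_nonneg hq0]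
  have hs : m * σ = 1 ∨ m * σ = -1 := by
    rcases h.eq_or with rfl | rfl <;> rcases hσ with rfl | rfl <;> simp
  have hradSq_le : ∀ x ∈ openCone,
      radSq (G x) / G x 3 ^ 2 ≤ (2 * k) ^ 2 * (radSq x / x 3 ^ 2) := by
    intro x hx
    have hx3 := hx.1
    have hGx := hpos x hx
    obtain ⟨n, hn0, hn⟩ := hα.exists_chordSq_mul_mem_Ioc (show 0 < 1 / k ^ 2 by positivity)
    set S := chordSq (n * α) with hS
    have h1 := h.norm_limit_sub_le hG (scr_mem_openCone hx (n * α) 0) hx hx.1 le_rfl le_rfl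
    have h2 : ‖scr (n * α) 0 x - x‖ ^ 2 = S * radSq x := by
      rw [norm_scr_sub_self_sq]; ring
    have h3 : ‖G (scr (n * α) 0 x) - G x‖ ^ 2 = S * radSq (G x) := by
      rw [hscr x hx, norm_scr_sub_self_sq, chordSq_intCast_mul hs]; ring
    have h4 : G (scr (n * α) 0 x) 3 = G x 3 := by rw [hscr x hx]; rfl
    rw [h4] at h1
    set d := k * (‖scr (n * α) 0 x - x‖ / x 3) with hd
    have hd2 : d ^ 2 = k ^ 2 * S * (radSq x / x 3 ^ 2) := by
      rw [hd, mul_pow, div_pow, h2]; ring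
    have hrx : radSq x / x 3 ^ 2 ≤ 1 := (div_le_one (by positivity)).2 hx.2.le
    have hd1 : d ≤ 1 := by
      refine (sq_le_sq₀ (by positivity) zero_le_one).1 ?_
      rw [hd2, one_pow]
      have h5 : k ^ 2 * S ≤ 1 := by
        rw [le_div_iff₀ (by positivity)] at hn; linarith
      have h6 : 0 ≤ radSq x / x 3 ^ 2 := div_nonneg (radSq_nonneg _) (sq_nonneg _)
      nlinarith
    have h7 := h1.trans (mul_le_mul_of_nonneg_left
      (exp_sub_one_le_two_mul (show 0 ≤ d by positivity) hd1) hGx.le)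
    have h8 := pow_le_pow_left₀ (norm_nonneg _) h7 2
    rw [h3, mul_pow, mul_pow, hd2] at h8
    rw [div_le_iff₀ (by positivity)]
    refine le_of_mul_le_mul_left (h8.trans (le_of_eq ?_)) hn0
    ring
  refine ⟨hpos, fun x hx y hy μ hμ hμx hμy ↦ h.norm_limit_sub_le hG hx hy hμ hμx hμy, hscr,
    fun x hx ↦ ?_, fun x hx ↦ ?_, hradSq_le, fun x hx ↦ ?_⟩
  · have hx3 := hx.1
    -- the length `x 3 / k` makes the exponent in the Lipschitz estimate equal to one
    have h1 := h.norm_limit_sub_le hG (scr_mem_openCone hx 0 (x 3 / k)) hx hx.1 le_rfl le_rfl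
    have h2 : ∀ b (y : E4), ‖scr 0 b y - y‖ = |b| := fun b y ↦ by
      refine (sq_eq_sq₀ (norm_nonneg _) (abs_nonneg _)).1 ?_
      rw [norm_scr_sub_self_sq, sq_abs]
      simp [chordSq]
    have h3 : G (scr 0 (x 3 / k) x) 3 = G x 3 := by rw [hscr x hx]; rfl
    rw [h3, h2, hscr x hx, mul_zero, h2, abs_mul, abs_of_pos (show 0 < x 3 / k by positivity),
      show k * (x 3 / k / x 3) = 1 by field_simp] at h1
    have h4 := h1.trans (mul_le_mul_of_nonneg_left
      (exp_sub_one_le_two_mul zero_le_one le_rfl) (hpos x hx).le)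
    rw [mul_div_assoc', div_le_iff₀ hk0] at h4
    linarith
  · have hGx := hpos x hx
    have hx3 := hx.1
    -- for translations by `b` the displacement at `G x` stays below `1 / k`; the summand `1`
    -- keeps the denominator positive, as `q = 0` is not excluded yet
    set b := G x 3 / (k * (q + 1)) with hb
    have hb0 : 0 < b := by positivity
    obtain ⟨n, hnb, hna⟩ := hα.exists_seq_tendsto 0 b
    have hlt : k ^ 2 * (((b * q) ^ 2 + 0 * radSq (G x)) / G x 3 ^ 2) < 1 := by
      have e : k ^ 2 * (((b * q) ^ 2 + 0 * radSq (G x)) / G x 3 ^ 2) = (q / (q + 1)) ^ 2 := by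
        rw [hb]; field_simp; ring
      rw [e]
      exact pow_lt_one₀ (by positivity) ((div_lt_one (by positivity)).2 (by linarith)) two_ne_zero
    have h1 := h.displacement_le_limit hσ hβ hG hq hx (hnb.mono_left Nat.hyperfilter_le_atTop)
      ((by simpa using hna : Tendsto (fun l ↦ chordSq (n l * α)) atTop (𝓝 0)).mono_left
        Nat.hyperfilter_le_atTop) hlt
    rw [hmq]
    refine (sq_le_sq₀ hGx.le (by positivity)).1 ?_
    rw [zero_mul, zero_mul, add_zero, add_zero, mul_div_assoc',
      div_le_div_iff₀ (by positivity) (by positivity)] at h1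
    refine le_of_mul_le_mul_left (h1.trans (le_of_eq ?_)) (show 0 < b ^ 2 by positivity)
    ring
  · have hGx := hpos x hx
    have hx3 := hx.1
    obtain ⟨n, hn0, hn⟩ := hα.exists_chordSq_mul_mem_Ioc
      (show 0 < 1 / (2 * (2 * k) ^ 2 * k ^ 2) by positivity)
    set S := chordSq (n * α) with hS
    have hrx : radSq x / x 3 ^ 2 ≤ 1 := (div_le_one (by positivity)).2 hx.2.le
    have hrG0 : 0 ≤ radSq (G x) / G x 3 ^ 2 := div_nonneg (radSq_nonneg _) (sq_nonneg _)
    have hrG : radSq (G x) / G x 3 ^ 2 ≤ (2 * k) ^ 2 :=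
      (hradSq_le x hx).trans (mul_le_of_le_one_right (by positivity) hrx)
    have hlt : k ^ 2 * (((0 * q) ^ 2 + S * radSq (G x)) / G x 3 ^ 2) < 1 := by
      rw [le_div_iff₀ (by positivity)] at hn
      have e : k ^ 2 * (((0 * q) ^ 2 + S * radSq (G x)) / G x 3 ^ 2)
          = k ^ 2 * S * (radSq (G x) / G x 3 ^ 2) := by ring
      rw [e]
      have := mul_le_mul_of_nonneg_left hrG (show 0 ≤ k ^ 2 * S by positivity)
      linarith
    have h1 := h.displacement_le_limit hσ hβ hG hq hx (n := fun _ ↦ n) (b := 0) (S := S)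
      ((tendsto_const_nhds.div_atTop tendsto_natCast_atTop_atTop).mono_left
        Nat.hyperfilter_le_atTop) tendsto_const_nhds hlt
    refine le_of_mul_le_mul_left (le_trans (le_of_eq ?_) (h1.trans (le_of_eq ?_))) hn0 <;> ring

end IsConeLift

end BlowUpLimit

/-! ### Orientation of limits of blow-ups -/

section Orientation

theorem ContinuousLinearMap.det_smul {E : Type*} [NormedAddCommGroup E] [NormedSpace ℝ E]
    (c : ℝ) (L : E →L[ℝ] E) : (c • L).det = c ^ Module.finrank ℝ E * L.det :=
  LinearMap.det_smul c (L : E →ₗ[ℝ] E)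

/-- A uniform limit of orientation preserving maps does not reverse the orientation. -/
theorem det_fderiv_nonneg_of_approx {ι : Type*} [Fintype ι] [Nonempty ι]
    {G : EuclideanSpace ℝ ι → EuclideanSpace ℝ ι} {p : EuclideanSpace ℝ ι}
    (hG : DifferentiableAt ℝ G p)
    (h : ∀ δ₀ > 0, ∃ δ > 0, δ ≤ δ₀ ∧ ∀ η > 0,
      ∃ (F : EuclideanSpace ℝ ι → EuclideanSpace ℝ ι) (K : ℝ≥0),
      LipschitzOnWith K F (Metric.ball p δ) ∧ (∀ x ∈ Metric.ball p δ, ‖F x - G x‖ ≤ η) ∧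
      ∀ x ∈ Metric.ball p δ, 0 ≤ (fderiv ℝ F x).det) :
    0 ≤ (fderiv ℝ G p).det := by
  set L := fderiv ℝ G p with hL
  by_contra! hneg
  obtain ⟨c, hc, hcL⟩ := ContinuousLinearMap.exists_le_norm_of_det_ne_zero hneg.ne
  have h1 : ∀ᶠ x in 𝓝 p, ‖G x - G p - L (x - p)‖ ≤ c / 16 * ‖x - p‖ :=
    hG.hasFDerivAt.isLittleO.def (by positivity)
  obtain ⟨δ₀, hδ₀, hball⟩ := Metric.eventually_nhds_iff_ball.1 h1
  obtain ⟨δ, hδ, hδδ₀, hη⟩ := h δ₀ hδ₀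
  obtain ⟨F, K, hFK, hFG, hFdet⟩ := hη (c * δ / 16) (by positivity)
  obtain ⟨F', hF', hFF'⟩ := hFK.extend_finite_dimension
  obtain ⟨H, hH⟩ := exists_isBumpPrimitive (G p) (show 0 < c * δ / 8 by positivity)
  obtain ⟨I, hI, hint⟩ := exists_pos_setIntegral_density_comp_eq volume hF' hc hδ hcL (p := p)
    (y₁ := G p) (fun x hx ↦ by
      rw [← hFF' hx]
      have h2 := hball x (Metric.ball_subset_ball hδδ₀ hx)
      have h3 : ‖x - p‖ ≤ δ := by rw [← dist_eq_norm]; exact (Metric.mem_ball.1 hx).le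
      have h4 : c / 16 * ‖x - p‖ ≤ c * δ / 16 := by
        have := mul_le_mul_of_nonneg_left h3 hc.le
        linarith
      have h5 : F x - (G p + L (x - p)) = (F x - G x) + (G x - G p - L (x - p)) := by abel
      rw [h5]
      exact (norm_add_le _ _).trans (by linarith [hFG x hx])) hH
  have h6 : 0 ≤ ∫ x in Metric.ball p δ, (fderiv ℝ H (F' x)).det * (fderiv ℝ F' x).det := by
    refine setIntegral_nonneg Metric.isOpen_ball.measurableSet fun x hx ↦ ?_
    have h7 : F' =ᶠ[𝓝 x] F := by
      filter_upwards [Metric.isOpen_ball.mem_nhds hx] with y hy using (hFF' hy).symm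
    rw [h7.fderiv_eq]
    exact mul_nonneg (hH.nonneg _) (hFdet x hx)
  rw [hint] at h6
  nlinarith

namespace IsConeLift

variable {k α β : ℝ} {V : Set E4} {m : ℤ} {F : E4 → E4} {T : ℝ} {G : E4 → E4}

theorem det_fderiv_blowUp_nonneg (h : IsConeLift k V α β m F T)
    (hdet : ∀ x ∈ V, DifferentiableAt ℝ F x → 0 < (fderiv ℝ F x).det) {x : E4}
    (hx : x ∈ openCone) {l : ℕ} (hl : 0 < l) (hT : T ≤ basePoint k l 3)
    (hTx : T ≤ ((l : ℝ) • x) 3) : 0 ≤ (fderiv ℝ (blowUp k F l) x).det := by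
  by_cases hd : DifferentiableAt ℝ (blowUp k F l) x
  swap
  · -- the derivative is zero by convention
    rw [fderiv_zero_of_not_differentiableAt hd, ← zero_smul ℝ (0 : E4 →L[ℝ] E4),
      ContinuousLinearMap.det_smul]
    simp
  have hl0 : (0 : ℝ) < l := by exact_mod_cast hl
  have h0 := h.height_map_basePoint_pos hT
  set c := F (basePoint k l) 3 with hc
  set L := fderiv ℝ (blowUp k F l) x with hL
  have h1 : F = fun y ↦ c • blowUp k F l ((l : ℝ)⁻¹ • y) + F (basePoint k l) 2 • vert := by
    funext y
    rw [blowUp, smul_smul, smul_smul, mul_inv_cancel₀ h0.ne', mul_inv_cancel₀ hl0.ne', one_smul,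
      one_smul, sub_add_cancel]
  have h2 : HasFDerivAt F ((c * (l : ℝ)⁻¹) • L) ((l : ℝ) • x) := by
    have h3 : HasFDerivAt (fun y : E4 ↦ (l : ℝ)⁻¹ • y)
        ((l : ℝ)⁻¹ • ContinuousLinearMap.id ℝ E4) ((l : ℝ) • x) :=
      ((l : ℝ)⁻¹ • ContinuousLinearMap.id ℝ E4).hasFDerivAt
    have h4 : HasFDerivAt (blowUp k F l) L ((l : ℝ)⁻¹ • (l : ℝ) • x) := by
      rw [smul_smul, inv_mul_cancel₀ hl0.ne', one_smul]
      exact hd.hasFDerivAt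
    have h5 := ((h4.comp _ h3).const_smul c).add_const (F (basePoint k l) 2 • vert)
    have h6 : c • L.comp ((l : ℝ)⁻¹ • ContinuousLinearMap.id ℝ E4) = (c * (l : ℝ)⁻¹) • L := by
      ext v
      simp [mul_smul]
    rw [h6] at h5
    rw [h1]
    exact h5
  have h7 := hdet _ (h.mem_of_le _ hTx (radSq_smul_le hx l)) h2.differentiableAt
  rw [h2.fderiv, ContinuousLinearMap.det_smul] at h7
  exact (pos_of_mul_pos_right h7 (by positivity)).le

/-- Near each point of the cone the blow-ups are uniformly Lipschitz. -/
theorem exists_lipschitzOnWith_blowUp (h : IsConeLift k V α β m F T)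
    (hG : ∀ x ∈ openCone, Tendsto (fun l ↦ blowUp k F l x) (hyperfilter ℕ : Filter ℕ) (𝓝 (G x)))
    {x : E4} (hx : x ∈ openCone) :
    ∃ δ > 0, ∃ C : ℝ≥0, Metric.closedBall x δ ⊆ openCone ∧
      ∀ᶠ l : ℕ in (hyperfilter ℕ : Filter ℕ), (0 < l ∧ T ≤ basePoint k l 3 ∧
        ∀ y ∈ Metric.closedBall x δ, T ≤ ((l : ℝ) • y) 3) ∧
        LipschitzOnWith C (blowUp k F l) (Metric.closedBall x δ) := by
  have hk0 : 0 < k := zero_lt_one.trans_le h.one_le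
  have hk1 := h.one_le
  have hx3 := hx.1
  have hGx := h.limit_pos hG hx
  obtain ⟨δ', hδ', hball⟩ := Metric.nhds_basis_closedBall.mem_iff.1 (isOpen_openCone.mem_nhds hx)
  set μ := x 3 / 2 with hμ
  have hμ0 : 0 < μ := by positivity
  set δ := min δ' (μ / (2 * k)) with hδ
  have hδ0 : 0 < δ := by positivity
  have hδ1 : k * (2 * δ / μ) ≤ 1 := by
    have : δ ≤ μ / (2 * k) := min_le_right _ _
    rw [le_div_iff₀ (by positivity)] at this
    rw [mul_div_assoc', div_le_one hμ0]
    linarith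
  have hδμ : δ ≤ μ := by
    refine (min_le_right _ _).trans (div_le_self hμ0.le (by linarith))
  have hsub : Metric.closedBall x δ ⊆ openCone :=
    (Metric.closedBall_subset_closedBall (min_le_left _ _)).trans hball
  have hheight : ∀ y ∈ Metric.closedBall x δ, μ ≤ y 3 := by
    intro y hy
    have h1 := (abs_apply_le_norm (y - x) 3).trans
      ((dist_eq_norm y x).symm.le.trans (Metric.mem_closedBall.1 hy))
    rw [PiLp.sub_apply, abs_le] at h1
    linarith [h1.1]
  set C : ℝ := (G x 3 + 1) * 3 * (2 * (k / μ)) with hC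
  refine ⟨δ, hδ0, C.toNNReal, hsub, ?_⟩
  have hev1 : Tendsto (fun l : ℕ ↦ (l : ℝ) * μ) atTop atTop :=
    tendsto_natCast_atTop_atTop.atTop_mul_const hμ0
  have hev2 : ∀ᶠ l in (hyperfilter ℕ : Filter ℕ), blowUp k F l x 3 < G x 3 + 1 :=
    ((continuous_height.tendsto _).comp (hG x hx)).eventually (gt_mem_nhds (lt_add_one _))
  filter_upwards [h.eventually_le_basePoint.filter_mono Nat.hyperfilter_le_atTop,
    (hev1.eventually_ge_atTop T).filter_mono Nat.hyperfilter_le_atTop, hev2] with l hl hlμ hlG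
  obtain ⟨hl0, hT⟩ := hl
  have hTy : ∀ y ∈ Metric.closedBall x δ, T ≤ ((l : ℝ) • y) 3 := fun y hy ↦ by
    refine hlμ.trans ?_
    simpa using mul_le_mul_of_nonneg_left (hheight y hy) (Nat.cast_nonneg l)
  refine ⟨⟨hl0, hT, hTy⟩, LipschitzOnWith.of_dist_le_mul fun y hy z hz ↦ ?_⟩
  have hxb : x ∈ Metric.closedBall x δ := Metric.mem_closedBall_self hδ0.le
  have hsmall : ∀ y ∈ Metric.closedBall x δ, ∀ z ∈ Metric.closedBall x δ,
      k * (‖y - z‖ / μ) ≤ 1 := by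
    intro y hy z hz
    refine le_trans ?_ hδ1
    gcongr
    rw [← dist_eq_norm]
    linarith [dist_triangle_right y z x, Metric.mem_closedBall.1 hy, Metric.mem_closedBall.1 hz]
  have h1 := h.norm_blowUp_sub_le (hsub hy) (hsub hz) hl0 hT (hTy y hy) (hTy z hz) hμ0
    (hheight y hy) (hheight z hz)
  have h2 := exp_sub_one_le_two_mul (show 0 ≤ k * (‖y - z‖ / μ) by positivity)
    (hsmall y hy z hz)
  have hx0 := h.blowUp_pos (hsub hxb) hT (hTy x hxb)
  have hy0 := h.blowUp_pos (hsub hy) hT (hTy y hy)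
  have h3 : blowUp k F l y 3 ≤ (G x 3 + 1) * 3 := by
    have h4 := height_le_mul_exp hx0 hy0
    have h5 := h.upperDist_blowUp_le (hsub hxb) (hsub hy) hl0 hT (hTy x hxb) (hTy y hy) hμ0
      (hheight x hxb) (hheight y hy)
    have h6 : Real.exp (upperDist (blowUp k F l x) (blowUp k F l y)) ≤ 3 := by
      have := Real.exp_le_exp.2 (h5.trans (hsmall x hxb y hy))
      linarith [Real.exp_one_lt_d9]
    exact h4.trans (mul_le_mul hlG.le h6 (Real.exp_pos _).le (by positivity))
  rw [dist_eq_norm, dist_eq_norm, Real.coe_toNNReal _ (by positivity)]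
  calc ‖blowUp k F l y - blowUp k F l z‖
      ≤ (G x 3 + 1) * 3 * (2 * (k * (‖y - z‖ / μ))) :=
        h1.trans (mul_le_mul h3 h2 (by linarith [Real.one_le_exp (show
          0 ≤ k * (‖y - z‖ / μ) by positivity)]) (by positivity))
    _ = C * ‖y - z‖ := by rw [hC]; ring

/-- Pointwise convergence of the blow-ups is uniform near each point, as they are uniformly
Lipschitz there, so the orientation passes to the limit. -/
theorem limit_det_nonneg (h : IsConeLift k V α β m F T)
    (hdet : ∀ x ∈ V, DifferentiableAt ℝ F x → 0 < (fderiv ℝ F x).det)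
    (hG : ∀ x ∈ openCone, Tendsto (fun l ↦ blowUp k F l x) (hyperfilter ℕ : Filter ℕ) (𝓝 (G x)))
    {x : E4} (hx : x ∈ openCone) (hd : DifferentiableAt ℝ G x) : 0 ≤ (fderiv ℝ G x).det := by
  obtain ⟨δ₂, hδ₂, C, hsub, hev⟩ := h.exists_lipschitzOnWith_blowUp hG hx
  refine det_fderiv_nonneg_of_approx hd fun δ₀ hδ₀ ↦ ⟨min δ₀ δ₂, lt_min hδ₀ hδ₂,
    min_le_left _ _, fun η hη ↦ ?_⟩
  have hb : Metric.ball x (min δ₀ δ₂) ⊆ Metric.closedBall x δ₂ :=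
    Metric.ball_subset_closedBall.trans
      (Metric.closedBall_subset_closedBall (min_le_right _ _))
  obtain ⟨l, ⟨⟨hl0, hT, hTy⟩, hL⟩, hlG⟩ := (hev.and (eventually_forall_norm_sub_le
    (isCompact_closedBall x δ₂) (hev.mono fun l hl ↦ hl.2) (fun y hy ↦ hG y (hsub hy)) hη)).exists
  exact ⟨blowUp k F l, C, hL.mono hb, fun y hy ↦ hlG y (hb hy), fun y hy ↦
    h.det_fderiv_blowUp_nonneg hdet (hsub (hb hy)) hl0 hT (hTy y (hb hy))⟩

end IsConeLift

end Orientation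

/-! ### A degree argument in the plane -/

section PlanarDegree

/-- The sector `0 < r < t` of the plane with coordinates `(r, t)`. -/
def sector : Set (EuclideanSpace ℝ (Fin 2)) := {v | 0 < v 0 ∧ v 0 < v 1}

theorem isOpen_sector : IsOpen sector := by
  have h1 : IsOpen {v : EuclideanSpace ℝ (Fin 2) | 0 < v 0} :=
    isOpen_lt continuous_const (by fun_prop)
  have h2 : IsOpen {v : EuclideanSpace ℝ (Fin 2) | v 0 < v 1} :=
    isOpen_lt (by fun_prop) (by fun_prop)
  exact h1.inter h2

/-- The rectangle `[a, b] × [c, d]`. -/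
def rect (a b c d : ℝ) : Set (EuclideanSpace ℝ (Fin 2)) :=
  {v | v 0 ∈ Icc a b ∧ v 1 ∈ Icc c d}

theorem convex_rect (a b c d : ℝ) : Convex ℝ (rect a b c d) :=
  ((convex_Icc a b).is_linear_preimage (f := fun v : EuclideanSpace ℝ (Fin 2) ↦ v 0)
      ⟨fun _ _ ↦ rfl, fun _ _ ↦ rfl⟩).inter
    ((convex_Icc c d).is_linear_preimage (f := fun v : EuclideanSpace ℝ (Fin 2) ↦ v 1)
      ⟨fun _ _ ↦ rfl, fun _ _ ↦ rfl⟩)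

theorem isCompact_rect (a b c d : ℝ) : IsCompact (rect a b c d) := by
  refine Metric.isCompact_of_isClosed_isBounded ?_ ?_
  · have h1 : IsClosed {v : EuclideanSpace ℝ (Fin 2) | v 0 ∈ Icc a b} :=
      isClosed_Icc.preimage (by fun_prop)
    exact h1.inter (isClosed_Icc.preimage (by fun_prop))
  · refine (Metric.isBounded_closedBall (x := 0)
      (r := √((|a| + |b|) ^ 2 + (|c| + |d|) ^ 2))).subset ?_
    rintro v ⟨⟨h1, h2⟩, h3, h4⟩
    rw [mem_closedBall_zero_iff]
    refine Real.le_sqrt_of_sq_le ?_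
    rw [EuclideanSpace.norm_sq_eq, Fin.sum_univ_two, Real.norm_eq_abs, Real.norm_eq_abs]
    have h5 : |v 0| ≤ |a| + |b| := abs_le.2
      ⟨by linarith [neg_abs_le a, abs_nonneg b], by linarith [le_abs_self b, abs_nonneg a]⟩
    have h6 : |v 1| ≤ |c| + |d| := abs_le.2
      ⟨by linarith [neg_abs_le c, abs_nonneg d], by linarith [le_abs_self d, abs_nonneg c]⟩
    exact add_le_add (pow_le_pow_left₀ (abs_nonneg _) h5 2)
      (pow_le_pow_left₀ (abs_nonneg _) h6 2)

theorem exists_lipschitz_cutoff_thickening {E : Type*} [PseudoMetricSpace E] {D : Set E}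
    (hD : D.Nonempty) {η : ℝ} (hη : 0 < η) :
    ∃ (χ : E → ℝ) (K : ℝ≥0), LipschitzWith K χ ∧ (∀ x, χ x ∈ Icc (0 : ℝ) 1) ∧
      (∀ x ∈ Metric.thickening (η / 2) D, χ x = 1) ∧ ∀ x, x ∉ Metric.thickening η D → χ x = 0 := by
  refine ⟨fun x ↦ max 0 (min 1 (2 - 2 / η * Metric.infDist x D)), (2 / η).toNNReal, ?_, ?_, ?_, ?_⟩
  · have h1 : LipschitzWith (2 / η).toNNReal fun x ↦ 2 - 2 / η * Metric.infDist x D := by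
      refine LipschitzWith.of_dist_le_mul fun x y ↦ ?_
      have h2 := (Metric.lipschitz_infDist_pt D).dist_le_mul x y
      rw [Real.dist_eq] at h2 ⊢
      rw [show 2 - 2 / η * Metric.infDist x D - (2 - 2 / η * Metric.infDist y D)
        = -(2 / η * (Metric.infDist x D - Metric.infDist y D)) by ring, abs_neg, abs_mul,
        abs_of_pos (by positivity), Real.coe_toNNReal _ (by positivity)]
      exact mul_le_mul_of_nonneg_left (by simpa using h2) (by positivity)
    exact (h1.const_min 1).const_max 0
  · intro x
    exact ⟨le_max_left _ _, max_le zero_le_one (min_le_left _ _)⟩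
  · intro x hx
    have h1 := (Metric.mem_thickening_iff_infDist_lt hD).1 hx
    have h2 : 2 / η * Metric.infDist x D ≤ 1 := by
      calc 2 / η * Metric.infDist x D ≤ 2 / η * (η / 2) :=
            mul_le_mul_of_nonneg_left h1.le (by positivity)
        _ = 1 := by field_simp
    have h3 : 1 ≤ 2 - 2 / η * Metric.infDist x D := by linarith
    simp [min_eq_left h3]
  · intro x hx
    have h1 := not_lt.1 (mt (Metric.mem_thickening_iff_infDist_lt hD).2 hx)
    have h2 : 2 ≤ 2 / η * Metric.infDist x D := by
      calc 2 = 2 / η * η := by field_simp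
        _ ≤ 2 / η * Metric.infDist x D := mul_le_mul_of_nonneg_left h1 (by positivity)
    exact max_eq_left ((min_le_right _ _).trans (by linarith))

/-- If `y` is comparable to `x²` and a convex combination of `x` and `y` is close to `1`, then `x`
is bounded, and bounded away from zero. -/
theorem mem_Icc_of_interpolation_sq {a b c x y : ℝ} (ha : 0 < a) (ha1 : a ≤ 1) (hb : 1 ≤ b)
    (hc : c ∈ Icc (0 : ℝ) 1) (hx : 0 < x) (hy : a * x ^ 2 ≤ y ∧ y ≤ b * x ^ 2)
    (h : |(1 - c) * x + c * y - 1| < 1 / 2) : x ∈ Icc (1 / (2 * b)) (2 / a) := by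
  obtain ⟨c0, c1⟩ := hc
  obtain ⟨h1, h2⟩ := abs_lt.1 h
  constructor
  · by_contra! hlt
    rw [lt_div_iff₀ (by positivity)] at hlt
    have h3 : x < 1 / 2 := by nlinarith
    have h4 : y < 1 / 2 := by nlinarith
    have h5 := mul_le_mul_of_nonneg_left h3.le (sub_nonneg.2 c1)
    have h6 := mul_le_mul_of_nonneg_left h4.le c0
    linarith
  · by_contra! hlt
    rw [div_lt_iff₀ ha] at hlt
    have h4 : 2 < x := by nlinarith
    have h5 : x < y := by nlinarith
    have h6 := mul_le_mul_of_nonneg_left h5.le c0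
    linarith

theorem mem_Icc_of_interpolation {a b c x y t : ℝ} (ha : 0 < a) (ha1 : a ≤ 1) (hb : 1 ≤ b)
    (hc : c ∈ Icc (0 : ℝ) 1) (hx : 0 < x) (hy : a * x ≤ y ∧ y ≤ b * x)
    (h : |(1 - c) * x + c * y - t| < 1 / 2) : x ∈ Icc ((t - 1 / 2) / b) ((t + 1 / 2) / a) := by
  obtain ⟨c0, c1⟩ := hc
  obtain ⟨h1, h2⟩ := abs_lt.1 h
  have hb0 : 0 < b := by linarith
  constructor
  · rw [div_le_iff₀ hb0]
    have h3 : x ≤ b * x := by nlinarith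
    linarith [mul_le_mul_of_nonneg_left h3 (sub_nonneg.2 c1), mul_le_mul_of_nonneg_left hy.2 c0]
  · rw [le_div_iff₀ ha]
    have h3 : a * x ≤ x := by nlinarith
    linarith [mul_le_mul_of_nonneg_left h3 (sub_nonneg.2 c1), mul_le_mul_of_nonneg_left hy.1 c0]

/-- A self-map of the sector that is comparable to `(r, t) ↦ (r², t)` has degree one, so its
Jacobian determinant cannot be negative everywhere: interpolating between the map and the identity,
one gets a map that is the identity outside a compact set, and that agrees with the given map
wherever it takes values close to a point `(1, t₀)` with `t₀` large. -/
theorem not_forall_det_fderiv_nonpos {φ : EuclideanSpace ℝ (Fin 2) → EuclideanSpace ℝ (Fin 2)}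
    {a b : ℝ} (ha : 0 < a) (ha1 : a ≤ 1) (hb1 : 1 ≤ b)
    (hφ0 : ∀ v ∈ sector, a * v 0 ^ 2 ≤ φ v 0 ∧ φ v 0 ≤ b * v 0 ^ 2)
    (hφ1 : ∀ v ∈ sector, a * v 1 ≤ φ v 1 ∧ φ v 1 ≤ b * v 1)
    (hφ : ∀ D ⊆ sector, IsCompact D → Convex ℝ D → ∃ C : ℝ≥0, LipschitzOnWith C φ D)
    (hdet : ∀ D ⊆ sector, IsCompact D → Convex ℝ D →
      ∀ᵐ v, v ∈ interior D → (fderiv ℝ φ v).det ≤ 0) : False := by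
  have hb : 0 < b := by linarith
  -- the preimages of points close to `(1, t₀)` lie in the rectangle `D`, which is contained in the
  -- sector because `t₀` is large
  set t₀ : ℝ := 2 * b / a + 1 with ht₀
  have h2ba : 2 ≤ 2 * b / a := by rw [le_div_iff₀ ha]; nlinarith
  set D := rect (1 / (2 * b)) (2 / a) ((t₀ - 1 / 2) / b) ((t₀ + 1 / 2) / a) with hD
  have hDs : D ⊆ sector := by
    rintro v ⟨⟨h1, h2⟩, h3, h4⟩
    refine ⟨lt_of_lt_of_le (by positivity) h1, h2.trans_lt (lt_of_lt_of_le ?_ h3)⟩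
    rw [lt_div_iff₀ hb, ht₀]
    have : 2 / a * b = 2 * b / a := by ring
    linarith
  have hDc : IsCompact D := isCompact_rect _ _ _ _
  have hD0 : D.Nonempty := by
    refine ⟨!₂[1, t₀], ⟨?_, ?_⟩, ?_, ?_⟩
    · change 1 / (2 * b) ≤ 1
      rw [div_le_one (by positivity)]; linarith
    · change 1 ≤ 2 / a
      rw [le_div_iff₀ ha]; linarith
    · change (t₀ - 1 / 2) / b ≤ t₀
      rw [div_le_iff₀ hb]; nlinarith
    · change t₀ ≤ (t₀ + 1 / 2) / a
      rw [le_div_iff₀ ha]; nlinarith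
  obtain ⟨η, hη, hηs⟩ := hDc.exists_cthickening_subset_open isOpen_sector hDs
  have hthick := Metric.thickening_subset_cthickening η D
  set D' := Metric.cthickening η D with hD'
  have hD'c : IsCompact D' := hDc.cthickening
  have hD'v : Convex ℝ D' := (convex_rect _ _ _ _).cthickening η
  obtain ⟨C, hC⟩ := hφ D' hηs hD'c hD'v
  obtain ⟨Φ, hΦ, hφΦ⟩ := hC.extend_finite_dimension
  obtain ⟨χ, Kχ, hχ, h01, h1, h0⟩ := exists_lipschitz_cutoff_thickening hD0 hη
  set p : EuclideanSpace ℝ (Fin 2) := !₂[1, t₀] with hp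
  obtain ⟨R', hR'⟩ := hD'c.isBounded.subset_ball p
  set R := max R' 4 with hR
  have hD'R : D' ⊆ Metric.ball p R := hR'.trans (Metric.ball_subset_ball (le_max_left _ _))
  obtain ⟨K, hK⟩ := hχ.exists_cutoff_smul h01
    (fun x hx ↦ h0 x fun h ↦ hx (hD'R (hthick h))) (hΦ.sub LipschitzWith.id)
  set A : EuclideanSpace ℝ (Fin 2) → EuclideanSpace ℝ (Fin 2) :=
    fun v ↦ v + χ v • (Φ v - v) with hA
  have hAL := LipschitzWith.id.add hK
  change LipschitzWith _ A at hAL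
  have hAid : ∀ v, v ∉ Metric.ball p R → A v = id v := by
    intro v hv
    rw [hA]
    simp [h0 v fun h ↦ hv (hD'R (hthick h))]
  obtain ⟨H, hH⟩ := exists_isBumpPrimitive p (show (0 : ℝ) < 1 * 4 / 8 by norm_num)
  obtain ⟨CH, hCH⟩ := hH.lipschitz
  have hmain := integral_density_comp_sub_eq_zero volume hH.contDiff hCH hAL LipschitzWith.id hAid
  obtain ⟨I, hI, hint⟩ := exists_pos_setIntegral_density_comp_eq volume
    (LipschitzWith.id (α := EuclideanSpace ℝ (Fin 2))) (L := ContinuousLinearMap.id ℝ _) one_pos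
    (show (0 : ℝ) < 4 by norm_num) (fun v ↦ by simp) (p := p) (y₁ := p)
    (fun x _ ↦ by simp; norm_num) hH
  -- points that the interpolation maps close to `p` lie in the rectangle
  have hclose : ∀ v, A v ∈ Metric.ball p (1 * 4 / 8) → v ∈ D := by
    intro v hv
    have hcoord : ∀ i, |A v i - p i| < 1 / 2 := fun i ↦ by
      have h2 : ‖(A v - p) i‖ ≤ ‖A v - p‖ := PiLp.norm_apply_le _ i
      rw [Metric.mem_ball, dist_eq_norm] at hv
      rw [PiLp.sub_apply, Real.norm_eq_abs] at h2
      exact h2.trans_lt (by linarith)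
    have e0 : |A v 0 - 1| < 1 / 2 := hcoord 0
    have e1 : |A v 1 - t₀| < 1 / 2 := hcoord 1
    by_cases hvs : v ∈ Metric.thickening η D
    · have hvD' := hthick hvs
      obtain ⟨hv0, hv1⟩ := hηs hvD'
      have eA : ∀ i, A v i = (1 - χ v) * v i + χ v * φ v i := fun i ↦ by
        rw [hA, hφΦ hvD']
        simp
        ring
      rw [eA] at e0 e1
      exact ⟨mem_Icc_of_interpolation_sq ha ha1 hb1 (h01 v) hv0 (hφ0 v (hηs hvD')) e0,
        mem_Icc_of_interpolation ha ha1 hb1 (h01 v) (hv0.trans hv1) (hφ1 v (hηs hvD')) e1⟩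
    · have eA : ∀ i, A v i = v i := fun i ↦ by simp [hA, h0 v hvs]
      rw [eA] at e0 e1
      have hv0 : 0 < v 0 := by linarith [(abs_lt.1 e0).1]
      have hv1 : 0 < v 1 := by linarith [(abs_lt.1 e1).1]
      exact ⟨mem_Icc_of_interpolation_sq (c := 0) (y := v 0 ^ 2) ha ha1 hb1
          ⟨le_rfl, zero_le_one⟩ hv0
          ⟨by nlinarith [sq_nonneg (v 0)], by nlinarith [sq_nonneg (v 0)]⟩ (by simpa using e0),
        mem_Icc_of_interpolation (c := 0) (y := v 1) ha ha1 hb1 ⟨le_rfl, zero_le_one⟩ hv1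
          ⟨by nlinarith, by nlinarith⟩ (by simpa using e1)⟩
  have hneg : ∀ᵐ v, (fderiv ℝ H (A v)).det * (fderiv ℝ A v).det ≤ 0 := by
    filter_upwards [hdet D' hηs hD'c hD'v] with v hv
    by_cases hvp : A v ∈ Metric.ball p (1 * 4 / 8)
    · have hvD := hclose v hvp
      have hmem : Metric.thickening (η / 2) D ∈ 𝓝 v :=
        Metric.isOpen_thickening.mem_nhds (Metric.self_subset_thickening (by positivity) D hvD)
      have hsub : Metric.thickening (η / 2) D ⊆ D' :=
        (Metric.thickening_mono (by linarith) D).trans hthick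
      have hAφ : A =ᶠ[𝓝 v] φ := by
        filter_upwards [hmem] with w hw
        rw [hA]
        simp [h1 w hw, hφΦ (hsub hw)]
      rw [hAφ.fderiv_eq]
      exact mul_nonpos_of_nonneg_of_nonpos (hH.nonneg _)
        (hv (mem_interior_iff_mem_nhds.2 (mem_of_superset hmem hsub)))
    · rw [hH.eq_zero _ hvp, zero_mul]
  set B := Metric.closedBall p R with hB
  have hBfin : volume B < ⊤ := (isCompact_closedBall p R).measure_lt_top
  have hzero : ∀ v, v ∉ B → (fderiv ℝ H (A v)).det * (fderiv ℝ A v).det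
      - (fderiv ℝ H (id v)).det * (fderiv ℝ id v).det = 0 := by
    intro v hv
    have h3 : A =ᶠ[𝓝 v] id := by
      filter_upwards [Metric.isClosed_closedBall.isOpen_compl.mem_nhds hv] with w hw
      exact hAid w fun h ↦ hw (Metric.ball_subset_closedBall h)
    rw [h3.fderiv_eq, h3.eq_of_nhds, sub_self]
  rw [← setIntegral_eq_integral_of_forall_compl_eq_zero hzero,
    integral_sub (integrableOn_density_comp volume hH.contDiff hCH hAL hBfin)
      (integrableOn_density_comp volume hH.contDiff hCH LipschitzWith.id hBfin)] at hmain
  have h3 : ∫ v in B, (fderiv ℝ H (A v)).det * (fderiv ℝ A v).det ≤ 0 :=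
    integral_nonpos_of_ae (ae_restrict_of_ae hneg)
  have h5 : (ContinuousLinearMap.id ℝ (EuclideanSpace ℝ (Fin 2))).det = 1 := LinearMap.det_id
  have h4 : ∫ v in Metric.ball p 4, (fderiv ℝ H (id v)).det * (fderiv ℝ id v).det
      ≤ ∫ v in B, (fderiv ℝ H (id v)).det * (fderiv ℝ id v).det := by
    refine setIntegral_mono_set
      (integrableOn_density_comp volume hH.contDiff hCH LipschitzWith.id hBfin)
      (Eventually.of_forall fun v ↦ ?_)
      (Metric.ball_subset_closedBall.trans
        (Metric.closedBall_subset_closedBall (le_max_right _ _))).eventuallyLE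
    simp only [fderiv_id, Pi.zero_apply]
    exact mul_nonneg (hH.nonneg _) (h5.symm ▸ zero_le_one)
  rw [hint] at h4
  rw [h5, mul_one] at h4
  linarith

end PlanarDegree

/-! ### The sign of the Jacobian determinant of a limit of blow-ups -/

section ConeLimit

/-- Polar coordinates, with the angle in full turns. -/
theorem exists_cos_sin_eq {x y : ℝ} (h : 0 < x ^ 2 + y ^ 2) : ∃ a : ℝ,
    Real.cos (2 * Real.pi * a) = x / √(x ^ 2 + y ^ 2) ∧
      Real.sin (2 * Real.pi * a) = y / √(x ^ 2 + y ^ 2) := by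
  have hz : (⟨x, y⟩ : ℂ) ≠ 0 := by
    intro h0
    have h1 := congrArg Complex.re h0
    have h2 := congrArg Complex.im h0
    simp only [Complex.zero_re, Complex.zero_im] at h1 h2
    rw [h1, h2] at h
    simp at h
  refine ⟨Complex.arg ⟨x, y⟩ / (2 * Real.pi), ?_, ?_⟩
  · rw [mul_div_cancel₀ _ (by positivity), Complex.cos_arg hz, Complex.norm_eq_sqrt_sq_add_sq]
  · rw [mul_div_cancel₀ _ (by positivity), Complex.sin_arg, Complex.norm_eq_sqrt_sq_add_sq]

namespace IsConeLimit

variable {k c : ℝ} {s : ℤ} {G : E4 → E4}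

/-- By equivariance, `G` is determined by its values in the half-plane `θ = 0`, `z = 0`. -/
theorem eq_of_radSq_pos (hG : IsConeLimit k s c G) (hs : s = 1 ∨ s = -1) {x : E4}
    (hx : x ∈ openCone) (hr : 0 < radSq x) :
    G x = !₂[x 0 / √(radSq x) * G (cyl √(radSq x) (x 3)) 0
        - s * (x 1 / √(radSq x)) * G (cyl √(radSq x) (x 3)) 1,
      s * (x 1 / √(radSq x)) * G (cyl √(radSq x) (x 3)) 0
        + x 0 / √(radSq x) * G (cyl √(radSq x) (x 3)) 1,
      G (cyl √(radSq x) (x 3)) 2 + c * x 2, G (cyl √(radSq x) (x 3)) 3] := by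
  obtain ⟨a, hcos, hsin⟩ := exists_cos_sin_eq (x := x 0) (y := x 1) hr
  have hρ : 0 < √(radSq x) := Real.sqrt_pos.2 hr
  change _ = x 0 / √(radSq x) at hcos
  change _ = x 1 / √(radSq x) at hsin
  set ρ := √(radSq x) with hρ'
  have hxs : x = scr a (x 2) (cyl ρ (x 3)) := by
    apply E4.ext <;> simp [hcos, hsin, hρ.ne']
  have hcyl : cyl ρ (x 3) ∈ openCone := by
    refine ⟨hx.1, ?_⟩
    rw [radSq_cyl, hρ', Real.sq_sqrt hr.le]
    exact hx.2
  have hcos' : Real.cos (2 * Real.pi * (s * a)) = x 0 / ρ := by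
    rw [← hcos]
    rcases hs with rfl | rfl <;> simp
  have hsin' : Real.sin (2 * Real.pi * (s * a)) = s * (x 1 / ρ) := by
    rw [← hsin]
    rcases hs with rfl | rfl <;> simp
  have h1 := hG.equivariant _ hcyl a (x 2)
  rw [← hxs] at h1
  rw [h1]
  apply E4.ext <;> simp [hcos', hsin']

theorem hasFDerivAt_sqrt_radSq {r t : ℝ} (hr : 0 < r) :
    HasFDerivAt (fun x : E4 ↦ √(radSq x)) (EuclideanSpace.proj 0 : E4 →L[ℝ] ℝ) (cyl r t) := by
  have hp : ∀ i, HasFDerivAt (fun x : E4 ↦ x i) (EuclideanSpace.proj i : E4 →L[ℝ] ℝ) (cyl r t) :=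
    fun i ↦ (EuclideanSpace.proj i : E4 →L[ℝ] ℝ).hasFDerivAt
  have h1 := (((hp 0).pow 2).add ((hp 1).pow 2)).sqrt (x := cyl r t) (by simp [hr.ne'])
  refine (h1.congr_fderiv ?_)
  ext v
  simp [Real.sqrt_sq hr.le]
  field_simp

/-- The map of the sector that `G` induces; the first coordinate is the square `r²` of the radius,
which is a smooth function on `ℝ⁴`. -/
noncomputable def planar (G : E4 → E4) (v : EuclideanSpace ℝ (Fin 2)) :
    EuclideanSpace ℝ (Fin 2) :=
  !₂[radSq (G (cyl (v 0) (v 1))), G (cyl (v 0) (v 1)) 3]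

/-- The Jacobian determinant of `G` in the half-plane `θ = 0`, `z = 0`. The derivatives in the
directions of `θ` and `z` are known from the equivariance, and contribute the factors `s` and `c`;
the factor `2 r` comes from the circumference of the circles of radius `r` and from the use of `r²`
in the definition of `planar`. -/
theorem det_fderiv_eq (hG : IsConeLimit k s c G) (hs : s = 1 ∨ s = -1)
    {v : EuclideanSpace ℝ (Fin 2)} (hv : v ∈ sector)
    (hd : DifferentiableAt ℝ (fun w : EuclideanSpace ℝ (Fin 2) ↦ G (cyl (w 0) (w 1))) v) :
    DifferentiableAt ℝ G (cyl (v 0) (v 1)) ∧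
      2 * v 0 * (fderiv ℝ G (cyl (v 0) (v 1))).det = s * c * (fderiv ℝ (planar G) v).det := by
  obtain ⟨hr, hrt⟩ := hv
  set r := v 0 with hrdef
  set t := v 1 with htdef
  set p := cyl r t with hp
  set Y : EuclideanSpace ℝ (Fin 2) → E4 := fun w ↦ G (cyl (w 0) (w 1)) with hY
  set Y' := fderiv ℝ Y v with hY'
  have hYd : HasFDerivAt Y Y' v := hd.hasFDerivAt
  have hYi : ∀ i, HasFDerivAt (fun w ↦ Y w i) ((EuclideanSpace.proj i : E4 →L[ℝ] ℝ).comp Y') v :=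
    fun i ↦ (EuclideanSpace.proj i : E4 →L[ℝ] ℝ).hasFDerivAt.comp v hYd
  have hpr : ∀ i, HasFDerivAt (fun x : E4 ↦ x i) (EuclideanSpace.proj i : E4 →L[ℝ] ℝ) p :=
    fun i ↦ (EuclideanSpace.proj i : E4 →L[ℝ] ℝ).hasFDerivAt
  have hρ := hasFDerivAt_sqrt_radSq (t := t) hr
  have hρp : √(radSq p) = r := by rw [hp, radSq_cyl, Real.sqrt_sq hr.le]
  -- the cylindrical coordinates `(r, t)` as a map of `ℝ⁴` to the plane
  set u' : E4 →L[ℝ] EuclideanSpace ℝ (Fin 2) :=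
    (EuclideanSpace.equiv (Fin 2) ℝ).symm.toContinuousLinearMap.comp
      (ContinuousLinearMap.pi ![EuclideanSpace.proj 0, EuclideanSpace.proj 3]) with hu'
  have hu : HasFDerivAt (fun x : E4 ↦ (!₂[√(radSq x), x 3] : EuclideanSpace ℝ (Fin 2))) u' p := by
    rw [← hasFDerivWithinAt_univ, hasFDerivWithinAt_euclidean]
    intro i
    rw [hasFDerivWithinAt_univ]
    fin_cases i
    · exact hρ
    · exact hpr 3
  have hup : (!₂[√(radSq p), p 3] : EuclideanSpace ℝ (Fin 2)) = v := by
    ext i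
    fin_cases i
    · exact hρp
    · rfl
  have hYu : ∀ i, HasFDerivAt (fun x : E4 ↦ G (cyl √(radSq x) (x 3)) i)
      (((EuclideanSpace.proj i : E4 →L[ℝ] ℝ).comp Y').comp u') p := by
    intro i
    have h1 : HasFDerivAt (fun w ↦ Y w i) ((EuclideanSpace.proj i : E4 →L[ℝ] ℝ).comp Y')
        (!₂[√(radSq p), p 3] : EuclideanSpace ℝ (Fin 2)) := by rw [hup]; exact hYi i
    exact h1.comp p hu
  have hinv : HasFDerivAt (fun x : E4 ↦ (√(radSq x))⁻¹)
      (-(r ^ 2)⁻¹ • (EuclideanSpace.proj 0 : E4 →L[ℝ] ℝ)) p := by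
    have h1 := (hasDerivAt_inv (𝕜 := ℝ) (x := √(radSq p))
      (by rw [hρp]; exact hr.ne')).comp_hasFDerivAt p hρ
    rw [hρp] at h1
    exact h1
  have hcosd : HasFDerivAt (fun x : E4 ↦ x 0 / √(radSq x)) (0 : E4 →L[ℝ] ℝ) p := by
    refine ((hpr 0).mul hinv).congr_fderiv ?_
    ext w
    have : p 0 = r := rfl
    simp only [this, hρp, add_apply, smul_apply,
      PiLp.proj_apply, smul_eq_mul, zero_apply]
    field_simp
    ring
  have hsind : HasFDerivAt (fun x : E4 ↦ x 1 / √(radSq x))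
      (r⁻¹ • (EuclideanSpace.proj 1 : E4 →L[ℝ] ℝ)) p := by
    refine ((hpr 1).mul hinv).congr_fderiv ?_
    ext w
    have : p 1 = 0 := rfl
    simp [this, hρp]
  have hev : ∀ᶠ x in 𝓝 p, x ∈ openCone ∧ 0 < radSq x := by
    have h1 : Continuous radSq := by unfold radSq; fun_prop
    have h2 : 0 < radSq p := by rw [hp, radSq_cyl]; positivity
    exact (isOpen_openCone.eventually_mem (cyl_mem_openCone hr.le hrt)).and
      (h1.continuousAt.eventually (lt_mem_nhds h2))
  set y := G p with hy
  have hyp : G (cyl √(radSq p) (p 3)) = y := by rw [hρp]; rfl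
  have hc0 : p 0 / √(radSq p) = 1 := by rw [hρp]; exact div_self hr.ne'
  have hs0 : p 1 / √(radSq p) = 0 := by rw [show p 1 = 0 from rfl, zero_div]
  set B : Fin 4 → (E4 →L[ℝ] ℝ) := fun i ↦ ((EuclideanSpace.proj i : E4 →L[ℝ] ℝ).comp Y').comp u'
    with hB
  have hG0 : HasFDerivAt (fun x ↦ G x 0)
      (B 0 - (s * y 1 / r) • (EuclideanSpace.proj 1 : E4 →L[ℝ] ℝ)) p := by
    have h1 := (hcosd.mul (hYu 0)).sub ((hsind.const_mul (s : ℝ)).mul (hYu 1))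
    rw [hyp, hc0, hs0] at h1
    refine (h1.congr_of_eventuallyEq ?_).congr_fderiv ?_
    · filter_upwards [hev] with x hx
      rw [hG.eq_of_radSq_pos hs hx.1 hx.2]
      rfl
    · ext w
      simp [hB]
      ring
  have hG1 : HasFDerivAt (fun x ↦ G x 1)
      (B 1 + (s * y 0 / r) • (EuclideanSpace.proj 1 : E4 →L[ℝ] ℝ)) p := by
    have h1 := ((hsind.const_mul (s : ℝ)).mul (hYu 0)).add (hcosd.mul (hYu 1))
    rw [hyp, hc0, hs0] at h1
    refine (h1.congr_of_eventuallyEq ?_).congr_fderiv ?_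
    · filter_upwards [hev] with x hx
      rw [hG.eq_of_radSq_pos hs hx.1 hx.2]
      rfl
    · ext w
      simp [hB]
      ring
  have hG2 : HasFDerivAt (fun x ↦ G x 2)
      (B 2 + c • (EuclideanSpace.proj 2 : E4 →L[ℝ] ℝ)) p := by
    refine ((hYu 2).add ((hpr 2).const_mul c)).congr_of_eventuallyEq ?_
    filter_upwards [hev] with x hx
    rw [hG.eq_of_radSq_pos hs hx.1 hx.2]
    rfl
  have hG3 : HasFDerivAt (fun x ↦ G x 3) (B 3) p := by
    refine (hYu 3).congr_of_eventuallyEq ?_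
    filter_upwards [hev] with x hx
    rw [hG.eq_of_radSq_pos hs hx.1 hx.2]
    rfl
  have hGd : DifferentiableAt ℝ G p := by
    rw [differentiableAt_euclidean]
    intro i
    fin_cases i
    exacts [hG0.differentiableAt, hG1.differentiableAt, hG2.differentiableAt, hG3.differentiableAt]
  refine ⟨hGd, ?_⟩
  have hentry : ∀ i (L : E4 →L[ℝ] ℝ), HasFDerivAt (fun x ↦ G x i) L p →
      ∀ w, fderiv ℝ G p w i = L w := by
    intro i L hL w
    have h1 : HasFDerivAt (fun x ↦ G x i) ((EuclideanSpace.proj i : E4 →L[ℝ] ℝ).comp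
        (fderiv ℝ G p)) p := (EuclideanSpace.proj i : E4 →L[ℝ] ℝ).hasFDerivAt.comp p hGd.hasFDerivAt
    rw [← h1.unique hL]
    rfl
  have hφ0 : HasFDerivAt (fun w ↦ planar G w 0)
      ((2 * y 0) • (EuclideanSpace.proj 0 : E4 →L[ℝ] ℝ).comp Y'
        + (2 * y 1) • (EuclideanSpace.proj 1 : E4 →L[ℝ] ℝ).comp Y') v := by
    refine (((hYi 0).pow 2).add ((hYi 1).pow 2)).congr_fderiv ?_
    ext w
    simp [hY, hy, hp]
    rfl
  have hφ1 : HasFDerivAt (fun w ↦ planar G w 1)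
      ((EuclideanSpace.proj 3 : E4 →L[ℝ] ℝ).comp Y') v := hYi 3
  have hφd : DifferentiableAt ℝ (planar G) v := by
    rw [differentiableAt_euclidean]
    intro i
    fin_cases i
    exacts [hφ0.differentiableAt, hφ1.differentiableAt]
  have hentry' : ∀ i (L : EuclideanSpace ℝ (Fin 2) →L[ℝ] ℝ),
      HasFDerivAt (fun w ↦ planar G w i) L v → ∀ w, fderiv ℝ (planar G) v w i = L w := by
    intro i L hL w
    have h1 : HasFDerivAt (fun w ↦ planar G w i)
        ((EuclideanSpace.proj i : EuclideanSpace ℝ (Fin 2) →L[ℝ] ℝ).comp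
        (fderiv ℝ (planar G) v)) v :=
      (EuclideanSpace.proj i : EuclideanSpace ℝ (Fin 2) →L[ℝ] ℝ).hasFDerivAt.comp v
        hφd.hasFDerivAt
    rw [← h1.unique hL]
    rfl
  have hu0 : u' (EuclideanSpace.single 0 1) = EuclideanSpace.single 0 1 := by
    ext i; fin_cases i <;> simp [hu']
  have hu1 : u' (EuclideanSpace.single 1 1) = 0 := by
    ext i; fin_cases i <;> simp [hu']
  have hu2 : u' (EuclideanSpace.single 2 1) = 0 := by
    ext i; fin_cases i <;> simp [hu']
  have hu3 : u' (EuclideanSpace.single 3 1) = EuclideanSpace.single 1 1 := by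
    ext i; fin_cases i <;> simp [hu']
  rw [EuclideanSpace.det_eq_det_matrix, EuclideanSpace.det_eq_det_matrix, Matrix.det_fin_two]
  simp only [Matrix.of_apply, hentry' 0 _ hφ0, hentry' 1 _ hφ1]
  have hM : (Matrix.of fun i j ↦ fderiv ℝ G p (EuclideanSpace.single j 1) i)
      = !![Y' (EuclideanSpace.single 0 1) 0, -(s * y 1 / r), 0, Y' (EuclideanSpace.single 1 1) 0;
          Y' (EuclideanSpace.single 0 1) 1, s * y 0 / r, 0, Y' (EuclideanSpace.single 1 1) 1;
          Y' (EuclideanSpace.single 0 1) 2, 0, c, Y' (EuclideanSpace.single 1 1) 2;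
          Y' (EuclideanSpace.single 0 1) 3, 0, 0, Y' (EuclideanSpace.single 1 1) 3] := by
    ext i j
    fin_cases i <;> fin_cases j <;>
      simp [hentry 0 _ hG0, hentry 1 _ hG1, hentry 2 _ hG2, hentry 3 _ hG3, hB, hu0, hu1, hu2, hu3]
  rw [hM]
  simp [Matrix.det_succ_row_zero, Fin.sum_univ_succ, Fin.succAbove]
  field_simp
  ring

theorem norm_cyl_sub_cyl (v w : EuclideanSpace ℝ (Fin 2)) :
    ‖cyl (v 0) (v 1) - cyl (w 0) (w 1)‖ = ‖v - w‖ := by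
  refine (sq_eq_sq₀ (norm_nonneg _) (norm_nonneg _)).1 ?_
  rw [E4.norm_sq, EuclideanSpace.norm_sq_eq, Fin.sum_univ_two]
  simp

theorem exists_lipschitzOnWith_cyl (hG : IsConeLimit k s c G) (hk : 0 ≤ k)
    {D : Set (EuclideanSpace ℝ (Fin 2))} (hD : D ⊆ sector) (hDc : IsCompact D) :
    ∃ C : ℝ≥0, LipschitzOnWith C
      (fun w : EuclideanSpace ℝ (Fin 2) ↦ G (cyl (w 0) (w 1))) D := by
  rcases D.eq_empty_or_nonempty with rfl | hne
  · exact ⟨0, lipschitzOnWith_empty _ _⟩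
  obtain ⟨v₀, hv₀, hmin⟩ := hDc.exists_isMinOn hne
    (f := fun v : EuclideanSpace ℝ (Fin 2) ↦ v 1) (by fun_prop)
  obtain ⟨M, hM⟩ := hDc.isBounded.exists_norm_le
  have hM0 : 0 ≤ M := (norm_nonneg _).trans (hM v₀ hv₀)
  set μ := v₀ 1 with hμ
  have hμ0 : 0 < μ := (hD hv₀).1.trans (hD hv₀).2
  set U := k * (2 * M / μ) with hU
  set C := 2 * k * |c| * M * (k / μ * Real.exp U) with hC
  refine ⟨C.toNNReal, LipschitzOnWith.of_dist_le_mul fun v hv w hw ↦ ?_⟩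
  have hcone : ∀ v ∈ D, cyl (v 0) (v 1) ∈ openCone := fun v hv ↦
    cyl_mem_openCone (hD hv).1.le (hD hv).2
  have h1 := hG.norm_sub_le _ (hcone v hv) _ (hcone w hw) μ hμ0 (hmin hv) (hmin hw)
  rw [norm_cyl_sub_cyl] at h1
  have h2 := hG.height_le _ (hcone v hv)
  have h3 : v 1 ≤ M := (le_abs_self _).trans ((PiLp.norm_apply_le v 1).trans (hM v hv))
  have h4 : G (cyl (v 0) (v 1)) 3 ≤ 2 * k * |c| * M :=
    h2.trans (mul_le_mul_of_nonneg_left h3 (by positivity))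
  set u := k * (‖v - w‖ / μ) with hu
  have hu0 : 0 ≤ u := by positivity
  have huU : u ≤ U := by
    have : ‖v - w‖ ≤ 2 * M := (_root_.norm_sub_le _ _).trans (by linarith [hM v hv, hM w hw])
    rw [hu, hU]
    gcongr
  have h5 : Real.exp u - 1 ≤ u * Real.exp U := by
    have h6 := Real.add_one_le_exp (-u)
    have h7 : Real.exp u * Real.exp (-u) = 1 := by rw [← Real.exp_add]; simp
    have h8 : Real.exp u * (1 - u) ≤ 1 := by
      rw [← h7]; exact mul_le_mul_of_nonneg_left (by linarith) (Real.exp_pos u).le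
    have h9 := mul_le_mul_of_nonneg_left (Real.exp_le_exp.2 huU) hu0
    linarith
  rw [dist_eq_norm, dist_eq_norm, Real.coe_toNNReal _ (by positivity)]
  calc ‖G (cyl (v 0) (v 1)) - G (cyl (w 0) (w 1))‖
      ≤ 2 * k * |c| * M * (u * Real.exp U) :=
        h1.trans (mul_le_mul h4 h5 (by linarith [Real.one_le_exp hu0]) (by positivity))
    _ = C * ‖v - w‖ := by rw [hC, hu]; ring

theorem exists_lipschitzOnWith_planar (hG : IsConeLimit k s c G) (hk : 0 ≤ k)
    {D : Set (EuclideanSpace ℝ (Fin 2))} (hD : D ⊆ sector) (hDc : IsCompact D) :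
    ∃ C : ℝ≥0, LipschitzOnWith C (planar G) D := by
  obtain ⟨C, hC⟩ := hG.exists_lipschitzOnWith_cyl hk hD hDc
  set Y : EuclideanSpace ℝ (Fin 2) → E4 := fun w ↦ G (cyl (w 0) (w 1)) with hY
  obtain ⟨M, hM⟩ := (hDc.image_of_continuousOn hC.continuousOn).isBounded.exists_norm_le
  set P : E4 → EuclideanSpace ℝ (Fin 2) := fun y ↦ !₂[radSq y, y 3] with hP
  have hPc : ContDiff ℝ 1 P := by
    rw [contDiff_euclidean]
    intro i
    fin_cases i
    · change ContDiff ℝ 1 fun y : E4 ↦ y 0 ^ 2 + y 1 ^ 2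
      fun_prop
    · change ContDiff ℝ 1 fun y : E4 ↦ y 3
      fun_prop
  obtain ⟨K, hK⟩ := hPc.contDiffOn.exists_lipschitzOnWith one_ne_zero (convex_closedBall 0 M)
    (isCompact_closedBall (0 : E4) M)
  exact ⟨K * C, hK.comp hC fun v hv ↦ by simpa using hM _ (mem_image_of_mem Y hv)⟩

/-- The signs `s` and `c` agree: otherwise the induced map of the sector would reverse the
orientation, although it has degree one. -/
theorem nonneg_mul (hG : IsConeLimit k s c G) (hk : 1 ≤ k) (hs : s = 1 ∨ s = -1)
    (hdet : ∀ x ∈ openCone, DifferentiableAt ℝ G x → 0 ≤ (fderiv ℝ G x).det) : 0 ≤ s * c := by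
  by_contra! hneg
  have hk0 : 0 < k := by linarith
  have hcone : ∀ v ∈ sector, cyl (v 0) (v 1) ∈ openCone := fun v hv ↦
    cyl_mem_openCone hv.1.le hv.2
  have hc0 : 0 < |c| := abs_pos.2 fun h ↦ by simp [h] at hneg
  set A := 2 * k * |c| with hA
  -- the constants in the bounds for the height (`a₁`, `A`) and for the squared radius (`a₂`, `b₂`)
  set a₁ := |c| / (2 * k) with ha₁
  set a₂ := a₁ ^ 2 / (2 * k) ^ 2 with ha₂
  set b₂ := (2 * k) ^ 2 * A ^ 2 with hb₂
  have hheight : ∀ v ∈ sector, a₁ * v 1 ≤ G (cyl (v 0) (v 1)) 3 ∧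
      G (cyl (v 0) (v 1)) 3 ≤ A * v 1 := by
    intro v hv
    have h1 := hG.le_height _ (hcone v hv)
    refine ⟨?_, hG.height_le _ (hcone v hv)⟩
    rw [ha₁, div_mul_eq_mul_div, div_le_iff₀ (by positivity)]
    rw [cyl_apply_three] at h1
    linarith
  have hradius : ∀ v ∈ sector, a₂ * v 0 ^ 2 ≤ radSq (G (cyl (v 0) (v 1))) ∧
      radSq (G (cyl (v 0) (v 1))) ≤ b₂ * v 0 ^ 2 := by
    intro v hv
    have h1 := hG.radSq_le _ (hcone v hv)
    have h2 := hG.le_radSq _ (hcone v hv)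
    obtain ⟨h3, h4⟩ := hheight v hv
    have hv0 : 0 < v 0 := hv.1
    have hv1 : 0 < v 1 := hv.1.trans hv.2
    set g := G (cyl (v 0) (v 1)) with hg
    have hg0 : 0 < g 3 := hG.pos _ (hcone v hv)
    rw [radSq_cyl, cyl_apply_three] at h1 h2
    have h5 : (a₁ * v 1) ^ 2 ≤ g 3 ^ 2 := pow_le_pow_left₀ (by positivity) h3 2
    have h6 : g 3 ^ 2 ≤ (A * v 1) ^ 2 := pow_le_pow_left₀ hg0.le h4 2
    constructor
    · rw [div_le_iff₀ (by positivity)] at h2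
      have h7 : (2 * k) ^ 2 * (radSq g / g 3 ^ 2) * v 1 ^ 2
          = (2 * k) ^ 2 * radSq g * v 1 ^ 2 / g 3 ^ 2 := by ring
      rw [h7, le_div_iff₀ (by positivity)] at h2
      have h8 : v 0 ^ 2 * (a₁ * v 1) ^ 2 ≤ (2 * k) ^ 2 * radSq g * v 1 ^ 2 :=
        (mul_le_mul_of_nonneg_left h5 (by positivity)).trans h2
      rw [ha₂, div_mul_eq_mul_div, div_le_iff₀ (by positivity)]
      refine le_of_mul_le_mul_right (le_trans (le_of_eq ?_) (h8.trans (le_of_eq ?_)))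
        (show 0 < v 1 ^ 2 by positivity) <;> ring
    · rw [div_le_iff₀ (by positivity)] at h1
      have h8 := h1.trans (mul_le_mul_of_nonneg_left h6 (by positivity))
      refine h8.trans (le_of_eq ?_)
      rw [hb₂]
      field_simp
  refine not_forall_det_fderiv_nonpos (φ := planar G) (a := min 1 (min a₁ a₂))
    (b := max 1 (max A b₂)) (by positivity) (min_le_left _ _) (le_max_left _ _)
    (fun v hv ↦ ⟨le_trans ?_ (hradius v hv).1, (hradius v hv).2.trans ?_⟩)
    (fun v hv ↦ ⟨le_trans ?_ (hheight v hv).1, (hheight v hv).2.trans ?_⟩)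
    (fun D hD hDc _ ↦ hG.exists_lipschitzOnWith_planar hk0.le hD hDc) ?_
  · exact mul_le_mul_of_nonneg_right ((min_le_right _ _).trans (min_le_right _ _)) (sq_nonneg _)
  · exact mul_le_mul_of_nonneg_right ((le_max_right _ _).trans (le_max_right _ _)) (sq_nonneg _)
  · exact mul_le_mul_of_nonneg_right ((min_le_right _ _).trans (min_le_left _ _))
      (hv.1.trans hv.2).le
  · exact mul_le_mul_of_nonneg_right ((le_max_left _ _).trans (le_max_right _ _))
      (hv.1.trans hv.2).le
  · intro D hD hDc _
    obtain ⟨C, hC⟩ := hG.exists_lipschitzOnWith_cyl hk0.le hD hDc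
    filter_upwards [hC.ae_differentiableWithinAt_of_mem (μ := volume)] with v hv hvD
    have hvs := hD (interior_subset hvD)
    obtain ⟨h1, h2⟩ := hG.det_fderiv_eq hs hvs
      ((hv (interior_subset hvD)).differentiableAt (mem_interior_iff_mem_nhds.1 hvD))
    have h3 := hdet _ (hcone v hvs) h1
    have h4 : 0 < v 0 := hvs.1
    by_contra! h5
    have h6 := mul_neg_of_neg_of_pos hneg h5
    have h7 : 0 ≤ 2 * v 0 * (fderiv ℝ G (cyl (v 0) (v 1))).det := by positivity
    linarith

end IsConeLimit

end ConeLimit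

/-! ### Comparison of the angles -/

section Conclusion

/-- If the lift preserves the orientation, then the rotation angles agree: the sign by which they
could differ is the sign of the Jacobian determinant of a limit of blow-ups. -/
theorem IsConeLift.eq_one_of_det_pos {k α β : ℝ} {V : Set E4} {m : ℤ} {F : E4 → E4} {T : ℝ}
    (h : IsConeLift k V α β m F T) (hα : Irrational α) (hβ : Irrational β) {σ j : ℤ}
    (hσ : σ = 1 ∨ σ = -1) (hαβ : β = σ * α + j)
    (hdet : ∀ x ∈ V, DifferentiableAt ℝ F x → 0 < (fderiv ℝ F x).det) : σ = 1 := by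
  classical
  have hex : ∀ x : E4, ∃ y : E4, x ∈ openCone →
      Tendsto (fun l ↦ blowUp k F l x) (hyperfilter ℕ : Filter ℕ) (𝓝 y) := by
    intro x
    by_cases hx : x ∈ openCone
    · obtain ⟨y, hy⟩ := h.exists_tendsto_blowUp hβ hx
      exact ⟨y, fun _ ↦ hy⟩
    · exact ⟨0, fun hx' ↦ absurd hx' hx⟩
  choose G hG using hex
  obtain ⟨q, hq⟩ := h.exists_tendsto_scale
  have hlim := h.isConeLimit hα hσ hαβ hG hq
  have hs : m * σ = 1 ∨ m * σ = -1 := by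
    rcases h.eq_or with rfl | rfl <;> rcases hσ with rfl | rfl <;> simp
  have h1 := hlim.nonneg_mul h.one_le hs fun x hx hd ↦ h.limit_det_nonneg hdet hG hx hd
  have hm : (m : ℝ) * m = 1 := by rcases h.eq_or with rfl | rfl <;> simp
  have h2 : ((m * σ : ℤ) : ℝ) * (m * q) = σ * q := by
    push_cast
    linear_combination σ * q * hm
  have hq0 : 0 ≤ q := by
    refine ge_of_tendsto hq ?_
    filter_upwards [h.eventually_le_basePoint.filter_mono Nat.hyperfilter_le_atTop] with l hl
    have h0 := h.height_map_basePoint_pos hl.2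
    positivity
  have hq1 : q ≠ 0 := by
    rintro rfl
    have hp := h.cyl_one_mem_openCone
    have h3 := hlim.height_le _ hp
    have h4 := hlim.pos _ hp
    simp only [mul_zero, abs_zero, zero_mul] at h3
    linarith
  rw [h2] at h1
  rcases hσ with rfl | rfl
  · rfl
  · push_cast at h1
    exact absurd (le_antisymm (by linarith) hq0) hq1

end Conclusion

theorem theoremB (ε : ℝ) (hε : 0 < ε) (α β : ℝ) (hα : Irrational α) (hβ : Irrational β)
    (f : MargulisCusp ε α → MargulisCusp ε β) (hf : IsBiLipschitzEmbedding f) :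
    (IsOrientationPreserving f → (α : UnitAddCircle) = (β : UnitAddCircle)) ∧
      ((α : UnitAddCircle) = (β : UnitAddCircle) ∨ (α : UnitAddCircle) = -(β : UnitAddCircle)) := by
  obtain ⟨k, V, m, F, T, hF, h⟩ := exists_isConeLift hε hα hβ hf
  obtain ⟨σ, j, hσ, hαβ⟩ := h.eq_or_eq_neg hα hβ
  have hj : ((j : ℝ) : UnitAddCircle) = 0 := by
    rw [AddCircle.coe_eq_zero_iff]
    exact ⟨j, by simp⟩
  refine ⟨fun hor ↦ ?_, ?_⟩
  · have h1 : σ = 1 := h.eq_one_of_det_pos hα hβ hσ hαβ fun x hx ↦ hor V F hF x hx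
    rw [hαβ, h1, AddCircle.coe_add, hj]
    simp
  · rcases hσ with rfl | rfl
    · left
      rw [hαβ, AddCircle.coe_add, hj]
      simp
    · right
      rw [hαβ, AddCircle.coe_add, hj]
      simp
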